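/- Let $d \ge 1$ and fix $\rho \ge \sqrt d$. For $A \subseteq \mathbb{R}^d$ put $\widetilde A := \{z \in \mathbb{Z}^d : B_\rho(z) \cap A \ne \emptyset\}$, where $B_\rho(z)$ is the closed Euclidean ball of radius $\rho$ centred at $z$. Call $A \subset \mathbb{R}^d$ Riemann measurable if it is bounded with Lebesgue-null boundary, and write $|A|$ for its Lebesgue measure. Let $B_0 \subset \mathbb{R}^d$ be Riemann measurable with $|B_0| > 0$, and let $\mathcal{R}(B_0)$ be the collection of Riemann measurable subsets of $B_0$. Let $(E, \mathcal{E}, P_0)$ be a probability space and let $X = (X_z)_{z \in \mathbb{Z}^d}$ be i.i.d. random elements of $E$ with law $P_0$; let $X_*$ be a further random element with law $P_0$, independent of $X$. For $y \in \mathbb{Z}^d$ let $\tau_y X := (X_{z+y})_{z \in \mathbb{Z}^d}$, let $X^{\mathbf 0}$ be $X$ with the value at the origin replaced by $X_*$, and let $\mathcal{F}_{\mathbf 0}$ be the $\sigma$-field generated by the $X_z$ with $z \preceq \mathbf 0$ in the lexicographic order on $\mathbb{Z}^d$. A random set function on $B_0$ is a family $H = (H_t(A) : t \ge 1,\ A \in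 \mathcal{R}(B_0))$ in which each $H_t(A) = H_t(X, A)$ is a real-valued measurable function of $(X_z,\ z \in \widetilde{tB_0})$. Its increments are $$\Delta^H_{t,y}(A) := H_t(\tau_y X, A) - H_t(\tau_y X^{\mathbf 0}, A), \qquad t \ge 1,\ y \in \mathbb{Z}^d,\ A \in \mathcal{R}(B_0).$$ Let $H^1, \dots, H^k$ be random set functions on $B_0$ such that, for each $i$: (a) there is a random variable $\Delta^{i}_\infty$ such that for every $A \in \mathcal{R}(B_0)$ and every sequence $(t_n, y_n)_{n \ge 1}$ in $[1,\infty) \times \mathbb{Z}^d$, with $\liminf_n S_n := \bigcup_n \bigcap_{m \ge n} S_m$ for sets $S_n$, $$\Delta^{H^i}_{t_n,y_n}(A) \xrightarrow{P} \Delta^{i}_\infty \quad \text{if } \liminf_{n} \,(y_n + t_n A) = \mathbb{R}^d,$$ $$\Delta^{H^i}_{t_n,y_n}(A) \xrightarrow{P} 0 \quad \text{if } \liminf_{n} \,(y_n + t_n (B_0 \setminus A)) = \mathbb{R}^d;$$ (b) there is $\gamma > 2$ (possibly depending on $i$) such that $\sup\{ \mathbb{E}[|\Delta^{H^i}_{t,-y}(A)|^\gamma]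 : A \in \mathcal{R}(B_0),\ t \ge 1,\ y \in \widetilde{tB_0} \} < \infty$. Put $\sigma^*_{ij} := \mathbb{E}\big[\mathbb{E}(\Delta^{i}_\infty \mid \mathcal{F}_{\mathbf 0})\, \mathbb{E}(\Delta^{j}_\infty \mid \mathcal{F}_{\mathbf 0})\big]$ and let $A_1, \dots, A_k \in \mathcal{R}(B_0)$. Then all $\Delta^i_\infty$ and all $H^i_t(A_i)$, $t \ge 1$, are square integrable; for all $i, j \in \{1, \dots, k\}$, $$\lim_{t \to \infty} t^{-d}\, \mathrm{Cov}(H^i_t(A_i), H^j_t(A_j)) = \sigma^*_{ij}\, |A_i \cap A_j|;$$ the matrix $(\sigma^*_{ij} |A_i \cap A_j|)_{i,j=1}^k$ is nonnegative definite; and as $t \to \infty$ $$\big( t^{-d/2} ( H^i_t(A_i) - \mathbb{E} H^i_t(A_i) ) \big)_{i=1}^k \xrightarrow{\mathcal{D}} \mathcal{N}\big(\mathbf 0, (\sigma^*_{ij} |A_i \cap A_j|)_{i,j=1}^k\big),$$ the centred (possibly degenerate) multivariate normal distribution with that covariance matrix. -/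

import Mathlib

open MeasureTheory ProbabilityTheory Filter Topology
open scoped Pointwise ENNReal NNReal

namespace LatticeCLT

/-- A set is Riemann (Jordan) measurable if it is bounded with Lebesgue-null boundary. -/
def IsRiemannMeasurable {d : ℕ} (A : Set (EuclideanSpace ℝ (Fin d))) : Prop :=
  Bornology.IsBounded A ∧ volume (frontier A) = 0

/-- The collection `𝓡(B₀)` of Riemann measurable subsets of `B₀`. -/
abbrev RiemannSubset {d : ℕ} (B₀ : Set (EuclideanSpace ℝ (Fin d))) : Type :=
  {A : Set (EuclideanSpace ℝ (Fin d)) // IsRiemannMeasurable A ∧ A ⊆ B₀}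

/-- The inclusion of `ℤ^d` in `ℝ^d`. -/
noncomputable def latticePoint {d : ℕ} (z : Fin d → ℤ) : EuclideanSpace ℝ (Fin d) :=
  WithLp.toLp 2 fun i => (z i : ℝ)

/-- The discretization of `A`: the lattice points whose closed `ρ`-ball meets `A`. -/
def discretization {d : ℕ} (ρ : ℝ) (A : Set (EuclideanSpace ℝ (Fin d))) : Set (Fin d → ℤ) :=
  {z | (Metric.closedBall (latticePoint z) ρ ∩ A).Nonempty}

/-- The lower limit `⋃ₙ ⋂_{m ≥ n} Sₘ` of a sequence of sets. -/
def setLiminf {α : Type*} (S : ℕ → Set α) : Set α :=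
  ⋃ n, ⋂ m, ⋂ (_ : n ≤ m), S m

/-- The translated configuration `τ_y x = (x_{z+y})_z`. -/
def shift {d : ℕ} {E : Type*} (y : Fin d → ℤ) (x : (Fin d → ℤ) → E) : (Fin d → ℤ) → E :=
  fun z => x (z + y)

/-- A random set function on `B₀`: for every `t ≥ 1` and every Riemann measurable `A ⊆ B₀`, a
measurable real function of the configuration on the discretization of `t B₀`. -/
structure RandomSetFunction {d : ℕ} (E : Type*) [MeasurableSpace E] (ρ : ℝ)
    (B₀ : Set (EuclideanSpace ℝ (Fin d))) where
  toFun : ∀ t : Set.Ici (1 : ℝ), RiemannSubset B₀ →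
    (discretization ρ ((t : ℝ) • B₀) → E) → ℝ
  measurable_toFun : ∀ t A, Measurable (toFun t A)

namespace RandomSetFunction

variable {d : ℕ} {E : Type*} [MeasurableSpace E] {ρ : ℝ} {B₀ : Set (EuclideanSpace ℝ (Fin d))}

/-- `H_t(x, A)` for a configuration `x` on the whole lattice. -/
def eval (H : RandomSetFunction E ρ B₀) (t : Set.Ici (1 : ℝ)) (x : (Fin d → ℤ) → E)
    (A : RiemannSubset B₀) : ℝ :=
  H.toFun t A fun z => x z

/-- The random variable `H_t(A) = H_t(X, A)`. -/
def var {Ω : Type*} (H : RandomSetFunction E ρ B₀) (X : (Fin d → ℤ) → Ω → E)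
    (t : Set.Ici (1 : ℝ)) (A : RiemannSubset B₀) (ω : Ω) : ℝ :=
  H.eval t (fun z => X z ω) A

/-- The increment `Δ_{t,y}(A) = H_t(τ_y X, A) - H_t(τ_y X⁰, A)`, where `X⁰` is the field `X` with
its value at the origin replaced by `Xs`. -/
def increment {Ω : Type*} (H : RandomSetFunction E ρ B₀) (X : (Fin d → ℤ) → Ω → E) (Xs : Ω → E)
    (t : Set.Ici (1 : ℝ)) (y : Fin d → ℤ) (A : RiemannSubset B₀) (ω : Ω) : ℝ :=
  H.eval t (shift y fun z => X z ω) A -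
    H.eval t (shift y (Function.update (fun z => X z ω) 0 (Xs ω))) A

/-- The two stabilization conditions, with limiting increment the random variable `D`. -/
def Stabilizes {Ω : Type*} [MeasurableSpace Ω] (P : Measure Ω) (H : RandomSetFunction E ρ B₀)
    (X : (Fin d → ℤ) → Ω → E) (Xs : Ω → E) (D : Ω → ℝ) : Prop :=
  Measurable D ∧
  ∀ (A : RiemannSubset B₀) (t : ℕ → Set.Ici (1 : ℝ)) (y : ℕ → Fin d → ℤ),
    (setLiminf (fun n => latticePoint (y n) +ᵥ ((t n : ℝ) • (A : Set (EuclideanSpace ℝ (Fin d))))) = Set.univ →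
      TendstoInMeasure P (fun n => H.increment X Xs (t n) (y n) A) atTop D) ∧
    (setLiminf (fun n => latticePoint (y n) +ᵥ ((t n : ℝ) • (B₀ \ (A : Set (EuclideanSpace ℝ (Fin d)))))) = Set.univ →
      TendstoInMeasure P (fun n => H.increment X Xs (t n) (y n) A) atTop (fun _ => 0))

/-- The moments condition: for some `γ > 2`, the `γ`-th absolute moments of the increments
`Δ_{t,-y}(A)` are bounded uniformly in `A`, `t ≥ 1` and `y` in the discretization of `t B₀`. -/
def BoundedMoments {Ω : Type*} [MeasurableSpace Ω] (P : Measure Ω) (H : RandomSetFunction E ρ B₀)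
    (X : (Fin d → ℤ) → Ω → E) (Xs : Ω → E) : Prop :=
  ∃ γ : ℝ, 2 < γ ∧ ∃ C : ℝ≥0, ∀ (A : RiemannSubset B₀) (t : Set.Ici (1 : ℝ)),
    ∀ y ∈ discretization ρ ((t : ℝ) • B₀),
      ∫⁻ ω, ‖H.increment X Xs t (-y) A ω‖ₑ ^ γ ∂P ≤ C

end RandomSetFunction

/-- The σ-field `𝓕_y` generated by the `X_z` with `z` at or before `y` in the lexicographic
order. -/
abbrev lexPast {d : ℕ} {Ω E : Type*} [MeasurableSpace E] (X : (Fin d → ℤ) → Ω → E)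
    (y : Fin d → ℤ) : MeasurableSpace Ω :=
  ⨆ (z : Fin d → ℤ) (_ : toLex z ≤ toLex y), MeasurableSpace.comap (X z) inferInstance

/-- `σ*_{ij} = 𝔼[𝔼(D_i | 𝓕_0) 𝔼(D_j | 𝓕_0)]`. -/
noncomputable def sigmaStar {d k : ℕ} {Ω E : Type*} [MeasurableSpace Ω] [MeasurableSpace E]
    (P : Measure Ω) (X : (Fin d → ℤ) → Ω → E) (D : Fin k → Ω → ℝ) (i j : Fin k) : ℝ :=
  ∫ ω, (P[D i | lexPast X 0]) ω * (P[D j | lexPast X 0]) ω ∂P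

/-- The matrix with entries `σ*_{ij} |A_i ∩ A_j|`. -/
noncomputable def limitCov {d k : ℕ} {Ω E : Type*} [MeasurableSpace Ω] [MeasurableSpace E]
    (P : Measure Ω) (X : (Fin d → ℤ) → Ω → E) (D : Fin k → Ω → ℝ)
    {B₀ : Set (EuclideanSpace ℝ (Fin d))} (A : Fin k → RiemannSubset B₀) :
    Matrix (Fin k) (Fin k) ℝ :=
  Matrix.of fun i j =>
    sigmaStar P X D i j * volume.real ((A i : Set (EuclideanSpace ℝ (Fin d))) ∩ A j)

end LatticeCLT

/-! Order the sites lexicographically. Revealing the coordinates in this order decomposes the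
centred `H_t(A)` into martingale differences `E(H_t(A) | F_y) - E(H_t(A) | F_{<y})`, with `y` in the
discretization of `t B₀` (`sub_integral_ae_eq_sum_pastDifference`). Averaging over a fresh value at
a site is conditioning on all other sites, so such a difference is the conditional expectation,
given the past up to `y`, of the change of `H_t(A)` when the value at `y` is resampled. Seen from
`y`, this is `E(Δ_{t,-y}(A) | F_0)` (`condExp_resampling_increment`).

Let `g = E(Δ_∞ | F_0)`. For `y = ⌊t x⌋` with `x` interior to `A`, stabilization sends the difference
seen from `y` to `g`; for `x` interior to `B₀ \ A` it sends it to `0`. The moments of order above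
two upgrade convergence in probability to mean square convergence, and conditioning contracts
(`exists_limit_pastDifference`). The points `x` left over are outside the closure of `B₀`, where
nothing contributes, or on a null boundary. Martingale differences are orthogonal, so the mean
square error of replacing `H_t(A) - E H_t(A)` by the stationary sum of `g ∘ τ_y` over the lattice
points `y` of `t A` is a sum of errors site by site. Divided by `t^d`, it is the integral over `x`
of the error at `⌊t x⌋`, which vanishes by dominated convergence
(`tendsto_integral_sq_centred_sub`).

It remains to treat the stationary sums. By orthogonality the covariance of two of them is exactly
the number of lattice points in `t (A_i ∩ A_j)` times `E[g_i g_j]`, which gives the covariance limit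
and the nonnegativity of the matrix. For the distributional limit, a linear combination of the sums
is a single sum of martingale differences `w_y`. After truncation of the `g_i`, the product argument
applies: `∏ (1 + i w_y)` has mean one, `exp(i ∑ w_y)` is close to `∏ (1 + i w_y) exp(-w_y² / 2)`,
and `∑ w_y²` converges in mean to a constant (`norm_integral_exp_sum_sub_le`). The last point is a
law of large numbers for the products `g_i g_j`, which follows from mixing of the i.i.d. field.

Everything is proved on the canonical product space and carried to `Ω` by the measure preserving map
`ω ↦ (X, Xs)`. -/

namespace LatticeCLT

/-! ### Conditional expectation: transport and contraction. -/

section CondExp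

variable {α β : Type*} {m : MeasurableSpace β} {mα : MeasurableSpace α} {mβ : MeasurableSpace β}

/-- Conditional expectation commutes with measure preserving maps. -/
theorem condExp_comp_measurePreserving {ν : Measure α} {μ : Measure β} [IsFiniteMeasure ν]
    [IsFiniteMeasure μ] {T : α → β} (hT : MeasurePreserving T ν μ)
    (hm : m ≤ mβ) {f : β → ℝ} (hf : Integrable f μ) :
    ν[f ∘ T | m.comap T] =ᵐ[ν] (μ[f | m]) ∘ T := by
  have hle : m.comap T ≤ mα := (MeasurableSpace.comap_mono hm).trans hT.measurable.comap_le
  refine (ae_eq_condExp_of_forall_setIntegral_eq hle ?_ ?_ ?_ ?_).symm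
  · exact hT.integrable_comp_of_integrable hf
  · intro s _ _
    exact (hT.integrable_comp_of_integrable integrable_condExp).integrableOn
  · rintro s ⟨u, hu, rfl⟩ _
    have key : ∀ k : β → ℝ, AEStronglyMeasurable k μ →
        ∫ x in T ⁻¹' u, (k ∘ T) x ∂ν = ∫ x in u, k x ∂μ := by
      intro k hk
      have hr := hT.restrict_preimage (hm _ hu)
      rw [← hr.map_eq, integral_map hr.measurable.aemeasurable]
      · rfl
      · rw [hr.map_eq]; exact hk.restrict
    rw [key _ integrable_condExp.1, key _ hf.1, setIntegral_condExp hm hf hu]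
  · exact (stronglyMeasurable_condExp.comp_measurable
      (comap_measurable T)).aestronglyMeasurable

/-- Conditional expectation contracts second moments. -/
theorem integral_sq_condExp_le {μ : Measure β} [IsFiniteMeasure μ]
    {f : β → ℝ} (hf : MemLp f 2 μ) :
    ∫ x, (μ[f | m]) x ^ 2 ∂μ ≤ ∫ x, f x ^ 2 ∂μ := by
  have h := integral_norm_condExp_rpow_le (μ := μ) (m := m) (f := f) (p := 2) (by norm_num)
    (by simpa using hf.integrable_sq)
  simpa using h

end CondExp

/-! ### Conditioning on sets of coordinates of a product space. -/

section Product

variable {ι E : Type*} [MeasurableSpace E] {P₀ : Measure E} [IsProbabilityMeasure P₀]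

open scoped Classical in
/-- Gluing two independent samples of a product measure gives a sample of it. -/
theorem measurePreserving_piecewise (S : Set ι) :
    MeasurePreserving (fun p : (ι → E) × (ι → E) => S.piecewise p.1 p.2)
      ((Measure.infinitePi fun _ : ι => P₀).prod (Measure.infinitePi fun _ : ι => P₀))
      (Measure.infinitePi fun _ : ι => P₀) := by
  have hmeas : Measurable (fun p : (ι → E) × (ι → E) => S.piecewise p.1 p.2) := by
    rw [measurable_pi_iff]
    intro z
    by_cases hz : z ∈ S
    · simp only [Set.piecewise_eq_of_mem _ _ _ hz]; fun_prop
    · simp only [Set.piecewise_eq_of_notMem _ _ _ hz]; fun_prop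
  refine ⟨hmeas, Measure.eq_infinitePi _ fun s t ht => ?_⟩
  rw [Measure.map_apply hmeas (.pi s.countable_toSet fun i _ => ht i)]
  have : (fun p : (ι → E) × (ι → E) => S.piecewise p.1 p.2) ⁻¹' (Set.pi s t)
      = (Set.pi (s.filter (· ∈ S) : Finset ι) t) ×ˢ (Set.pi (s.filter (· ∉ S) : Finset ι) t) := by
    ext p
    simp only [Set.mem_preimage, Set.mem_pi, Set.mem_prod, Finset.coe_filter, Set.mem_ofPred_eq,
      Finset.mem_coe]
    constructor
    · intro h
      refine ⟨fun i hi => ?_, fun i hi => ?_⟩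
      · simpa [hi.2] using h i hi.1
      · simpa [hi.2] using h i hi.1
    · rintro ⟨h1, h2⟩ i hi
      by_cases hS : i ∈ S
      · simpa [hS] using h1 i ⟨hi, hS⟩
      · simpa [hS] using h2 i ⟨hi, hS⟩
  rw [this, Measure.prod_prod, Measure.infinitePi_pi _ fun i _ => ht i,
    Measure.infinitePi_pi _ fun i _ => ht i, Finset.prod_filter_mul_prod_filter_not]

/-- An event of this σ-field is a preimage under restriction to `S`, so it cannot see the other
coordinates. -/
theorem mem_iff_of_measurableSet_cylinderEvents {S : Set ι} {B : Set (ι → E)}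
    (hB : MeasurableSet[cylinderEvents S] B) {x y : ι → E} (hxy : ∀ z ∈ S, x z = y z) :
    x ∈ B ↔ y ∈ B := by
  have hle : cylinderEvents (X := fun _ : ι => E) S ≤
      MeasurableSpace.comap (S.domRestrict) inferInstance := by
    refine iSup₂_le fun i hi => ?_
    rintro _ ⟨u, hu, rfl⟩
    exact ⟨(fun f : S → E => f ⟨i, hi⟩) ⁻¹' u, measurable_pi_apply _ hu, rfl⟩
  obtain ⟨C, -, rfl⟩ := hle _ hB
  have : S.domRestrict x = S.domRestrict y := by
    ext z; exact hxy z z.2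
  simp only [Set.mem_preimage, this]

-- The glued point reads `x` only on `S`, and `f` reads only `T`. Coarsening the σ-field on the
-- first factor to that of `S ∩ T` lets Fubini measurability deliver the smaller σ-field.
open scoped Classical in
theorem stronglyMeasurable_integral_piecewise {S T : Set ι} {f : (ι → E) → ℝ}
    (hf : StronglyMeasurable[cylinderEvents T] f) :
    StronglyMeasurable[cylinderEvents (S ∩ T)]
      (fun x => ∫ x', f (S.piecewise x x') ∂(Measure.infinitePi fun _ : ι => P₀)) := by
  have hp : @Measurable _ _ (@Prod.instMeasurableSpace _ _ (cylinderEvents (S ∩ T)) MeasurableSpace.pi)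
      (cylinderEvents T) (fun p : (ι → E) × (ι → E) => S.piecewise p.1 p.2) := by
    refine @measurable_cylinderEvents_iff _ _ _
      (@Prod.instMeasurableSpace _ _ (cylinderEvents (S ∩ T)) MeasurableSpace.pi) _ _ _ |>.2 ?_
    intro z hz
    by_cases hzS : z ∈ S
    · simp only [Set.piecewise_eq_of_mem _ _ _ hzS]
      exact (measurable_cylinderEvent_apply (X := fun _ : ι => E)
        (show z ∈ S ∩ T from ⟨hzS, hz⟩)).comp
        (@measurable_fst _ _ (cylinderEvents (S ∩ T)) MeasurableSpace.pi)
    · simp only [Set.piecewise_eq_of_notMem _ _ _ hzS]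
      exact (measurable_pi_apply z).comp
        (@measurable_snd _ _ (cylinderEvents (S ∩ T)) MeasurableSpace.pi)
  exact @StronglyMeasurable.integral_prod_right' _ _ _ (cylinderEvents (S ∩ T)) _ _ _ _ _ _
    (hf.comp_measurable hp)

open scoped Classical in
/-- In a product space, conditioning on the coordinates in `S` integrates out the others. -/
theorem condExp_cylinderEvents_ae_eq_integral (S : Set ι) {f : (ι → E) → ℝ}
    (hf : Integrable f (Measure.infinitePi fun _ : ι => P₀)) (hfm : StronglyMeasurable f) :
    (Measure.infinitePi fun _ : ι => P₀)[f | cylinderEvents S]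
      =ᵐ[Measure.infinitePi fun _ : ι => P₀]
    fun x => ∫ x', f (S.piecewise x x') ∂(Measure.infinitePi fun _ : ι => P₀) := by
  set μ := Measure.infinitePi fun _ : ι => P₀
  have hpw := measurePreserving_piecewise (P₀ := P₀) S
  have hintg : Integrable (fun p : (ι → E) × (ι → E) => f (S.piecewise p.1 p.2)) (μ.prod μ) :=
    hpw.integrable_comp_of_integrable hf
  refine (ae_eq_condExp_of_forall_setIntegral_eq cylinderEvents_le_pi hf ?_ ?_ ?_).symm
  · intro s _ _
    exact hintg.integral_prod_left.integrableOn
  · intro s hs _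
    have hs' : MeasurableSet s := cylinderEvents_le_pi _ hs
    rw [← integral_indicator hs', ← integral_indicator hs']
    have h1 : ∫ x, s.indicator f x ∂μ
        = ∫ p, s.indicator f (S.piecewise p.1 p.2) ∂(μ.prod μ) := by
      conv_lhs => rw [show μ = _ from hpw.map_eq.symm]
      exact integral_map hpw.measurable.aemeasurable (hfm.indicator hs').aestronglyMeasurable
    rw [h1, integral_prod]
    · refine integral_congr_ae (Eventually.of_forall fun x => ?_)
      -- The event depends on `S` only, so its indicator comes out of the inner integral.
      have hiff : ∀ x', S.piecewise x x' ∈ s ↔ x ∈ s := fun x' =>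
        mem_iff_of_measurableSet_cylinderEvents hs fun z hz => by simp [hz]
      by_cases hx : x ∈ s
      · simp [Set.indicator, hx, hiff]
      · simp [Set.indicator, hx, hiff]
    · exact hpw.integrable_comp_of_integrable (hf.indicator hs')
  · have := stronglyMeasurable_integral_piecewise (P₀ := P₀) (S := S) (T := Set.univ) (f := f)
      (by rwa [cylinderEvents_univ])
    rw [Set.inter_univ] at this
    exact this.aestronglyMeasurable

/-- Integrating out the coordinates off `S` leaves a function of those in `S ∩ T`; conditioning it
further on `S ∩ T` changes nothing, and the tower property concludes. Independence of the
coordinates enters through the integral formula. -/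
theorem condExp_cylinderEvents_inter_of_stronglyMeasurable (S : Set ι) {T : Set ι}
    {f : (ι → E) → ℝ} (hf : Integrable f (Measure.infinitePi fun _ : ι => P₀))
    (hfm : StronglyMeasurable[cylinderEvents T] f) :
    (Measure.infinitePi fun _ : ι => P₀)[f | cylinderEvents S]
      =ᵐ[Measure.infinitePi fun _ : ι => P₀]
    (Measure.infinitePi fun _ : ι => P₀)[f | cylinderEvents (S ∩ T)] := by
  set μ := Measure.infinitePi fun _ : ι => P₀
  have h1 := condExp_cylinderEvents_ae_eq_integral S hf (hfm.mono cylinderEvents_le_pi)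
  have h2 : AEStronglyMeasurable[cylinderEvents (S ∩ T)] (μ[f | cylinderEvents S]) μ :=
    ⟨_, stronglyMeasurable_integral_piecewise (P₀ := P₀) hfm, h1⟩
  have h3 := condExp_of_aestronglyMeasurable' (μ := μ)
    (cylinderEvents_le_pi (X := fun _ : ι => E) (Δ := S ∩ T)) h2 integrable_condExp
  exact h3.symm.trans (condExp_condExp_of_le (cylinderEvents_mono Set.inter_subset_left)
    cylinderEvents_le_pi)

/-- In a product space, the conditional expectations given the coordinates in `S` and those
in `T` commute, and compose to the one given the coordinates in `S ∩ T`. -/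
theorem condExp_condExp_cylinderEvents (S T : Set ι) {f : (ι → E) → ℝ} :
    (Measure.infinitePi fun _ : ι => P₀)[(Measure.infinitePi fun _ : ι => P₀)[f | cylinderEvents S] |
        cylinderEvents T]
      =ᵐ[Measure.infinitePi fun _ : ι => P₀]
    (Measure.infinitePi fun _ : ι => P₀)[f | cylinderEvents (T ∩ S)] :=
  (condExp_cylinderEvents_inter_of_stronglyMeasurable T integrable_condExp
    stronglyMeasurable_condExp).trans (condExp_condExp_of_le
      (cylinderEvents_mono Set.inter_subset_right) cylinderEvents_le_pi)

end Product

/-! ### Lattice shifts of the field. -/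

section Shift

theorem shift_shift {d : ℕ} {E : Type*} (y y' : Fin d → ℤ) (x : (Fin d → ℤ) → E) :
    shift y (shift y' x) = shift (y + y') x := by
  funext z; simp [shift, add_assoc]

theorem shift_neg_shift {d : ℕ} {E : Type*} (y : Fin d → ℤ) (x : (Fin d → ℤ) → E) :
    shift (-y) (shift y x) = x := by
  funext z; simp [shift]

variable {d : ℕ} {E : Type*} [MeasurableSpace E]

@[fun_prop]
theorem measurable_shift (y : Fin d → ℤ) : Measurable (shift (E := E) y) :=
  measurable_pi_iff.2 fun z => measurable_pi_apply (z + y)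

theorem measurePreserving_shift {P₀ : Measure E} [IsProbabilityMeasure P₀] (y : Fin d → ℤ) :
    MeasurePreserving (shift y) (Measure.infinitePi fun _ : Fin d → ℤ => P₀)
      (Measure.infinitePi fun _ : Fin d → ℤ => P₀) :=
  ⟨measurable_shift y, Measure.map_infinitePi_infinitePi_of_inj
    (P := fun _ : Fin d → ℤ => P₀) (f := fun z => z + y) (add_left_injective y)⟩

theorem comap_shift_cylinderEvents (y : Fin d → ℤ) (S : Set (Fin d → ℤ)) :
    (cylinderEvents (X := fun _ : Fin d → ℤ => E) S).comap (shift y)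
      = cylinderEvents ((fun z => z + y) '' S) := by
  simp only [cylinderEvents, MeasurableSpace.comap_iSup, MeasurableSpace.comap_comp, iSup_image]
  rfl

end Shift

/-! ### Martingale differences and a quantitative central limit theorem. -/

section MartingaleDifferences

/-- Telescoping by removal of the largest element `a`: its weak initial segment is the whole set,
its strict one is the rest, and the segments of smaller elements do not see `a`. It is meant for `Φ
S` a conditional expectation given the coordinates in `S`. -/
theorem sum_sub_eq_of_linearOrder {ι κ V : Type*} [LinearOrder κ] [AddCommGroup V] {r : ι → κ}
    (hr : Function.Injective r) (Φ : Set ι → V) (s : Finset ι) :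
    ∑ y ∈ s, (Φ ({z | r z ≤ r y} ∩ s) - Φ ({z | r z < r y} ∩ s)) = Φ s - Φ ∅ := by
  classical
  induction s using Finset.induction_on_max_value r with
  | empty => simp
  | insert a s ha hmax ih =>
    have hlt : ∀ x ∈ s, r x < r a := fun x hx =>
      lt_of_le_of_ne (hmax x hx) fun h => ha (hr h ▸ hx)
    rw [Finset.sum_insert ha]
    have h1 : {z | r z ≤ r a} ∩ ((insert a s : Finset ι) : Set ι) = (insert a s : Finset ι) := by
      ext z
      simp only [Set.mem_inter_iff, Set.mem_ofPred_eq, Finset.coe_insert, Set.mem_insert_iff,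
        Finset.mem_coe, and_iff_right_iff_imp]
      rintro (rfl | h)
      · exact le_rfl
      · exact hmax z h
    have h2 : {z | r z < r a} ∩ ((insert a s : Finset ι) : Set ι) = s := by
      ext z
      simp only [Set.mem_inter_iff, Set.mem_ofPred_eq, Finset.coe_insert, Set.mem_insert_iff,
        Finset.mem_coe]
      constructor
      · rintro ⟨h, rfl | h'⟩
        · exact absurd h (lt_irrefl _)
        · exact h'
      · exact fun h => ⟨hlt z h, Or.inr h⟩
    have h3 : ∑ y ∈ s, (Φ ({z | r z ≤ r y} ∩ (insert a s : Finset ι))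
        - Φ ({z | r z < r y} ∩ (insert a s : Finset ι)))
        = ∑ y ∈ s, (Φ ({z | r z ≤ r y} ∩ s) - Φ ({z | r z < r y} ∩ s)) := by
      refine Finset.sum_congr rfl fun y hy => ?_
      congr 2
      · ext z
        simp only [Set.mem_inter_iff, Set.mem_ofPred_eq, Finset.coe_insert, Set.mem_insert_iff,
          Finset.mem_coe]
        constructor
        · rintro ⟨h, rfl | h'⟩
          · exact absurd (h.trans_lt (hlt y hy)) (lt_irrefl _)
          · exact ⟨h, h'⟩
        · exact fun h => ⟨h.1, Or.inr h.2⟩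
      · ext z
        simp only [Set.mem_inter_iff, Set.mem_ofPred_eq, Finset.coe_insert, Set.mem_insert_iff,
          Finset.mem_coe]
        constructor
        · rintro ⟨h, rfl | h'⟩
          · exact absurd (h.trans (hlt y hy)) (lt_irrefl _)
          · exact ⟨h, h'⟩
        · exact fun h => ⟨h.1, Or.inr h.2⟩
    rw [h1, h2, h3, ih]
    abel

variable {Ω : Type*} {m mΩ : MeasurableSpace Ω} {μ : Measure Ω} [IsProbabilityMeasure μ]

/-- Pull `g` out of the conditional expectation and integrate. The values are taken in a Banach
space because `g` will also be a complex product. -/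
theorem integral_smul_eq_zero_of_condExp_eq_zero {F : Type*} [NormedAddCommGroup F]
    [NormedSpace ℝ F] [CompleteSpace F] (hm : m ≤ mΩ) {w : Ω → ℝ} {g : Ω → F}
    (hg : AEStronglyMeasurable[m] g μ) (hw : Integrable w μ)
    (hwg : Integrable (w • g) μ) (h0 : μ[w | m] =ᵐ[μ] 0) : ∫ x, w x • g x ∂μ = 0 := by
  have h1 := condExp_smul_of_aestronglyMeasurable_right hw hwg hg
  have h2 : μ[w • g | m] =ᵐ[μ] 0 := by
    filter_upwards [h1, h0] with x hx hx0
    simp [hx, hx0]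
  have h3 := integral_condExp (μ := μ) hm (f := w • g)
  rw [integral_congr_ae h2] at h3
  simpa using h3.symm

theorem integral_mul_eq_zero_of_condExp_eq_zero (hm : m ≤ mΩ) {w g : Ω → ℝ}
    (hg : AEStronglyMeasurable[m] g μ) (hw2 : MemLp w 2 μ) (hg2 : MemLp g 2 μ)
    (h0 : μ[w | m] =ᵐ[μ] 0) : ∫ x, w x * g x ∂μ = 0 :=
  integral_smul_eq_zero_of_condExp_eq_zero hm hg (hw2.integrable (by norm_num))
    (hw2.integrable_mul hg2) h0

variable {ι κ : Type*} [LinearOrder κ] {r : ι → κ} {F : ι → MeasurableSpace Ω}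

/-- Martingale differences are orthogonal. -/
theorem integral_sum_mul_sum_eq (hr : Function.Injective r) (hF : ∀ y, F y ≤ mΩ) {w v : ι → Ω → ℝ}
    (hw : ∀ y y', r y < r y' → AEStronglyMeasurable[F y'] (w y) μ)
    (hv : ∀ y y', r y < r y' → AEStronglyMeasurable[F y'] (v y) μ)
    (hw2 : ∀ y, MemLp (w y) 2 μ) (hv2 : ∀ y, MemLp (v y) 2 μ)
    (hw0 : ∀ y, μ[w y | F y] =ᵐ[μ] 0) (hv0 : ∀ y, μ[v y | F y] =ᵐ[μ] 0)
    (s t : Finset ι) [DecidableEq ι] :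
    ∫ x, (∑ y ∈ s, w y x) * (∑ y ∈ t, v y x) ∂μ = ∑ y ∈ s ∩ t, ∫ x, w y x * v y x ∂μ := by
  have hintg : ∀ y y', Integrable (fun x => w y x * v y' x) μ := fun y y' =>
    (hw2 y).integrable_mul (hv2 y')
  -- Condition at the later of the two indices, where the earlier factor is already measurable.
  have hz : ∀ y y', y ≠ y' → ∫ x, w y x * v y' x ∂μ = 0 := by
    intro y y' hne
    rcases lt_or_gt_of_ne (hr.ne hne) with h | h
    · simp_rw [mul_comm (w y _)]
      exact integral_mul_eq_zero_of_condExp_eq_zero (hF y') (hw y y' h) (hv2 y') (hw2 y) (hv0 y')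
    · exact integral_mul_eq_zero_of_condExp_eq_zero (hF y) (hv y' y h) (hw2 y) (hv2 y') (hw0 y)
  simp_rw [Finset.sum_mul_sum]
  rw [integral_finsetSum _ fun y _ => integrable_finsetSum _ fun y' _ => hintg y y']
  simp_rw [integral_finsetSum t fun y' _ => hintg _ y']
  rw [← Finset.filter_mem_eq_inter, Finset.sum_filter]
  refine Finset.sum_congr rfl fun y _ => ?_
  split_ifs with hy
  · exact Finset.sum_eq_single_of_mem y hy fun y' _ h => hz y y' h.symm
  · exact Finset.sum_eq_zero fun y' hy' => hz y y' fun h => hy (h ▸ hy')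

/-- Each factor satisfies `|1 + i w|² = 1 + w² ≤ exp(c²)`. -/
theorem ae_norm_prod_le {Ω ι : Type*} [MeasurableSpace Ω] {μ : Measure Ω} {w : ι → Ω → ℝ} {c : ℝ}
    (hb : ∀ y, ∀ᵐ x ∂μ, |w y x| ≤ c) (s : Finset ι) :
    ∀ᵐ x ∂μ, ‖∏ y ∈ s, (1 + (w y x : ℂ) * Complex.I)‖ ≤ Real.exp (s.card * c ^ 2 / 2) := by
  have : ∀ᵐ x ∂μ, ∀ y ∈ s, |w y x| ≤ c := (s.eventually_all (l := ae μ)).2 fun y _ => hb y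
  filter_upwards [this] with x hx
  rw [norm_prod]
  have : ∀ y ∈ s, ‖1 + (w y x : ℂ) * Complex.I‖ ≤ Real.exp (c ^ 2 / 2) := by
    intro y hy
    have h1 : ‖1 + (w y x : ℂ) * Complex.I‖ ^ 2 = 1 + w y x ^ 2 := by
      rw [← Complex.normSq_eq_norm_sq]; simp [Complex.normSq_apply]; ring
    have h2 : w y x ^ 2 ≤ c ^ 2 := sq_le_sq' (by linarith [(abs_le.1 (hx y hy)).1]) (abs_le.1 (hx y hy)).2
    have h3 : 1 + c ^ 2 ≤ Real.exp (c ^ 2 / 2) ^ 2 := by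
      rw [← Real.exp_nat_mul]
      have := Real.add_one_le_exp (c ^ 2)
      calc 1 + c ^ 2 ≤ Real.exp (c ^ 2) := by linarith
        _ = _ := by congr 1; push_cast; ring
    exact (pow_le_pow_iff_left₀ (norm_nonneg _) (Real.exp_pos _).le two_ne_zero).1 (by rw [h1]; linarith)
  calc _ ≤ ∏ y ∈ s, Real.exp (c ^ 2 / 2) :=
        Finset.prod_le_prod (fun _ _ => norm_nonneg _) this
    _ = _ := by rw [Finset.prod_const, ← Real.exp_nat_mul]; congr 1; ring

/-- Multiplying by the factor of the largest index `a` adds `i w_a` times a product of earlier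
factors. That product is measurable for `F a`, so the added term has mean zero. -/
theorem integral_prod_one_add_mul_I_eq_one (hr : Function.Injective r) (hF : ∀ y, F y ≤ mΩ)
    {w : ι → Ω → ℝ} (hw : ∀ y y', r y < r y' → AEStronglyMeasurable[F y'] (w y) μ)
    (hwm : ∀ y, AEStronglyMeasurable (w y) μ)
    {c : ℝ} (hb : ∀ y, ∀ᵐ x ∂μ, |w y x| ≤ c) (hw0 : ∀ y, μ[w y | F y] =ᵐ[μ] 0) (s : Finset ι) :
    ∫ x, ∏ y ∈ s, (1 + (w y x : ℂ) * Complex.I) ∂μ = 1 := by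
  classical
  have hTm : ∀ s : Finset ι, AEStronglyMeasurable
      (fun x => ∏ y ∈ s, (1 + (w y x : ℂ) * Complex.I)) μ := fun s =>
    Finset.aestronglyMeasurable_fun_prod _ fun y _ =>
      ((Complex.continuous_ofReal.comp_aestronglyMeasurable (hwm y)).mul_const _).const_add _
  have hTi : ∀ s : Finset ι, Integrable
      (fun x => ∏ y ∈ s, (1 + (w y x : ℂ) * Complex.I)) μ := fun s =>
    Integrable.of_bound (hTm s) _ (ae_norm_prod_le hb s)
  have hwi : ∀ y, Integrable (w y) μ := fun y => Integrable.of_bound (hwm y) c (hb y)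
  induction s using Finset.induction_on_max_value r with
  | empty => simp
  | insert a s ha hmax ih =>
    have hlt : ∀ x ∈ s, r x < r a := fun x hx =>
      lt_of_le_of_ne (hmax x hx) fun h => ha (hr h ▸ hx)
    have hwT : Integrable (w a • fun x => ∏ y ∈ s, (1 + (w y x : ℂ) * Complex.I)) μ := by
      have := (hTi s).bdd_mul (f := fun x => (w a x : ℂ)) (c := c)
        (Complex.continuous_ofReal.comp_aestronglyMeasurable (hwm a))
        (by filter_upwards [hb a] with x hx; simpa using hx)
      refine this.congr (Eventually.of_forall fun x => ?_)
      simp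
    have h0 : ∫ x, w a x • ∏ y ∈ s, (1 + (w y x : ℂ) * Complex.I) ∂μ = 0 := by
      refine integral_smul_eq_zero_of_condExp_eq_zero (hF a) ?_ (hwi a) hwT (hw0 a)
      have hy' : ∀ y ∈ s, AEStronglyMeasurable[F a] (fun x => 1 + (w y x : ℂ) * Complex.I) μ :=
        fun y hy => ((Complex.continuous_ofReal.comp_aestronglyMeasurable
          (hw y a (hlt y hy))).mul_const _).const_add _
      clear ih hwT ha hmax hlt
      induction s using Finset.induction_on with
      | empty => simpa using aestronglyMeasurable_const
      | insert b s hb' ih =>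
        simp_rw [Finset.prod_insert hb']
        exact (hy' b (Finset.mem_insert_self _ _)).mul
          (ih fun y hy => hy' y (Finset.mem_insert_of_mem hy))
    have h1 : ∀ x, ∏ y ∈ insert a s, (1 + (w y x : ℂ) * Complex.I)
        = ∏ y ∈ s, (1 + (w y x : ℂ) * Complex.I)
          + Complex.I * (w a x • ∏ y ∈ s, (1 + (w y x : ℂ) * Complex.I)) := by
      intro x
      rw [Finset.prod_insert ha, Complex.real_smul]; ring
    simp_rw [h1]
    have hwT' : Integrable (fun x => Complex.I * (w a x •
        ∏ y ∈ s, (1 + (w y x : ℂ) * Complex.I))) μ := hwT.const_mul _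
    rw [integral_add (hTi s) hwT', integral_const_mul, ih, h0]
    simp

/-- Exchange one factor at a time; the remaining factors, of modulus at most one, do not amplify the
error. -/
theorem norm_prod_sub_prod_le_sum {ι : Type*} (s : Finset ι) (a b : ι → ℂ)
    (ha : ∀ y ∈ s, ‖a y‖ ≤ 1) (hb : ∀ y ∈ s, ‖b y‖ ≤ 1) :
    ‖∏ y ∈ s, a y - ∏ y ∈ s, b y‖ ≤ ∑ y ∈ s, ‖a y - b y‖ := by
  classical
  induction s using Finset.induction_on with
  | empty => simp
  | insert z s hz ih =>
    rw [Finset.prod_insert hz, Finset.prod_insert hz, Finset.sum_insert hz]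
    have ih' := ih (fun y hy => ha y (Finset.mem_insert_of_mem hy))
      (fun y hy => hb y (Finset.mem_insert_of_mem hy))
    have h1 : ‖∏ y ∈ s, b y‖ ≤ 1 := by
      rw [norm_prod]
      exact Finset.prod_le_one (fun _ _ => norm_nonneg _)
        fun y hy => hb y (Finset.mem_insert_of_mem hy)
    calc ‖a z * ∏ y ∈ s, a y - b z * ∏ y ∈ s, b y‖
        = ‖(a z - b z) * ∏ y ∈ s, b y + a z * (∏ y ∈ s, a y - ∏ y ∈ s, b y)‖ := by ring_nf
      _ ≤ ‖a z - b z‖ * ‖∏ y ∈ s, b y‖ + ‖a z‖ * ‖∏ y ∈ s, a y - ∏ y ∈ s, b y‖ := by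
          refine (norm_add_le _ _).trans ?_
          rw [norm_mul, norm_mul]
      _ ≤ ‖a z - b z‖ * 1 + 1 * ∑ y ∈ s, ‖a y - b y‖ := by
          have := ha z (Finset.mem_insert_self _ _)
          gcongr
      _ = _ := by ring

/-- After squaring this is `(1 + w²) exp(-w²) ≤ 1`. It makes the compensated factors admissible in
the factorwise comparison of products. -/
theorem norm_one_add_mul_I_mul_exp_le (w : ℝ) :
    ‖(1 + (w : ℂ) * Complex.I) * Real.exp (-w ^ 2 / 2)‖ ≤ 1 := by
  have h1 : ‖1 + (w : ℂ) * Complex.I‖ ^ 2 = 1 + w ^ 2 := by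
    rw [← Complex.normSq_eq_norm_sq]; simp [Complex.normSq_apply]; ring
  rw [norm_mul, Complex.norm_real, Real.norm_eq_abs, abs_of_pos (Real.exp_pos _)]
  refine (pow_le_pow_iff_left₀ (by positivity) zero_le_one two_ne_zero).1 ?_
  rw [mul_pow, h1, ← Real.exp_nat_mul]
  have h2 : ((2 : ℕ) : ℝ) * (-w ^ 2 / 2) = -w ^ 2 := by push_cast; ring
  rw [h2, Real.exp_neg, one_pow, ← div_eq_mul_inv, div_le_one (Real.exp_pos _)]
  linarith [Real.add_one_le_exp (w ^ 2)]

/-- Both terms are `1 + i w - w² / 2` up to third order. The constant is `1 + 1/2 + 1/2`: the Taylor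
remainder of `exp(i w)`, that of `exp(-w² / 2)` times a factor of modulus at most `2`, and the
leftover cubic term. -/
theorem norm_exp_sub_one_add_mul_I_mul_exp_le {w : ℝ} (hw : |w| ≤ 1) :
    ‖Complex.exp (w * Complex.I) - (1 + (w : ℂ) * Complex.I) * Real.exp (-w ^ 2 / 2)‖
      ≤ 2 * |w| ^ 3 := by
  have hn : ‖(w : ℂ) * Complex.I‖ = |w| := by simp
  have h1 := Complex.exp_bound (x := (w : ℂ) * Complex.I) (by rw [hn]; exact hw) (n := 3) (by norm_num)
  rw [hn] at h1
  have hw2 : w ^ 2 ≤ 1 := by rw [← sq_abs]; exact pow_le_one₀ (abs_nonneg _) hw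
  have h2 : |Real.exp (-w ^ 2 / 2) - 1 - (-w ^ 2 / 2)| ≤ (-w ^ 2 / 2) ^ 2 :=
    Real.abs_exp_sub_one_sub_id_le (by rw [abs_le]; constructor <;> nlinarith [sq_nonneg w])
  have h3 : ‖1 + (w : ℂ) * Complex.I‖ ≤ 2 :=
    (norm_add_le _ _).trans (by rw [hn]; simp; linarith)
  have e : Complex.exp (w * Complex.I) - (1 + (w : ℂ) * Complex.I) * Real.exp (-w ^ 2 / 2)
      = (Complex.exp (w * Complex.I) - ∑ m ∈ Finset.range 3, ((w : ℂ) * Complex.I) ^ m / (m.factorial : ℂ))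
        - (1 + (w : ℂ) * Complex.I) * ((Real.exp (-w ^ 2 / 2) - 1 - (-w ^ 2 / 2) : ℝ) : ℂ)
        + (w : ℂ) ^ 3 * Complex.I / 2 := by
    simp only [Finset.sum_range_succ, Finset.sum_range_zero, Nat.factorial]
    push_cast
    have : Complex.I ^ 2 = -1 := Complex.I_sq
    ring_nf
    rw [this]; ring
  rw [e]
  have h4 : ‖(w : ℂ) ^ 3 * Complex.I / 2‖ = |w| ^ 3 / 2 := by simp
  have h5 : (-w ^ 2 / 2) ^ 2 ≤ |w| ^ 3 / 4 := by
    have : (-w ^ 2 / 2) ^ 2 = |w| ^ 3 * |w| / 4 := by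
      have := sq_abs w
      calc (-w ^ 2 / 2) ^ 2 = (w ^ 2) ^ 2 / 4 := by ring
        _ = (|w| ^ 2) ^ 2 / 4 := by rw [this]
        _ = _ := by ring
    rw [this]
    have : |w| ^ 3 * |w| ≤ |w| ^ 3 * 1 := by gcongr
    linarith
  calc _ ≤ ‖Complex.exp (w * Complex.I) - ∑ m ∈ Finset.range 3, ((w : ℂ) * Complex.I) ^ m / (m.factorial : ℂ)‖
        + ‖1 + (w : ℂ) * Complex.I‖ * ‖((Real.exp (-w ^ 2 / 2) - 1 - (-w ^ 2 / 2) : ℝ) : ℂ)‖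
        + ‖(w : ℂ) ^ 3 * Complex.I / 2‖ := by
        refine (norm_add_le _ _).trans ?_
        gcongr
        refine (norm_sub_le _ _).trans ?_
        rw [norm_mul]
    _ ≤ |w| ^ 3 * 1 + 2 * (|w| ^ 3 / 4) + |w| ^ 3 / 2 := by
        rw [h4, Complex.norm_real, Real.norm_eq_abs]
        gcongr
        · refine h1.trans ?_
          gcongr
          norm_num [Nat.factorial]
        · exact h2.trans h5
    _ = _ := by ring

/-- A quantitative central limit theorem for bounded martingale differences. -/
theorem norm_integral_exp_sum_sub_le (hr : Function.Injective r) (hF : ∀ y, F y ≤ mΩ)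
    {w : ι → Ω → ℝ} (hw : ∀ y y', r y < r y' → AEStronglyMeasurable[F y'] (w y) μ)
    (hwm : ∀ y, AEStronglyMeasurable (w y) μ)
    {c K σ : ℝ} (hc : 0 ≤ c) (hc1 : c ≤ 1) (hσ : 0 ≤ σ) (hb : ∀ y, ∀ᵐ x ∂μ, |w y x| ≤ c)
    (hw0 : ∀ y, μ[w y | F y] =ᵐ[μ] 0) (s : Finset ι) (hK : s.card * c ^ 2 ≤ K) :
    ‖∫ x, Complex.exp ((∑ y ∈ s, w y x : ℝ) * Complex.I) ∂μ - (Real.exp (-σ / 2) : ℂ)‖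
      ≤ 2 * c * K + Real.exp (K / 2) * ∫ x, |∑ y ∈ s, w y x ^ 2 - σ| ∂μ := by
  have hbs : ∀ᵐ x ∂μ, ∀ y ∈ s, |w y x| ≤ c := (s.eventually_all (l := ae μ)).2 fun y _ => hb y
  have hTb : ∀ᵐ x ∂μ, ‖∏ y ∈ s, (1 + (w y x : ℂ) * Complex.I)‖ ≤ Real.exp (K / 2) := by
    filter_upwards [ae_norm_prod_le hb s] with x hx
    exact hx.trans (Real.exp_le_exp.2 (by linarith))
  set T : Ω → ℂ := fun x => ∏ y ∈ s, (1 + (w y x : ℂ) * Complex.I) with hT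
  set Q : Ω → ℝ := fun x => ∑ y ∈ s, w y x ^ 2 with hQ
  have hTm : AEStronglyMeasurable T μ :=
    Finset.aestronglyMeasurable_fun_prod _ fun y _ =>
      ((Complex.continuous_ofReal.comp_aestronglyMeasurable (hwm y)).mul_const _).const_add _
  have hTi : Integrable T μ := Integrable.of_bound hTm _ hTb
  have hQm : AEStronglyMeasurable Q μ :=
    Finset.aestronglyMeasurable_fun_sum _ fun y _ => (hwm y).pow 2
  have hSm : AEStronglyMeasurable (fun x => ∑ y ∈ s, w y x) μ :=
    Finset.aestronglyMeasurable_fun_sum _ fun y _ => hwm y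
  have hQ0 : ∀ x, 0 ≤ Q x := fun x => Finset.sum_nonneg fun y _ => sq_nonneg _
  have hQi : Integrable Q μ := by
    refine Integrable.of_bound hQm K ?_
    filter_upwards [hbs] with x hx
    rw [Real.norm_eq_abs, abs_of_nonneg (hQ0 x)]
    refine le_trans (Finset.sum_le_card_nsmul _ _ (c ^ 2) fun y hy => ?_) (by simpa using hK)
    rw [← sq_abs]; exact pow_le_pow_left₀ (abs_nonneg _) (hx y hy) 2
  have hT1 : ∫ x, T x ∂μ = 1 := integral_prod_one_add_mul_I_eq_one hr hF hw hwm hb hw0 s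
  have hei : Integrable (fun x => Complex.exp ((∑ y ∈ s, w y x : ℝ) * Complex.I)) μ := by
    refine Integrable.of_bound (C := 1) ?_ (Eventually.of_forall fun x => ?_)
    · exact Complex.continuous_exp.comp_aestronglyMeasurable
        ((Complex.continuous_ofReal.comp_aestronglyMeasurable hSm).mul_const _)
    · rw [Complex.norm_exp_ofReal_mul_I]
  -- As `T` has mean one, the target is the mean of `T exp(-σ / 2)`, and a pointwise comparison
  -- suffices.
  have hdiff : ∫ x, Complex.exp ((∑ y ∈ s, w y x : ℝ) * Complex.I) ∂μ - (Real.exp (-σ / 2) : ℂ)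
      = ∫ x, (Complex.exp ((∑ y ∈ s, w y x : ℝ) * Complex.I) - T x * (Real.exp (-σ / 2) : ℂ)) ∂μ := by
    rw [integral_sub hei (hTi.mul_const _), integral_mul_const, hT1, one_mul]
  have hQσ : Integrable (fun x => |Q x - σ|) μ := (hQi.sub (integrable_const σ)).abs
  rw [hdiff]
  calc _ ≤ ∫ x, (2 * c * K + Real.exp (K / 2) * |Q x - σ|) ∂μ := by
        refine norm_integral_le_of_norm_le ((integrable_const _).add (hQσ.const_mul _)) ?_
        filter_upwards [hbs, hTb] with x hx hTx
        -- First replacement: compare with `T exp(-Q / 2)` factor by factor, at a cost of `2 c³` per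
        -- index.
        have hA : ‖Complex.exp ((∑ y ∈ s, w y x : ℝ) * Complex.I)
            - T x * (Real.exp (-Q x / 2) : ℂ)‖ ≤ 2 * c * K := by
          have e1 : Complex.exp ((∑ y ∈ s, w y x : ℝ) * Complex.I)
              = ∏ y ∈ s, Complex.exp (w y x * Complex.I) := by
            rw [← Complex.exp_sum, ← Finset.sum_mul]; push_cast; rfl
          have e2 : T x * (Real.exp (-Q x / 2) : ℂ)
              = ∏ y ∈ s, ((1 + (w y x : ℂ) * Complex.I) * Real.exp (-(w y x) ^ 2 / 2)) := by
            rw [Finset.prod_mul_distrib, ← Complex.ofReal_prod, ← Real.exp_sum, hQ]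
            congr 3
            rw [← Finset.sum_div, Finset.sum_neg_distrib]
          rw [e1, e2]
          refine (norm_prod_sub_prod_le_sum _ _ _
            (fun y _ => (Complex.norm_exp_ofReal_mul_I _).le)
            fun y _ => norm_one_add_mul_I_mul_exp_le _).trans ?_
          have : ∀ y ∈ s, ‖Complex.exp (w y x * Complex.I)
              - (1 + (w y x : ℂ) * Complex.I) * Real.exp (-(w y x) ^ 2 / 2)‖ ≤ 2 * c ^ 3 :=
            fun y hy => (norm_exp_sub_one_add_mul_I_mul_exp_le ((hx y hy).trans hc1)).trans
              (by have := hx y hy; gcongr)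
          refine (Finset.sum_le_card_nsmul _ _ _ this).trans ?_
          rw [nsmul_eq_mul]
          calc (s.card : ℝ) * (2 * c ^ 3) = 2 * c * (s.card * c ^ 2) := by ring
            _ ≤ 2 * c * K := by gcongr
        -- Second replacement, `Q` by `σ`: the function `exp(-q / 2)` is Lipschitz on `q ≥ 0`, and
        -- the bound on `|T|` supplies the factor `exp(K / 2)`.
        have hB : |Real.exp (-Q x / 2) - Real.exp (-σ / 2)| ≤ |Q x - σ| := by
          have key : ∀ a b : ℝ, 0 ≤ a → a ≤ b → Real.exp (-a / 2) - Real.exp (-b / 2) ≤ b - a := by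
            intro a b ha hab
            have h1 : Real.exp (-a / 2) ≤ 1 := Real.exp_le_one_iff.2 (by linarith)
            have h2 : Real.exp (-b / 2) = Real.exp (-a / 2) * Real.exp (-(b - a) / 2) := by
              rw [← Real.exp_add]; congr 1; ring
            have h3 := Real.add_one_le_exp (-(b - a) / 2)
            have h4 := Real.exp_pos (-a / 2)
            rw [h2]
            nlinarith
          rcases le_total (Q x) σ with h | h
          · rw [abs_of_nonneg, abs_of_nonpos (by linarith), neg_sub]
            · exact key _ _ (hQ0 x) h
            · exact sub_nonneg.2 (Real.exp_le_exp.2 (by linarith))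
          · rw [abs_of_nonpos, abs_of_nonneg (by linarith), neg_sub]
            · exact key _ _ hσ h
            · exact sub_nonpos.2 (Real.exp_le_exp.2 (by linarith))
        have e : Complex.exp ((∑ y ∈ s, w y x : ℝ) * Complex.I) - T x * (Real.exp (-σ / 2) : ℂ)
            = (Complex.exp ((∑ y ∈ s, w y x : ℝ) * Complex.I) - T x * (Real.exp (-Q x / 2) : ℂ))
              + T x * ((Real.exp (-Q x / 2) - Real.exp (-σ / 2) : ℝ) : ℂ) := by
          push_cast; ring
        rw [e]
        refine (norm_add_le _ _).trans (add_le_add hA ?_)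
        rw [norm_mul, Complex.norm_real, Real.norm_eq_abs]
        gcongr
    _ = _ := by
        rw [integral_add (integrable_const _) (hQσ.const_mul _),
          integral_const_mul (Real.exp (K / 2)), integral_const]
        simp [hQ]

end MartingaleDifferences

/-! ### Mean square inequalities and integrals under measure preserving maps. -/

section SecondMoments

variable {Ω : Type*} {mΩ : MeasurableSpace Ω} {μ : Measure Ω}

theorem integral_abs_mul_le_sqrt {f g : Ω → ℝ} (hf : MemLp f 2 μ) (hg : MemLp g 2 μ) :
    ∫ x, |f x| * |g x| ∂μ ≤ √(∫ x, f x ^ 2 ∂μ) * √(∫ x, g x ^ 2 ∂μ) := by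
  have h := integral_mul_norm_le_Lp_mul_Lq (μ := μ) (f := f) (g := g) (p := 2) (q := 2)
    Real.HolderConjugate.two_two (by simpa using hf) (by simpa using hg)
  simpa [Real.sqrt_eq_rpow] using h

theorem abs_integral_mul_le_sqrt {f g : Ω → ℝ} (hf : MemLp f 2 μ) (hg : MemLp g 2 μ) :
    |∫ x, f x * g x ∂μ| ≤ √(∫ x, f x ^ 2 ∂μ) * √(∫ x, g x ^ 2 ∂μ) := by
  refine (abs_integral_le_integral_abs).trans ?_
  simp_rw [abs_mul]
  exact integral_abs_mul_le_sqrt hf hg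

theorem integral_abs_le_sqrt [IsProbabilityMeasure μ] {f : Ω → ℝ} (hf : MemLp f 2 μ) :
    ∫ x, |f x| ∂μ ≤ √(∫ x, f x ^ 2 ∂μ) := by
  simpa using integral_abs_mul_le_sqrt hf (memLp_const (1 : ℝ))

theorem integral_sq_add_le {f g : Ω → ℝ} (hf : MemLp f 2 μ) (hg : MemLp g 2 μ) :
    ∫ x, (f x + g x) ^ 2 ∂μ ≤ 2 * ∫ x, f x ^ 2 ∂μ + 2 * ∫ x, g x ^ 2 ∂μ := by
  rw [← integral_const_mul, ← integral_const_mul,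
    ← integral_add (hf.integrable_sq.const_mul 2) (hg.integrable_sq.const_mul 2)]
  refine integral_mono (hf.add hg).integrable_sq
    ((hf.integrable_sq.const_mul 2).add (hg.integrable_sq.const_mul 2)) fun x => ?_
  simp only
  nlinarith [sq_nonneg (f x - g x)]

/-- Expand `f' g' - f g` in `f - f'` and `g - g'` and apply Cauchy–Schwarz. Only the norms of `f`,
`g` and of the differences appear, so no moment bound on the pair `f'`, `g'` is required. -/
theorem abs_integral_mul_sub_le {f g f' g' : Ω → ℝ} (hf : MemLp f 2 μ) (hg : MemLp g 2 μ)
    (hf' : MemLp f' 2 μ) (hg' : MemLp g' 2 μ) :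
    |∫ x, f' x * g' x ∂μ - ∫ x, f x * g x ∂μ|
      ≤ √(∫ x, (f x - f' x) ^ 2 ∂μ) * √(∫ x, g x ^ 2 ∂μ)
        + √(∫ x, f x ^ 2 ∂μ) * √(∫ x, (g x - g' x) ^ 2 ∂μ)
        + √(∫ x, (f x - f' x) ^ 2 ∂μ) * √(∫ x, (g x - g' x) ^ 2 ∂μ) := by
  have hdf : MemLp (fun x => f x - f' x) 2 μ := hf.sub hf'
  have hdg : MemLp (fun x => g x - g' x) 2 μ := hg.sub hg'
  have i1 : Integrable (fun x => (f x - f' x) * g x) μ := hdf.integrable_mul hg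
  have i2 : Integrable (fun x => f x * (g x - g' x)) μ := hf.integrable_mul hdg
  have i3 : Integrable (fun x => (f x - f' x) * (g x - g' x)) μ := hdf.integrable_mul hdg
  have i4 : Integrable (fun x => f x * g x) μ := hf.integrable_mul hg
  have i5 : Integrable (fun x => f' x * g' x) μ := hf'.integrable_mul hg'
  have i6 : Integrable (fun x => (f x - f' x) * (g x - g' x) - (f x - f' x) * g x) μ := i3.sub i1
  have e : ∫ x, f' x * g' x ∂μ - ∫ x, f x * g x ∂μ
      = ∫ x, (f x - f' x) * (g x - g' x) ∂μ - ∫ x, (f x - f' x) * g x ∂μ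
        - ∫ x, f x * (g x - g' x) ∂μ := by
    rw [← integral_sub i5 i4, ← integral_sub i3 i1, ← integral_sub i6 i2]
    congr 1; ext x; ring
  rw [e]
  have h1 := abs_integral_mul_le_sqrt hdf hg
  have h2 := abs_integral_mul_le_sqrt hf hdg
  have h3 := abs_integral_mul_le_sqrt hdf hdg
  refine (abs_sub _ _).trans ?_
  have h4 := abs_sub (∫ x, (f x - f' x) * (g x - g' x) ∂μ) (∫ x, (f x - f' x) * g x ∂μ)
  linarith

theorem memLp_comp_measurePreserving {Ω' : Type*} {mΩ' : MeasurableSpace Ω'} {ν : Measure Ω'}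
    {T : Ω' → Ω} (hT : MeasurePreserving T ν μ) {f : Ω → ℝ} {p : ℝ≥0∞} (hf : MemLp f p μ) :
    MemLp (fun x => f (T x)) p ν := hf.comp_measurePreserving hT

theorem integral_comp_measurePreserving {Ω' F : Type*} {mΩ' : MeasurableSpace Ω'}
    [NormedAddCommGroup F] [NormedSpace ℝ F] {ν : Measure Ω'}
    {T : Ω' → Ω} (hT : MeasurePreserving T ν μ) {f : Ω → F} (hf : AEStronglyMeasurable f μ) :
    ∫ x, f (T x) ∂ν = ∫ x, f x ∂μ := by
  rw [← hT.map_eq] at hf ⊢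
  exact (integral_map hT.measurable.aemeasurable hf).symm

end SecondMoments

/-! ### Mixing and the law of large numbers for the i.i.d. field. -/

section LawOfLargeNumbers

variable {d : ℕ} {E : Type*} [MeasurableSpace E] {P₀ : Measure E} [IsProbabilityMeasure P₀]

/-- Lévy's upward theorem along an exhaustion of the index set by finite sets, obtained from an
injection into `ℕ`. -/
theorem exists_finset_integral_abs_condExp_sub_le {ι : Type*} [Countable ι] {g : (ι → E) → ℝ}
    (hg : Integrable g (Measure.infinitePi fun _ : ι => P₀)) (hgm : StronglyMeasurable g)
    {ε : ℝ} (hε : 0 < ε) :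
    ∃ s : Finset ι, ∫ x, |((Measure.infinitePi fun _ : ι => P₀)[g | cylinderEvents s]) x - g x|
      ∂(Measure.infinitePi fun _ : ι => P₀) ≤ ε := by
  classical
  obtain ⟨e, he⟩ := exists_injective_nat ι
  set μ := Measure.infinitePi fun _ : ι => P₀
  let ℱ : Filtration ℕ (MeasurableSpace.pi (X := fun _ : ι => E)) :=
    { seq := fun n => cylinderEvents {z | e z < n}
      mono' := fun n m hnm => cylinderEvents_mono fun z hz => lt_of_lt_of_le hz hnm
      le' := fun n => cylinderEvents_le_pi }
  have hsup : (⨆ n, ℱ n) = MeasurableSpace.pi := by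
    refine le_antisymm (iSup_le fun n => ℱ.le n) ?_
    refine iSup_le fun z => ?_
    refine le_trans ?_ (le_iSup (fun n => (ℱ n : MeasurableSpace (ι → E))) (e z + 1))
    exact le_iSup₂_of_le (f := fun (i : ι) (_ : i ∈ {w | e w < e z + 1}) =>
      MeasurableSpace.comap (fun σ : ι → E => σ i) inferInstance) z (Nat.lt_succ_self _) le_rfl
  have ht := hg.tendsto_eLpNorm_condExp (ℱ := ℱ) (by rw [hsup]; exact hgm)
  obtain ⟨n, hn⟩ := (ht.eventually (ENNReal.tendsto_nhds_zero.1 tendsto_id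
    (ENNReal.ofReal ε) (by simpa using hε))).exists
  have hfin : {z | e z < n}.Finite :=
    (Set.finite_Iio n).preimage he.injOn
  refine ⟨hfin.toFinset, ?_⟩
  rw [hfin.coe_toFinset]
  have hintg : Integrable (μ[g | cylinderEvents {z | e z < n}] - g) μ := integrable_condExp.sub hg
  have h2 : ∫ x, ‖(μ[g | cylinderEvents {z | e z < n}] - g) x‖ ∂μ
      = (eLpNorm (μ[g | cylinderEvents {z | e z < n}] - g) 1 μ).toReal := by
    rw [eLpNorm_one_eq_lintegral_enorm, integral_norm_eq_lintegral_enorm hintg.1]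
  simp only [Real.norm_eq_abs, Pi.sub_apply] at h2
  rw [h2]
  exact ENNReal.toReal_le_of_le_ofReal hε.le hn

theorem integrable_of_ae_abs_le {Ω : Type*} {mΩ : MeasurableSpace Ω} {μ : Measure Ω}
    [IsFiniteMeasure μ] {g : Ω → ℝ} (hgm : AEStronglyMeasurable g μ) {K : ℝ}
    (hb : ∀ᵐ x ∂μ, |g x| ≤ K) : Integrable g μ :=
  Integrable.of_bound hgm K hb

/-- Bounded functions of an i.i.d. field are mixing under lattice shifts. -/
theorem tendsto_integral_mul_shift_cofinite {g : ((Fin d → ℤ) → E) → ℝ}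
    (hgm : StronglyMeasurable g) {K : ℝ}
    (hb : ∀ᵐ x ∂(Measure.infinitePi fun _ : Fin d → ℤ => P₀), |g x| ≤ K)
    (h0 : ∫ x, g x ∂(Measure.infinitePi fun _ : Fin d → ℤ => P₀) = 0) :
    Tendsto (fun z => ∫ x, g x * g (shift z x) ∂(Measure.infinitePi fun _ : Fin d → ℤ => P₀))
      cofinite (𝓝 0) := by
  classical
  set μ := Measure.infinitePi fun _ : Fin d → ℤ => P₀ with hμ
  have hK : 0 ≤ K := by
    obtain ⟨x, hx⟩ := hb.exists
    exact (abs_nonneg _).trans hx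
  have hgi : Integrable g μ := integrable_of_ae_abs_le hgm.aestronglyMeasurable hb
  rw [Metric.tendsto_nhds]
  intro ε hε
  -- The approximation error enters twice, each time multiplied by `K`, for a total of at most `ε K
  -- / (2 K + 1) < ε`, also when `K = 0`.
  obtain ⟨s, hs⟩ := exists_finset_integral_abs_condExp_sub_le hgi hgm
    (ε := ε / (2 * K + 1) / 2) (by positivity)
  set gs := μ[g | cylinderEvents (s : Set (Fin d → ℤ))] with hgs
  have hgsm : StronglyMeasurable[cylinderEvents (s : Set (Fin d → ℤ))] gs :=
    stronglyMeasurable_condExp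
  have hgsm' : StronglyMeasurable gs := hgsm.mono cylinderEvents_le_pi
  have hgsb : ∀ᵐ x ∂μ, |gs x| ≤ K := ae_bdd_abs_condExp_of_ae_bdd_abs hb
  have hgs0 : ∫ x, gs x ∂μ = 0 := by rw [hgs, integral_condExp cylinderEvents_le_pi, h0]
  have hgs2 : MemLp gs 2 μ := MemLp.of_bound hgsm'.aestronglyMeasurable K hgsb
  -- The shifts to exclude are the differences of points of `s`; for every other `z` the sets `s`
  -- and `s + z` are disjoint.
  have hfin : (((s ×ˢ s).image fun p => p.1 - p.2 : Finset (Fin d → ℤ)) : Set (Fin d → ℤ)).Finite :=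
    Finset.finite_toSet _
  filter_upwards [hfin.compl_mem_cofinite] with z hz
  have hτ := measurePreserving_shift (P₀ := P₀) z
  have hdisj : (s : Set (Fin d → ℤ)) ∩ ((fun w => w + z) '' s) = ∅ := by
    rw [Set.eq_empty_iff_forall_notMem]
    rintro w ⟨hw, w', hw', rfl⟩
    exact hz (Finset.mem_coe.2 (Finset.mem_image.2 ⟨(w' + z, w'),
      Finset.mem_product.2 ⟨hw, hw'⟩, by simp⟩))
  have hgsz : StronglyMeasurable[cylinderEvents ((fun w => w + z) '' (s : Set (Fin d → ℤ)))]
      (fun x => gs (shift z x)) := by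
    rw [← comap_shift_cylinderEvents]
    exact hgsm.comp_measurable (comap_measurable _)
  have hgsz2 : MemLp (fun x => gs (shift z x)) 2 μ := memLp_comp_measurePreserving hτ hgs2
  -- The shifted approximant reads coordinates off `s` only, so its conditional expectation given
  -- `s` is its mean, which is zero.
  have hmain : ∫ x, gs (shift z x) * gs x ∂μ = 0 := by
    refine integral_mul_eq_zero_of_condExp_eq_zero (m := cylinderEvents (s : Set (Fin d → ℤ)))
      cylinderEvents_le_pi hgsm.aestronglyMeasurable hgsz2 hgs2 ?_
    refine (condExp_cylinderEvents_inter_of_stronglyMeasurable _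
      (hgsz2.integrable (by norm_num)) hgsz).trans ?_
    rw [hdisj]
    have hbot : cylinderEvents (X := fun _ : Fin d → ℤ => E) ∅ = ⊥ := by simp [cylinderEvents]
    rw [hbot, condExp_bot]
    refine Eventually.of_forall fun x => ?_
    change ∫ x, gs (shift z x) ∂μ = 0
    rw [integral_comp_measurePreserving hτ hgsm'.aestronglyMeasurable, hgs0]
  have hbz : ∀ᵐ x ∂μ, |g (shift z x)| ≤ K := hτ.quasiMeasurePreserving.ae hb
  have hdi : Integrable (fun x => |gs x - g x|) μ := (integrable_condExp.sub hgi).abs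
  have hdiz : Integrable (fun x => |gs (shift z x) - g (shift z x)|) μ :=
    hτ.integrable_comp_of_integrable hdi
  have hgz : Integrable (fun x => g (shift z x)) μ := hτ.integrable_comp_of_integrable hgi
  have hi1 : Integrable (fun x => g x * g (shift z x)) μ := hgz.bdd_mul hgm.aestronglyMeasurable hb
  have hi2 : Integrable (fun x => gs (shift z x) * gs x) μ := hgsz2.integrable_mul hgs2
  have hle : |∫ x, g x * g (shift z x) ∂μ|
      ≤ ∫ x, (K * |gs x - g x| + K * |gs (shift z x) - g (shift z x)|) ∂μ := by
    have : ∫ x, g x * g (shift z x) ∂μ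
        = ∫ x, (g x * g (shift z x) - gs (shift z x) * gs x) ∂μ := by
      rw [integral_sub hi1 hi2, hmain, sub_zero]
    rw [this, ← Real.norm_eq_abs]
    refine norm_integral_le_of_norm_le ((hdi.const_mul K).add (hdiz.const_mul K)) ?_
    filter_upwards [hbz, hgsb] with x h1 h2
    have e : g x * g (shift z x) - gs (shift z x) * gs x
        = -(g (shift z x) * (gs x - g x)) - gs x * (gs (shift z x) - g (shift z x)) := by ring
    rw [e, Real.norm_eq_abs]
    refine (abs_sub _ _).trans ?_
    rw [abs_neg, abs_mul, abs_mul]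
    gcongr
  have hz' : ∫ x, |gs (shift z x) - g (shift z x)| ∂μ = ∫ x, |gs x - g x| ∂μ :=
    integral_comp_measurePreserving hτ hdi.1
  rw [integral_add (hdi.const_mul K) (hdiz.const_mul K), integral_const_mul, integral_const_mul,
    hz'] at hle
  rw [Real.dist_eq, sub_zero]
  refine hle.trans_lt ?_
  have h3 : K * ∫ x, |gs x - g x| ∂μ ≤ K * (ε / (2 * K + 1) / 2) := by gcongr
  have h4 : K * (ε / (2 * K + 1) / 2) + K * (ε / (2 * K + 1) / 2) < ε := by
    have : K * (ε / (2 * K + 1) / 2) + K * (ε / (2 * K + 1) / 2) = ε * (K / (2 * K + 1)) := by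
      field_simp; ring
    rw [this]
    have : K / (2 * K + 1) < 1 := by rw [div_lt_one (by positivity)]; linarith
    nlinarith
  linarith

/-- The mean square law of large numbers for centred bounded functions of an i.i.d. field. -/
theorem tendsto_integral_sq_sum_shift {g : ((Fin d → ℤ) → E) → ℝ}
    (hgm : StronglyMeasurable g) {K : ℝ}
    (hb : ∀ᵐ x ∂(Measure.infinitePi fun _ : Fin d → ℤ => P₀), |g x| ≤ K)
    (h0 : ∫ x, g x ∂(Measure.infinitePi fun _ : Fin d → ℤ => P₀) = 0)
    {Λ : ℕ → Finset (Fin d → ℤ)} {N : ℕ → ℝ} (hN0 : ∀ n, 0 < N n) (hN : Tendsto N atTop atTop)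
    {v : ℝ} (hv : Tendsto (fun n => (Λ n).card / N n) atTop (𝓝 v)) :
    Tendsto (fun n => ∫ x, ((N n)⁻¹ * ∑ y ∈ Λ n, g (shift y x)) ^ 2
      ∂(Measure.infinitePi fun _ : Fin d → ℤ => P₀)) atTop (𝓝 0) := by
  classical
  set μ := Measure.infinitePi fun _ : Fin d → ℤ => P₀ with hμ
  set q : (Fin d → ℤ) → ℝ := fun z => ∫ x, g x * g (shift z x) ∂μ with hq
  have hK : 0 ≤ K := by
    obtain ⟨x, hx⟩ := hb.exists
    exact (abs_nonneg _).trans hx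
  have hg2 : MemLp g 2 μ := MemLp.of_bound hgm.aestronglyMeasurable K hb
  have hgy2 : ∀ y, MemLp (fun x => g (shift y x)) 2 μ := fun y =>
    memLp_comp_measurePreserving (measurePreserving_shift y) hg2
  have hqK : ∀ z, |q z| ≤ K ^ 2 := by
    intro z
    have hbz : ∀ᵐ x ∂μ, |g (shift z x)| ≤ K :=
      (measurePreserving_shift (P₀ := P₀) z).quasiMeasurePreserving.ae hb
    have := norm_integral_le_of_norm_le_const (μ := μ) (f := fun x => g x * g (shift z x))
      (C := K ^ 2) (by
        filter_upwards [hb, hbz] with x h1 h2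
        rw [norm_mul, sq]; exact mul_le_mul h1 h2 (abs_nonneg _) hK)
    simpa using this
  have hcov : ∀ y y', ∫ x, g (shift y x) * g (shift y' x) ∂μ = q (y' - y) := by
    intro y y'
    have := integral_comp_measurePreserving (measurePreserving_shift (P₀ := P₀) y)
      (f := fun x => g x * g (shift (y' - y) x))
      (hgm.aestronglyMeasurable.mul (hgy2 _).1)
    rw [hq]
    simp only
    rw [← this]
    simp [shift_shift, hμ]
  have hexp : ∀ n, ∫ x, ((N n)⁻¹ * ∑ y ∈ Λ n, g (shift y x)) ^ 2 ∂μ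
      = (N n)⁻¹ ^ 2 * ∑ y ∈ Λ n, ∑ y' ∈ Λ n, q (y' - y) := by
    intro n
    simp_rw [mul_pow, integral_const_mul, sq (∑ y ∈ Λ n, _), Finset.sum_mul_sum]
    congr 1
    have hintg : ∀ y y', Integrable (fun x => g (shift y x) * g (shift y' x)) μ := fun y y' =>
      (hgy2 y).integrable_mul (hgy2 y')
    rw [integral_finsetSum _ fun y _ => integrable_finsetSum _ fun y' _ => hintg y y']
    refine Finset.sum_congr rfl fun y _ => ?_
    rw [integral_finsetSum _ fun y' _ => hintg y y']
    exact Finset.sum_congr rfl fun y' _ => hcov y y'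
  have hv0 : 0 ≤ v := ge_of_tendsto' hv fun n => div_nonneg (Nat.cast_nonneg _) (hN0 n).le
  have hqt := tendsto_integral_mul_shift_cofinite hgm hb h0
  rw [Metric.tendsto_nhds]
  intro ε hε
  -- In the limit the pairs with small correlation contribute `v² δ ≤ ε / 2`.
  set δ := ε / 2 / (v + 1) ^ 2 with hδ
  have hδ0 : 0 < δ := by positivity
  have hZ : {z | ¬ |q z| < δ}.Finite := by
    have := Metric.tendsto_nhds.1 hqt δ hδ0
    simpa [Real.dist_eq] using this
  -- For fixed `y`, only finitely many displacements, a number independent of `n`, have correlation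
  -- at least `δ`. They cost `K²` each and disappear after division by `N²`.
  have hbound : ∀ n, ∑ y ∈ Λ n, ∑ y' ∈ Λ n, |q (y' - y)|
      ≤ (Λ n).card * ((Λ n).card * δ + hZ.toFinset.card * K ^ 2) := by
    intro n
    rw [← nsmul_eq_mul]
    refine Finset.sum_le_card_nsmul _ _ _ fun y _ => ?_
    have : ∀ y', |q (y' - y)| ≤ δ + if y' - y ∈ hZ.toFinset then K ^ 2 else 0 := by
      intro y'
      split_ifs with h
      · linarith [hqK (y' - y)]
      · simp only [Set.Finite.mem_toFinset, Set.mem_ofPred_eq, not_not] at h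
        linarith
    refine (Finset.sum_le_sum fun y' _ => this y').trans ?_
    rw [Finset.sum_add_distrib, Finset.sum_const, nsmul_eq_mul, ← Finset.sum_filter,
      Finset.sum_const, nsmul_eq_mul]
    refine add_le_add le_rfl (mul_le_mul_of_nonneg_right (Nat.cast_le.2 ?_) (sq_nonneg K))
    refine Finset.card_le_card_of_injOn (fun y' => y' - y) (fun y' hy' => ?_) ?_
    · exact (Finset.mem_filter.1 hy').2
    · intro a _ b _ h; exact sub_left_injective h
  have hE : Tendsto (fun n => ((Λ n).card / N n) * (((Λ n).card / N n) * δ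
      + hZ.toFinset.card * K ^ 2 * (N n)⁻¹)) atTop (𝓝 (v * (v * δ + hZ.toFinset.card * K ^ 2 * 0))) :=
    hv.mul ((hv.mul_const δ).add (hN.inv_tendsto_atTop.const_mul _))
  have hlt : v * (v * δ + hZ.toFinset.card * K ^ 2 * 0) < ε := by
    have : v * (v * δ + hZ.toFinset.card * K ^ 2 * 0) = (v ^ 2 / (v + 1) ^ 2) * (ε / 2) := by
      rw [mul_zero, add_zero, hδ]; field_simp
    rw [this]
    have : v ^ 2 / (v + 1) ^ 2 ≤ 1 := by
      rw [div_le_one (by positivity)]; nlinarith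
    nlinarith
  filter_upwards [hE.eventually (gt_mem_nhds hlt)] with n hn
  rw [Real.dist_eq, sub_zero, hexp]
  refine lt_of_le_of_lt ?_ hn
  rw [abs_mul, abs_of_nonneg (sq_nonneg _)]
  have h1 : |∑ y ∈ Λ n, ∑ y' ∈ Λ n, q (y' - y)| ≤ ∑ y ∈ Λ n, ∑ y' ∈ Λ n, |q (y' - y)| :=
    (Finset.abs_sum_le_sum_abs _ _).trans (Finset.sum_le_sum fun y _ =>
      Finset.abs_sum_le_sum_abs _ _)
  calc (N n)⁻¹ ^ 2 * |∑ y ∈ Λ n, ∑ y' ∈ Λ n, q (y' - y)|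
      ≤ (N n)⁻¹ ^ 2 * ((Λ n).card * ((Λ n).card * δ + hZ.toFinset.card * K ^ 2)) := by
        gcongr; exact h1.trans (hbound n)
    _ = _ := by have := (hN0 n).ne'; field_simp

/-- The law of large numbers in `L¹` for bounded functions of an i.i.d. field. -/
theorem tendsto_integral_abs_sum_shift_sub {g : ((Fin d → ℤ) → E) → ℝ}
    (hgm : StronglyMeasurable g) {K : ℝ}
    (hb : ∀ᵐ x ∂(Measure.infinitePi fun _ : Fin d → ℤ => P₀), |g x| ≤ K)
    {Λ : ℕ → Finset (Fin d → ℤ)} {N : ℕ → ℝ} (hN0 : ∀ n, 0 < N n) (hN : Tendsto N atTop atTop)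
    {v : ℝ} (hv : Tendsto (fun n => (Λ n).card / N n) atTop (𝓝 v)) :
    Tendsto (fun n => ∫ x, |(N n)⁻¹ * ∑ y ∈ Λ n, g (shift y x)
        - v * ∫ x', g x' ∂(Measure.infinitePi fun _ : Fin d → ℤ => P₀)|
      ∂(Measure.infinitePi fun _ : Fin d → ℤ => P₀)) atTop (𝓝 0) := by
  set μ := Measure.infinitePi fun _ : Fin d → ℤ => P₀ with hμ
  set e := ∫ x', g x' ∂μ with he
  have hgi : Integrable g μ := integrable_of_ae_abs_le hgm.aestronglyMeasurable hb
  have hcm : StronglyMeasurable (fun x => g x - e) := hgm.sub stronglyMeasurable_const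
  have hcb : ∀ᵐ x ∂μ, |g x - e| ≤ K + |e| := by
    filter_upwards [hb] with x hx
    exact (abs_sub _ _).trans (by linarith)
  have hc0 : ∫ x, (g x - e) ∂μ = 0 := by
    rw [integral_sub hgi (integrable_const _)]; simp [he]
  have h1 := tendsto_integral_sq_sum_shift hcm hcb hc0 hN0 hN hv
  have h2 : Tendsto (fun n => √(∫ x, ((N n)⁻¹ * ∑ y ∈ Λ n, (g (shift y x) - e)) ^ 2 ∂μ)
      + |(Λ n).card / N n - v| * |e|) atTop (𝓝 0) := by
    have := (Real.continuous_sqrt.tendsto 0).comp h1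
    have h3 : Tendsto (fun n => |(Λ n).card / N n - v| * |e|) atTop (𝓝 (|v - v| * |e|)) :=
      ((hv.sub_const v).abs).mul_const _
    simpa using this.add h3
  have hc2 : MemLp (fun x => g x - e) 2 μ := MemLp.of_bound hcm.aestronglyMeasurable _ hcb
  have hs2 : ∀ n, MemLp (fun x => (N n)⁻¹ * ∑ y ∈ Λ n, (g (shift y x) - e)) 2 μ := fun n =>
    (memLp_finsetSum _ fun y _ =>
      memLp_comp_measurePreserving (measurePreserving_shift y) hc2).const_mul _
  refine squeeze_zero (fun n => integral_nonneg fun x => abs_nonneg _) (fun n => ?_) h2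
  have hsi : Integrable (fun x => |(N n)⁻¹ * ∑ y ∈ Λ n, (g (shift y x) - e)|) μ :=
    ((hs2 n).integrable (by norm_num)).abs
  calc _ ≤ ∫ x, (|(N n)⁻¹ * ∑ y ∈ Λ n, (g (shift y x) - e)| + |(Λ n).card / N n - v| * |e|) ∂μ := by
        refine integral_mono_of_nonneg (Eventually.of_forall fun x => abs_nonneg _)
          (hsi.add (integrable_const _)) (Eventually.of_forall fun x => ?_)
        simp only
        rw [← abs_mul]
        refine le_trans (le_of_eq ?_) (abs_add_le _ _)
        congr 1
        rw [Finset.sum_sub_distrib, Finset.sum_const, nsmul_eq_mul]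
        ring
    _ ≤ _ := by
        rw [integral_add hsi (integrable_const _), integral_const]
        simp only [probReal_univ, one_smul]
        gcongr
        exact integral_abs_le_sqrt (hs2 n)

end LawOfLargeNumbers

/-! ### Translation invariance of the lexicographic order. -/

section LexOrder

variable {d : ℕ}

theorem image_add_lexIic (y : Fin d → ℤ) :
    (fun z => z + y) '' {z : Fin d → ℤ | toLex z ≤ toLex 0} = {z | toLex z ≤ toLex y} := by
  ext z
  simp only [Set.mem_image, Set.mem_ofPred_eq]
  constructor
  · rintro ⟨w, hw, rfl⟩
    simpa using add_le_add_left hw (toLex y)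
  · intro h
    refine ⟨z - y, ?_, by simp⟩
    simpa using add_le_add_left h (-toLex y)

theorem image_add_lexIio (y : Fin d → ℤ) :
    (fun z => z + y) '' {z : Fin d → ℤ | toLex z < toLex 0} = {z | toLex z < toLex y} := by
  ext z
  simp only [Set.mem_image, Set.mem_ofPred_eq]
  constructor
  · rintro ⟨w, hw, rfl⟩
    simpa using add_lt_add_left hw (toLex y)
  · intro h
    refine ⟨z - y, ?_, by simp⟩
    simpa using add_lt_add_left h (-toLex y)

end LexOrder

/-! ### Central limit theorem for sums of stationary martingale differences. -/

section CentralLimit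

variable {d : ℕ} {E : Type*} [MeasurableSpace E] {P₀ : Measure E} [IsProbabilityMeasure P₀]

/-- The σ-field of the coordinates strictly before `y` in the lexicographic order. -/
abbrev strictPast (d : ℕ) (E : Type*) [MeasurableSpace E] (y : Fin d → ℤ) :
    MeasurableSpace ((Fin d → ℤ) → E) :=
  cylinderEvents (X := fun _ : Fin d → ℤ => E) {z | toLex z < toLex y}

/-- The σ-field of the coordinates at or before `y` in the lexicographic order. -/
abbrev weakPast (d : ℕ) (E : Type*) [MeasurableSpace E] (y : Fin d → ℤ) :
    MeasurableSpace ((Fin d → ℤ) → E) :=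
  cylinderEvents (X := fun _ : Fin d → ℤ => E) {z | toLex z ≤ toLex y}

theorem weakPast_le_strictPast {y y' : Fin d → ℤ} (h : toLex y < toLex y') :
    weakPast d E y ≤ strictPast d E y' :=
  cylinderEvents_mono fun _ hz => lt_of_le_of_lt hz h

theorem strictPast_le_weakPast (y : Fin d → ℤ) : strictPast d E y ≤ weakPast d E y :=
  cylinderEvents_mono fun z hz => show toLex z ≤ toLex y from le_of_lt hz

theorem comap_shift_weakPast (y : Fin d → ℤ) :
    (weakPast d E 0).comap (shift y) = weakPast d E y := by
  rw [comap_shift_cylinderEvents, image_add_lexIic]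

theorem comap_shift_strictPast (y : Fin d → ℤ) :
    (strictPast d E 0).comap (shift y) = strictPast d E y := by
  rw [comap_shift_cylinderEvents, image_add_lexIio]

/-- A square integrable function of the field seen from the origin, depending on the lexicographic
past only and centred given the strict past: its shifts are martingale differences. -/
structure IsMartingaleDifference (P₀ : Measure E) [IsProbabilityMeasure P₀]
    (g : ((Fin d → ℤ) → E) → ℝ) : Prop where
  stronglyMeasurable : StronglyMeasurable[weakPast d E 0] g
  memLp : MemLp g 2 (Measure.infinitePi fun _ : Fin d → ℤ => P₀)
  condExp_eq_zero : (Measure.infinitePi fun _ : Fin d → ℤ => P₀)[g | strictPast d E 0]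
    =ᵐ[Measure.infinitePi fun _ : Fin d → ℤ => P₀] 0

namespace IsMartingaleDifference

variable {g g' : ((Fin d → ℤ) → E) → ℝ}

theorem stronglyMeasurable_pi (hg : IsMartingaleDifference P₀ g) : StronglyMeasurable g :=
  hg.stronglyMeasurable.mono cylinderEvents_le_pi

theorem memLp_shift (hg : IsMartingaleDifference P₀ g) (y : Fin d → ℤ) :
    MemLp (fun x => g (shift y x)) 2 (Measure.infinitePi fun _ : Fin d → ℤ => P₀) :=
  memLp_comp_measurePreserving (measurePreserving_shift y) hg.memLp

theorem stronglyMeasurable_shift (hg : IsMartingaleDifference P₀ g) {y y' : Fin d → ℤ}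
    (h : toLex y < toLex y') : StronglyMeasurable[strictPast d E y'] (fun x => g (shift y x)) := by
  refine StronglyMeasurable.mono ?_ (weakPast_le_strictPast h)
  rw [← comap_shift_weakPast]
  exact hg.stronglyMeasurable.comp_measurable (comap_measurable _)

theorem condExp_shift_eq_zero (hg : IsMartingaleDifference P₀ g) (y : Fin d → ℤ) :
    (Measure.infinitePi fun _ : Fin d → ℤ => P₀)[fun x => g (shift y x) | strictPast d E y]
      =ᵐ[Measure.infinitePi fun _ : Fin d → ℤ => P₀] 0 := by
  have hτ := measurePreserving_shift (P₀ := P₀) y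
  have h := condExp_comp_measurePreserving hτ
    (cylinderEvents_le_pi (X := fun _ : Fin d → ℤ => E) (Δ := {z | toLex z < toLex 0}))
    (hg.memLp.integrable (by norm_num))
  rw [comap_shift_strictPast] at h
  filter_upwards [h, hτ.quasiMeasurePreserving.ae hg.condExp_eq_zero] with x h1 h2
  exact h1.trans h2

/-- Orthogonality leaves only the common sites, and by stationarity they contribute equally. This is
where `|A_i ∩ A_j|` comes from. -/
theorem integral_sum_mul_sum (hg : IsMartingaleDifference P₀ g)
    (hg' : IsMartingaleDifference P₀ g') (s t : Finset (Fin d → ℤ)) [DecidableEq (Fin d → ℤ)] :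
    ∫ x, (∑ y ∈ s, g (shift y x)) * (∑ y ∈ t, g' (shift y x))
        ∂(Measure.infinitePi fun _ : Fin d → ℤ => P₀)
      = (s ∩ t).card * ∫ x, g x * g' x ∂(Measure.infinitePi fun _ : Fin d → ℤ => P₀) := by
  rw [integral_sum_mul_sum_eq (r := (toLex : (Fin d → ℤ) → Lex (Fin d → ℤ)))
    (F := strictPast d E) toLex.injective (fun y => cylinderEvents_le_pi)
    (fun y y' h => (hg.stronglyMeasurable_shift h).aestronglyMeasurable)
    (fun y y' h => (hg'.stronglyMeasurable_shift h).aestronglyMeasurable)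
    hg.memLp_shift hg'.memLp_shift hg.condExp_shift_eq_zero hg'.condExp_shift_eq_zero]
  have : ∀ y ∈ s ∩ t, ∫ x, g (shift y x) * g' (shift y x)
      ∂(Measure.infinitePi fun _ : Fin d → ℤ => P₀)
      = ∫ x, g x * g' x ∂(Measure.infinitePi fun _ : Fin d → ℤ => P₀) := fun y _ =>
    integral_comp_measurePreserving (measurePreserving_shift (P₀ := P₀) y)
      (f := fun x => g x * g' x) (hg.memLp.1.mul hg'.memLp.1)
  rw [Finset.sum_congr rfl this, Finset.sum_const, nsmul_eq_mul]

theorem sub (hg : IsMartingaleDifference P₀ g) (hg' : IsMartingaleDifference P₀ g') :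
    IsMartingaleDifference P₀ (fun x => g x - g' x) where
  stronglyMeasurable := hg.stronglyMeasurable.sub hg'.stronglyMeasurable
  memLp := hg.memLp.sub hg'.memLp
  condExp_eq_zero := by
    refine (condExp_sub (hg.memLp.integrable (by norm_num)) (hg'.memLp.integrable (by norm_num))
      _).trans ?_
    filter_upwards [hg.condExp_eq_zero, hg'.condExp_eq_zero] with x h1 h2
    simp [h1, h2]

/-- Truncate `g` to `φ`, then subtract the conditional mean `ψ` of `φ` given the strict past to
restore centring. Since `g` is centred, `-ψ` is the conditional expectation of `g - φ`, so by
contraction recentring costs no more than truncation. -/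
theorem exists_bounded_approx (hg : IsMartingaleDifference P₀ g) {ε : ℝ} (hε : 0 < ε) :
    ∃ g', IsMartingaleDifference P₀ g' ∧
      (∃ K, ∀ᵐ x ∂(Measure.infinitePi fun _ : Fin d → ℤ => P₀), |g' x| ≤ K) ∧
      ∫ x, (g x - g' x) ^ 2 ∂(Measure.infinitePi fun _ : Fin d → ℤ => P₀) ≤ ε := by
  set μ := Measure.infinitePi fun _ : Fin d → ℤ => P₀ with hμ
  let φ : ℕ → ((Fin d → ℤ) → E) → ℝ := fun M x => max (-(M : ℝ)) (min (g x) M)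
  have hφm : ∀ M, StronglyMeasurable[weakPast d E 0] (φ M) := fun M =>
    (show Continuous fun r : ℝ => max (-(M : ℝ)) (min r M) by fun_prop).comp_stronglyMeasurable
      hg.stronglyMeasurable
  have hφb : ∀ M x, |φ M x| ≤ M := by
    intro M x
    rw [abs_le]
    have : (0 : ℝ) ≤ M := Nat.cast_nonneg M
    exact ⟨le_max_left _ _, max_le (by linarith) (min_le_right _ _)⟩
  have hφg : ∀ M x, |g x - φ M x| ≤ |g x| := by
    intro M x
    have hM : (0 : ℝ) ≤ M := Nat.cast_nonneg M
    simp only [φ]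
    rcases le_total (g x) M with h1 | h1
    · rw [min_eq_left h1]
      rcases le_total (-(M : ℝ)) (g x) with h2 | h2
      · rw [max_eq_right h2]; simp
      · rw [max_eq_left h2, abs_of_nonpos (by linarith), abs_of_nonpos (by linarith)]; linarith
    · rw [min_eq_right h1, max_eq_right (by linarith), abs_of_nonneg (by linarith),
        abs_of_nonneg (by linarith)]; linarith
  have hφ2 : ∀ M, MemLp (φ M) 2 μ := fun M =>
    MemLp.of_bound ((hφm M).mono cylinderEvents_le_pi).aestronglyMeasurable M
      (Eventually.of_forall (hφb M))
  have hlim : Tendsto (fun M => ∫ x, (g x - φ M x) ^ 2 ∂μ) atTop (𝓝 0) := by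
    have := tendsto_integral_of_dominated_convergence (μ := μ)
      (F := fun M x => (g x - φ M x) ^ 2) (f := fun _ => 0) (fun x => g x ^ 2)
      (fun M => ((hg.memLp.1.sub (hφ2 M).1).pow 2)) hg.memLp.integrable_sq
      (fun M => Eventually.of_forall fun x => by
        rw [Real.norm_eq_abs, abs_of_nonneg (sq_nonneg _), ← sq_abs, ← sq_abs (g x)]
        exact pow_le_pow_left₀ (abs_nonneg _) (hφg M x) 2)
      (Eventually.of_forall fun x => by
        obtain ⟨M₀, hM₀⟩ := exists_nat_ge |g x|
        refine tendsto_const_nhds.congr' ?_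
        filter_upwards [eventually_ge_atTop M₀] with M hM
        have : |g x| ≤ M := hM₀.trans (Nat.cast_le.2 hM)
        have h := abs_le.1 this
        simp [φ, min_eq_left h.2, max_eq_right h.1])
    simpa using this
  -- Truncation and recentring each err by at most `ε / 4` in mean square, and `(a + b)² ≤ 2 a² + 2
  -- b²`.
  obtain ⟨M, hM⟩ := (hlim.eventually (gt_mem_nhds (show (0 : ℝ) < ε / 4 by positivity))).exists
  set ψ := μ[φ M | strictPast d E 0] with hψ
  have hψ2 : MemLp ψ 2 μ := (hφ2 M).condExp (by norm_num)
  have hψm : StronglyMeasurable[strictPast d E 0] ψ := stronglyMeasurable_condExp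
  refine ⟨fun x => φ M x - ψ x, ⟨?_, (hφ2 M).sub hψ2, ?_⟩, ⟨M + M, ?_⟩, ?_⟩
  · exact (hφm M).sub (hψm.mono (strictPast_le_weakPast 0))
  · refine (condExp_sub ((hφ2 M).integrable (by norm_num)) (hψ2.integrable (by norm_num))
      _).trans ?_
    rw [condExp_of_stronglyMeasurable cylinderEvents_le_pi hψm (hψ2.integrable (by norm_num))]
    simp [hψ]
  · have : ∀ᵐ x ∂μ, |ψ x| ≤ M :=
      ae_bdd_abs_condExp_of_ae_bdd_abs (Eventually.of_forall (hφb M))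
    filter_upwards [this] with x hx
    exact (abs_sub _ _).trans (add_le_add (hφb M x) hx)
  · have hd2 : MemLp (fun x => g x - φ M x) 2 μ := hg.memLp.sub (hφ2 M)
    have hc : μ[fun x => g x - φ M x | strictPast d E 0] =ᵐ[μ] fun x => -ψ x := by
      refine (condExp_sub (hg.memLp.integrable (by norm_num))
        ((hφ2 M).integrable (by norm_num)) _).trans ?_
      filter_upwards [hg.condExp_eq_zero] with x hx
      simp [hx, hψ, hμ]
    have hle := integral_sq_condExp_le (m := strictPast d E 0) hd2
    have he : ∫ x, (μ[fun x => g x - φ M x | strictPast d E 0]) x ^ 2 ∂μ = ∫ x, ψ x ^ 2 ∂μ := by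
      refine integral_congr_ae ?_
      filter_upwards [hc] with x hx
      rw [hx]; ring
    rw [he] at hle
    have := integral_sq_add_le hd2 hψ2
    have e2 : ∫ x, (g x - (φ M x - ψ x)) ^ 2 ∂μ = ∫ x, (g x - φ M x + ψ x) ^ 2 ∂μ := by
      congr 1; ext x; ring
    rw [e2]
    linarith

end IsMartingaleDifference

/-- The map `u ↦ exp(i u)` is 1-Lipschitz, so closeness in mean controls characteristic functions.
-/
theorem norm_integral_exp_sub_le {Ω : Type*} {mΩ : MeasurableSpace Ω} {μ : Measure Ω}
    [IsProbabilityMeasure μ] {U V : Ω → ℝ} (hU : Integrable U μ) (hV : Integrable V μ) :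
    ‖∫ x, Complex.exp (U x * Complex.I) ∂μ - ∫ x, Complex.exp (V x * Complex.I) ∂μ‖
      ≤ ∫ x, |U x - V x| ∂μ := by
  have hi : ∀ W : Ω → ℝ, Integrable W μ → Integrable (fun x => Complex.exp (W x * Complex.I)) μ :=
    fun W hW => Integrable.of_bound (C := 1) (Complex.continuous_exp.comp_aestronglyMeasurable
      ((Complex.continuous_ofReal.comp_aestronglyMeasurable hW.1).mul_const _))
      (Eventually.of_forall fun x => (Complex.norm_exp_ofReal_mul_I _).le)
  rw [← integral_sub (hi U hU) (hi V hV)]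
  refine norm_integral_le_of_norm_le (hU.sub hV).abs (Eventually.of_forall fun x => ?_)
  have e : Complex.exp (U x * Complex.I) - Complex.exp (V x * Complex.I)
      = Complex.exp (V x * Complex.I) * (Complex.exp (Complex.I * ((U x - V x : ℝ) : ℂ)) - 1) := by
    rw [mul_sub, ← Complex.exp_add, mul_one]
    congr 2
    push_cast; ring
  rw [e, norm_mul, Complex.norm_exp_ofReal_mul_I, one_mul]
  exact Real.norm_exp_I_mul_ofReal_sub_one_le

variable {k : ℕ}

/-- The central limit theorem for linear combinations of sums of bounded stationary martingale
differences. -/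
theorem tendsto_integral_exp_sum_shift_of_bounded {g : Fin k → ((Fin d → ℤ) → E) → ℝ}
    (hg : ∀ i, IsMartingaleDifference P₀ (g i)) {K : ℝ}
    (hb : ∀ i, ∀ᵐ x ∂(Measure.infinitePi fun _ : Fin d → ℤ => P₀), |g i x| ≤ K)
    {Λ : Fin k → ℕ → Finset (Fin d → ℤ)} {N : ℕ → ℝ} (hN0 : ∀ n, 0 < N n)
    (hN : Tendsto N atTop atTop) [DecidableEq (Fin d → ℤ)] {V : Fin k → Fin k → ℝ}
    (hV : ∀ i j, Tendsto (fun n => (Λ i n ∩ Λ j n).card / N n) atTop (𝓝 (V i j)))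
    (a : Fin k → ℝ) :
    Tendsto (fun n => ∫ x, Complex.exp (((√(N n))⁻¹ * ∑ i, a i * ∑ y ∈ Λ i n, g i (shift y x) : ℝ)
        * Complex.I) ∂(Measure.infinitePi fun _ : Fin d → ℤ => P₀)) atTop
      (𝓝 (Real.exp (-(∑ i, ∑ j, a i * a j * (V i j * ∫ x, g i x * g j x
        ∂(Measure.infinitePi fun _ : Fin d → ℤ => P₀))) / 2) : ℂ)) := by
  set μ := Measure.infinitePi fun _ : Fin d → ℤ => P₀ with hμ
  set σ := ∑ i, ∑ j, a i * a j * (V i j * ∫ x, g i x * g j x ∂μ) with hσ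
  rcases Nat.eq_zero_or_pos k with rfl | hk
  · simp [hσ]
  have hK : 0 ≤ K := by
    obtain ⟨x, hx⟩ := (hb ⟨0, hk⟩).exists
    exact (abs_nonneg _).trans hx
  -- Merge the `k` sums into one over the union of the `Λ i n`: the site `y` carries weight `a i`
  -- for each `i` with `y ∈ Λ i n`.
  let w : ℕ → (Fin d → ℤ) → ((Fin d → ℤ) → E) → ℝ := fun n y x =>
    (√(N n))⁻¹ * ∑ i, (if y ∈ Λ i n then a i else 0) * g i (shift y x)
  let s : ℕ → Finset (Fin d → ℤ) := fun n => Finset.univ.biUnion fun i => Λ i n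
  set B := (∑ i, |a i|) * K with hB
  have hB0 : 0 ≤ B := mul_nonneg (Finset.sum_nonneg fun i _ => abs_nonneg _) hK
  have hsub : ∀ i n, Λ i n ⊆ s n := fun i n =>
    Finset.subset_biUnion_of_mem (fun i => Λ i n) (Finset.mem_univ i)
  have hsum : ∀ n x, ∑ y ∈ s n, w n y x
      = (√(N n))⁻¹ * ∑ i, a i * ∑ y ∈ Λ i n, g i (shift y x) := by
    intro n x
    simp only [w]
    rw [← Finset.mul_sum, Finset.sum_comm]
    congr 1
    refine Finset.sum_congr rfl fun i _ => ?_
    simp_rw [ite_mul, zero_mul]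
    rw [← Finset.sum_filter, Finset.mul_sum, Finset.filter_mem_eq_inter,
      Finset.inter_eq_right.2 (hsub i n)]
  have hsq : ∀ n x, ∑ y ∈ s n, w n y x ^ 2
      = ∑ i, ∑ j, a i * a j * ((N n)⁻¹ * ∑ y ∈ Λ i n ∩ Λ j n, g i (shift y x) * g j (shift y x)) := by
    intro n x
    have h1 : ∀ y, w n y x ^ 2 = ∑ i, ∑ j, (N n)⁻¹ * (a i * a j *
        if y ∈ Λ i n ∩ Λ j n then g i (shift y x) * g j (shift y x) else 0) := by
      intro y
      simp only [w]
      rw [mul_pow, inv_pow, Real.sq_sqrt (hN0 n).le, sq (∑ i, _), Finset.sum_mul_sum,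
        Finset.mul_sum]
      refine Finset.sum_congr rfl fun i _ => ?_
      rw [Finset.mul_sum]
      refine Finset.sum_congr rfl fun j _ => ?_
      by_cases hi : y ∈ Λ i n <;> by_cases hj : y ∈ Λ j n <;> simp [hi, hj]
      exact Or.inl (by ring)
    simp_rw [h1]
    rw [Finset.sum_comm]
    refine Finset.sum_congr rfl fun i _ => ?_
    rw [Finset.sum_comm]
    refine Finset.sum_congr rfl fun j _ => ?_
    rw [← Finset.mul_sum, ← Finset.mul_sum, ← Finset.sum_filter, Finset.filter_mem_eq_inter,
      Finset.inter_eq_right.2 (Finset.inter_subset_left.trans (hsub i n))]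
    ring
  have hgb : ∀ i j, ∀ᵐ x ∂μ, |g i x * g j x| ≤ K * K := by
    intro i j
    filter_upwards [hb i, hb j] with x h1 h2
    rw [abs_mul]
    exact mul_le_mul h1 h2 (abs_nonneg _) hK
  have hgij : ∀ i j y, Integrable (fun x => g i (shift y x) * g j (shift y x)) μ :=
    fun i j y => ((hg i).memLp_shift y).integrable_mul ((hg j).memLp_shift y)
  -- The squares split into normalized sums over `Λ i n ∩ Λ j n` of shifts of the bounded function
  -- `g i * g j`, and each obeys the law of large numbers.
  have hQ : Tendsto (fun n => ∫ x, |∑ y ∈ s n, w n y x ^ 2 - σ| ∂μ) atTop (𝓝 0) := by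
    have hlln : ∀ i j, Tendsto (fun n => ∫ x, |(N n)⁻¹ * ∑ y ∈ Λ i n ∩ Λ j n,
        g i (shift y x) * g j (shift y x) - V i j * ∫ x', g i x' * g j x' ∂μ| ∂μ) atTop (𝓝 0) :=
      fun i j => tendsto_integral_abs_sum_shift_sub (g := fun x => g i x * g j x)
        ((hg i).stronglyMeasurable_pi.mul (hg j).stronglyMeasurable_pi) (hgb i j) hN0 hN (hV i j)
    have htot : Tendsto (fun n => ∑ i, ∑ j, |a i * a j| * ∫ x, |(N n)⁻¹ * ∑ y ∈ Λ i n ∩ Λ j n,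
        g i (shift y x) * g j (shift y x) - V i j * ∫ x', g i x' * g j x' ∂μ| ∂μ) atTop
        (𝓝 (∑ i, ∑ j, |a i * a j| * 0)) :=
      tendsto_finsetSum _ fun i _ => tendsto_finsetSum _ fun j _ => (hlln i j).const_mul _
    simp only [mul_zero, Finset.sum_const_zero] at htot
    refine squeeze_zero (fun n => integral_nonneg fun x => abs_nonneg _) (fun n => ?_) htot
    have hintg : ∀ i j, Integrable (fun x => |a i * a j| * |(N n)⁻¹ * ∑ y ∈ Λ i n ∩ Λ j n,
        g i (shift y x) * g j (shift y x) - V i j * ∫ x', g i x' * g j x' ∂μ|) μ := fun i j =>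
      ((((integrable_finsetSum _ fun y _ => hgij i j y).const_mul _).sub
        (integrable_const _)).abs).const_mul _
    have hsplit : ∑ i, ∑ j, |a i * a j| * ∫ x, |(N n)⁻¹ * ∑ y ∈ Λ i n ∩ Λ j n,
        g i (shift y x) * g j (shift y x) - V i j * ∫ x', g i x' * g j x' ∂μ| ∂μ
        = ∫ x, ∑ i, ∑ j, |a i * a j| * |(N n)⁻¹ * ∑ y ∈ Λ i n ∩ Λ j n,
        g i (shift y x) * g j (shift y x) - V i j * ∫ x', g i x' * g j x' ∂μ| ∂μ := by
      rw [integral_finsetSum _ fun i _ => integrable_finsetSum _ fun j _ => hintg i j]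
      refine Finset.sum_congr rfl fun i _ => ?_
      rw [integral_finsetSum _ fun j _ => hintg i j]
      exact Finset.sum_congr rfl fun j _ => (integral_const_mul _ _).symm
    rw [hsplit]
    refine integral_mono_of_nonneg (Eventually.of_forall fun x => abs_nonneg _)
      (integrable_finsetSum _ fun i _ => integrable_finsetSum _ fun j _ => hintg i j)
      (Eventually.of_forall fun x => ?_)
    simp only [hsq, hσ]
    rw [← Finset.sum_sub_distrib]
    refine (Finset.abs_sum_le_sum_abs _ _).trans (Finset.sum_le_sum fun i _ => ?_)
    rw [← Finset.sum_sub_distrib]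
    refine (Finset.abs_sum_le_sum_abs _ _).trans (Finset.sum_le_sum fun j _ => ?_)
    rw [← mul_sub, abs_mul]
  have hw2 : ∀ n y, MemLp (w n y) 2 μ := fun n y =>
    (memLp_finsetSum _ fun i _ => ((hg i).memLp_shift y).const_mul _).const_mul _
  -- As a limit of means of sums of squares, `σ` is nonnegative with no positivity assumption on
  -- `V`.
  have hσ0 : 0 ≤ σ := by
    have h1 : Tendsto (fun n => ∫ x, ∑ y ∈ s n, w n y x ^ 2 ∂μ) atTop (𝓝 σ) := by
      rw [tendsto_iff_norm_sub_tendsto_zero]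
      refine squeeze_zero (fun n => norm_nonneg _) (fun n => ?_) hQ
      have hi : Integrable (fun x => ∑ y ∈ s n, w n y x ^ 2) μ :=
        integrable_finsetSum _ fun y _ => (hw2 n y).integrable_sq
      have : ∫ x, ∑ y ∈ s n, w n y x ^ 2 ∂μ - σ = ∫ x, (∑ y ∈ s n, w n y x ^ 2 - σ) ∂μ := by
        rw [integral_sub hi (integrable_const _)]; simp
      rw [this]
      exact norm_integral_le_integral_norm _
    exact ge_of_tendsto' h1 fun n => integral_nonneg fun x =>
      Finset.sum_nonneg fun y _ => sq_nonneg _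
  have hwb : ∀ n y, ∀ᵐ x ∂μ, |w n y x| ≤ (√(N n))⁻¹ * B := by
    intro n y
    have hby : ∀ᵐ x ∂μ, ∀ i, |g i (shift y x)| ≤ K := ae_all_iff.2 fun i =>
      (measurePreserving_shift (P₀ := P₀) y).quasiMeasurePreserving.ae (hb i)
    filter_upwards [hby] with x hx
    simp only [w]
    rw [abs_mul, abs_of_nonneg (inv_nonneg.2 (Real.sqrt_nonneg _))]
    gcongr
    refine (Finset.abs_sum_le_sum_abs _ _).trans ?_
    rw [hB, Finset.sum_mul]
    refine Finset.sum_le_sum fun i _ => ?_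
    rw [abs_mul]
    refine mul_le_mul ?_ (hx i) (abs_nonneg _) (abs_nonneg _)
    split_ifs <;> simp
  have hw0 : ∀ n y, μ[w n y | strictPast d E y] =ᵐ[μ] 0 := by
    intro n y
    have e : w n y = (√(N n))⁻¹ • ∑ i, ((if y ∈ Λ i n then a i else 0) • fun x => g i (shift y x)) := by
      ext x; simp only [w, Pi.smul_apply, Finset.sum_apply, smul_eq_mul]
    rw [e]
    refine (condExp_smul _ _ _).trans ?_
    have h1 := condExp_finsetSum (μ := μ) (s := Finset.univ)
      (f := fun i => (if y ∈ Λ i n then a i else 0) • fun x => g i (shift y x))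
      (fun i _ => (((hg i).memLp_shift y).integrable (by norm_num)).smul _) (strictPast d E y)
    have h2 : ∀ᵐ x ∂μ, ∀ i, (μ[(if y ∈ Λ i n then a i else 0) • fun x => g i (shift y x) |
        strictPast d E y]) x = 0 := by
      refine ae_all_iff.2 fun i => ?_
      filter_upwards [condExp_smul (μ := μ) (if y ∈ Λ i n then a i else 0)
        (fun x => g i (shift y x)) (strictPast d E y), (hg i).condExp_shift_eq_zero y] with x h3 h4
      rw [h3, Pi.smul_apply]
      simp only [smul_eq_mul, mul_eq_zero]
      exact Or.inr h4
    filter_upwards [h1, h2] with x h3 h4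
    simp only [Pi.smul_apply, h3, Finset.sum_apply, h4]
    simp
  have hwm : ∀ n y y', toLex y < toLex y' → AEStronglyMeasurable[strictPast d E y'] (w n y) μ := by
    intro n y y' h
    refine StronglyMeasurable.aestronglyMeasurable ?_
    exact (Finset.stronglyMeasurable_fun_sum _ fun i _ =>
      ((hg i).stronglyMeasurable_shift h).const_mul _).const_mul _
  -- The merged differences are bounded by `B / √(N n)` and live on at most `∑ i, (Λ i n).card`
  -- sites; the `+ 1` makes the bound hold for all large `n`.
  set M := (∑ i, V i i + 1) * B ^ 2 with hM
  have hcard : ∀ᶠ n in atTop, (s n).card * ((√(N n))⁻¹ * B) ^ 2 ≤ M := by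
    have h1 : Tendsto (fun n => ∑ i, ((Λ i n ∩ Λ i n).card / N n : ℝ)) atTop (𝓝 (∑ i, V i i)) :=
      tendsto_finsetSum _ fun i _ => hV i i
    filter_upwards [h1.eventually (ge_mem_nhds (lt_add_one _))] with n hn
    rw [mul_pow, inv_pow, Real.sq_sqrt (hN0 n).le, ← mul_assoc, hM]
    refine mul_le_mul_of_nonneg_right (le_trans ?_ hn) (sq_nonneg _)
    rw [← Finset.sum_div, ← div_eq_mul_inv]
    refine div_le_div_of_nonneg_right ?_ (hN0 n).le
    have := Finset.card_biUnion_le (s := Finset.univ) (t := fun i => Λ i n)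
    simp only [Finset.inter_self]
    exact_mod_cast this
  have hc : Tendsto (fun n => (√(N n))⁻¹ * B) atTop (𝓝 0) := by
    have := (Real.tendsto_sqrt_atTop.comp hN).inv_tendsto_atTop.mul_const B
    simpa using this
  rw [tendsto_iff_norm_sub_tendsto_zero]
  have hlim : Tendsto (fun n => 2 * ((√(N n))⁻¹ * B) * M
      + Real.exp (M / 2) * ∫ x, |∑ y ∈ s n, w n y x ^ 2 - σ| ∂μ) atTop (𝓝 0) := by
    simpa using ((hc.const_mul 2).mul_const M).add (hQ.const_mul (Real.exp (M / 2)))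
  refine squeeze_zero' (Eventually.of_forall fun n => norm_nonneg _) ?_ hlim
  filter_upwards [hcard, hc.eventually (ge_mem_nhds zero_lt_one)] with n h1 h2
  have := norm_integral_exp_sum_sub_le (r := (toLex : (Fin d → ℤ) → Lex (Fin d → ℤ)))
    (F := strictPast d E) toLex.injective (fun y => cylinderEvents_le_pi) (hwm n)
    (fun y => (hw2 n y).1) (mul_nonneg (inv_nonneg.2 (Real.sqrt_nonneg _)) hB0) h2 hσ0 (hwb n)
    (hw0 n) (s n) h1
  simp_rw [hsum] at this
  exact this

/-- The central limit theorem for linear combinations of sums of stationary martingale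
differences. -/
theorem tendsto_integral_exp_sum_shift {g : Fin k → ((Fin d → ℤ) → E) → ℝ}
    (hg : ∀ i, IsMartingaleDifference P₀ (g i))
    {Λ : Fin k → ℕ → Finset (Fin d → ℤ)} {N : ℕ → ℝ} (hN0 : ∀ n, 0 < N n)
    (hN : Tendsto N atTop atTop) [DecidableEq (Fin d → ℤ)] {V : Fin k → Fin k → ℝ}
    (hV : ∀ i j, Tendsto (fun n => (Λ i n ∩ Λ j n).card / N n) atTop (𝓝 (V i j)))
    (a : Fin k → ℝ) :
    Tendsto (fun n => ∫ x, Complex.exp (((√(N n))⁻¹ * ∑ i, a i * ∑ y ∈ Λ i n, g i (shift y x) : ℝ)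
        * Complex.I) ∂(Measure.infinitePi fun _ : Fin d → ℤ => P₀)) atTop
      (𝓝 (Real.exp (-(∑ i, ∑ j, a i * a j * (V i j * ∫ x, g i x * g j x
        ∂(Measure.infinitePi fun _ : Fin d → ℤ => P₀))) / 2) : ℂ)) := by
  set μ := Measure.infinitePi fun _ : Fin d → ℤ => P₀ with hμ
  have hex : ∀ (m : ℕ) (i : Fin k), ∃ g', IsMartingaleDifference P₀ g' ∧
      (∃ K, ∀ᵐ x ∂μ, |g' x| ≤ K) ∧ ∫ x, (g i x - g' x) ^ 2 ∂μ ≤ 1 / ((m : ℝ) + 1) :=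
    fun m i => (hg i).exists_bounded_approx (by positivity)
  choose g' hg' hb' happ using hex
  choose K hK using hb'
  have hbK : ∀ m i, ∀ᵐ x ∂μ, |g' m i x| ≤ ∑ i, |K m i| := by
    intro m i
    filter_upwards [hK m i] with x hx
    exact hx.trans ((le_abs_self _).trans (Finset.single_le_sum (f := fun i => |K m i|)
      (fun i _ => abs_nonneg _) (Finset.mem_univ i)))
  have hm := fun m => tendsto_integral_exp_sum_shift_of_bounded (hg' m) (hbK m) hN0 hN hV a
  have happ0 : ∀ i, Tendsto (fun m => ∫ x, (g i x - g' m i x) ^ 2 ∂μ) atTop (𝓝 0) := fun i =>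
    squeeze_zero (fun m => integral_nonneg fun x => sq_nonneg _) (fun m => happ m i)
      tendsto_one_div_add_atTop_nhds_zero_nat
  have hsq0 : ∀ i, Tendsto (fun m => √(∫ x, (g i x - g' m i x) ^ 2 ∂μ)) atTop (𝓝 0) := fun i => by
    have := (Real.continuous_sqrt.tendsto 0).comp (happ0 i)
    rwa [Real.sqrt_zero] at this
  have hprod : ∀ i j, Tendsto (fun m => ∫ x, g' m i x * g' m j x ∂μ) atTop
      (𝓝 (∫ x, g i x * g j x ∂μ)) := by
    intro i j
    rw [tendsto_iff_norm_sub_tendsto_zero]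
    have hb : Tendsto (fun m => √(∫ x, (g i x - g' m i x) ^ 2 ∂μ) * √(∫ x, g j x ^ 2 ∂μ)
        + √(∫ x, g i x ^ 2 ∂μ) * √(∫ x, (g j x - g' m j x) ^ 2 ∂μ)
        + √(∫ x, (g i x - g' m i x) ^ 2 ∂μ) * √(∫ x, (g j x - g' m j x) ^ 2 ∂μ)) atTop (𝓝 0) := by
      simpa using (((hsq0 i).mul_const _).add ((hsq0 j).const_mul _)).add ((hsq0 i).mul (hsq0 j))
    refine squeeze_zero (fun m => norm_nonneg _) (fun m => ?_) hb
    exact abs_integral_mul_sub_le (hg i).memLp (hg j).memLp (hg' m i).memLp (hg' m j).memLp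
  have hLm : Tendsto (fun m => (Real.exp (-(∑ i, ∑ j, a i * a j * (V i j *
      ∫ x, g' m i x * g' m j x ∂μ)) / 2) : ℂ)) atTop
      (𝓝 (Real.exp (-(∑ i, ∑ j, a i * a j * (V i j * ∫ x, g i x * g j x ∂μ)) / 2) : ℂ)) := by
    refine (Complex.continuous_ofReal.tendsto _).comp ((Real.continuous_exp.tendsto _).comp ?_)
    refine Tendsto.div_const (Tendsto.neg ?_) 2
    exact tendsto_finsetSum _ fun i _ => tendsto_finsetSum _ fun j _ =>
      ((hprod i j).const_mul _).const_mul _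
  have hem : Tendsto (fun m => ∑ i, |a i| * √((V i i + 1) * ∫ x, (g i x - g' m i x) ^ 2 ∂μ))
      atTop (𝓝 0) := by
    have : Tendsto (fun m => ∑ i, |a i| * √((V i i + 1) * ∫ x, (g i x - g' m i x) ^ 2 ∂μ))
        atTop (𝓝 (∑ i : Fin k, |a i| * √((V i i + 1) * 0))) :=
      tendsto_finsetSum _ fun i _ => (((Real.continuous_sqrt.tendsto _).comp
        ((happ0 i).const_mul _))).const_mul _
    simpa using this
  -- The approximation error must be controlled by a bound independent of `n`. Orthogonality gives
  -- this: the second moment of the error sum is the number of sites times that of one term, and the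
  -- count is comparable to `N n`.
  have hcomp : ∀ m, ∀ᶠ n in atTop,
      ‖∫ x, Complex.exp (((√(N n))⁻¹ * ∑ i, a i * ∑ y ∈ Λ i n, g i (shift y x) : ℝ)
        * Complex.I) ∂μ
      - ∫ x, Complex.exp (((√(N n))⁻¹ * ∑ i, a i * ∑ y ∈ Λ i n, g' m i (shift y x) : ℝ)
        * Complex.I) ∂μ‖ ≤ ∑ i, |a i| * √((V i i + 1) * ∫ x, (g i x - g' m i x) ^ 2 ∂μ) := by
    intro m
    have hev : ∀ᶠ n in atTop, ∀ i, ((Λ i n ∩ Λ i n).card / N n : ℝ) ≤ V i i + 1 :=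
      eventually_all.2 fun i => (hV i i).eventually (ge_mem_nhds (lt_add_one _))
    filter_upwards [hev] with n hn
    have hU : ∀ f : Fin k → ((Fin d → ℤ) → E) → ℝ, (∀ i, IsMartingaleDifference P₀ (f i)) →
        Integrable (fun x => (√(N n))⁻¹ * ∑ i, a i * ∑ y ∈ Λ i n, f i (shift y x)) μ := fun f hf =>
      (integrable_finsetSum _ fun i _ => (integrable_finsetSum _ fun y _ =>
        ((hf i).memLp_shift y).integrable (by norm_num)).const_mul _).const_mul _
    refine (norm_integral_exp_sub_le (hU g hg) (hU (g' m) (hg' m))).trans ?_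
    have hD2 : ∀ i, MemLp (fun x => ∑ y ∈ Λ i n, (g i (shift y x) - g' m i (shift y x))) 2 μ :=
      fun i => memLp_finsetSum _ fun y _ => ((hg i).sub (hg' m i)).memLp_shift y
    have hDi : ∀ i, Integrable (fun x => |a i| * ((√(N n))⁻¹ *
        |∑ y ∈ Λ i n, (g i (shift y x) - g' m i (shift y x))|)) μ := fun i =>
      ((((hD2 i).integrable (by norm_num)).abs).const_mul _).const_mul _
    calc _ ≤ ∫ x, ∑ i, |a i| * ((√(N n))⁻¹ *
          |∑ y ∈ Λ i n, (g i (shift y x) - g' m i (shift y x))|) ∂μ := by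
          refine integral_mono_of_nonneg (Eventually.of_forall fun x => abs_nonneg _)
            (integrable_finsetSum _ fun i _ => hDi i) (Eventually.of_forall fun x => ?_)
          simp only
          rw [← mul_sub, ← Finset.sum_sub_distrib, abs_mul,
            abs_of_nonneg (inv_nonneg.2 (Real.sqrt_nonneg _))]
          refine (mul_le_mul_of_nonneg_left (Finset.abs_sum_le_sum_abs _ _)
            (inv_nonneg.2 (Real.sqrt_nonneg _))).trans (le_of_eq ?_)
          rw [Finset.mul_sum]
          refine Finset.sum_congr rfl fun i _ => ?_
          rw [← mul_sub, ← Finset.sum_sub_distrib, abs_mul]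
          ring
      _ = ∑ i, |a i| * ((√(N n))⁻¹ *
          ∫ x, |∑ y ∈ Λ i n, (g i (shift y x) - g' m i (shift y x))| ∂μ) := by
          rw [integral_finsetSum _ fun i _ => hDi i]
          simp_rw [integral_const_mul]
      _ ≤ _ := by
          refine Finset.sum_le_sum fun i _ => mul_le_mul_of_nonneg_left ?_ (abs_nonneg _)
          have h1 := integral_abs_le_sqrt (hD2 i)
          have h2 := ((hg i).sub (hg' m i)).integral_sum_mul_sum ((hg i).sub (hg' m i))
            (Λ i n) (Λ i n)
          simp_rw [← sq] at h2
          rw [h2] at h1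
          have h3 : 0 ≤ ∫ x, (g i x - g' m i x) ^ 2 ∂μ := integral_nonneg fun x => sq_nonneg _
          calc _ ≤ (√(N n))⁻¹ * √((Λ i n ∩ Λ i n).card * ∫ x, (g i x - g' m i x) ^ 2 ∂μ) :=
                mul_le_mul_of_nonneg_left h1 (inv_nonneg.2 (Real.sqrt_nonneg _))
            _ = √((Λ i n ∩ Λ i n).card / N n * ∫ x, (g i x - g' m i x) ^ 2 ∂μ) := by
                rw [← Real.sqrt_inv, ← Real.sqrt_mul (inv_nonneg.2 (hN0 n).le)]
                congr 1; ring
            _ ≤ _ := Real.sqrt_le_sqrt (mul_le_mul_of_nonneg_right (hn i) h3)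
  rw [Metric.tendsto_nhds]
  intro ε hε
  -- The truncation level `m` is fixed before `n` is sent to infinity.
  obtain ⟨m, h1, h2⟩ := ((Metric.tendsto_nhds.1 hLm (ε / 3) (by positivity)).and
    (hem.eventually (gt_mem_nhds (show (0 : ℝ) < ε / 3 by positivity)))).exists
  filter_upwards [hcomp m, Metric.tendsto_nhds.1 (hm m) (ε / 3) (by positivity)] with n h3 h4
  have h5 := dist_triangle4 (∫ x, Complex.exp (((√(N n))⁻¹ * ∑ i, a i *
      ∑ y ∈ Λ i n, g i (shift y x) : ℝ) * Complex.I) ∂μ)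
    (∫ x, Complex.exp (((√(N n))⁻¹ * ∑ i, a i * ∑ y ∈ Λ i n, g' m i (shift y x) : ℝ)
        * Complex.I) ∂μ)
    (Real.exp (-(∑ i, ∑ j, a i * a j * (V i j * ∫ x, g' m i x * g' m j x ∂μ)) / 2) : ℂ)
    (Real.exp (-(∑ i, ∑ j, a i * a j * (V i j * ∫ x, g i x * g j x ∂μ)) / 2) : ℂ)
  rw [← dist_eq_norm] at h3
  linarith

end CentralLimit

/-! ### Lattice points in dilated sets and rescaled lattice sums. -/

section Lattice

variable {d : ℕ}

/-- The lattice point `⌊t x⌋`, coordinate by coordinate. -/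
noncomputable def latticeFloor (t : ℝ) (x : EuclideanSpace ℝ (Fin d)) : Fin d → ℤ :=
  fun i => ⌊t * x i⌋

theorem measurable_latticeFloor (t : ℝ) :
    Measurable (latticeFloor t : EuclideanSpace ℝ (Fin d) → Fin d → ℤ) :=
  measurable_pi_iff.2 fun i => Int.measurable_floor.comp (by fun_prop)

theorem volume_latticeFloor_preimage {t : ℝ} (ht : 0 < t) (y : Fin d → ℤ) :
    volume.real (latticeFloor t ⁻¹' {y} : Set (EuclideanSpace ℝ (Fin d))) = (t ^ d)⁻¹ := by
  have h1 : (latticeFloor t ⁻¹' {y} : Set (EuclideanSpace ℝ (Fin d)))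
      = WithLp.ofLp ⁻¹' (Set.univ.pi fun i => Set.Ico ((y i : ℝ) / t) ((y i + 1) / t)) := by
    ext x
    simp only [Set.mem_preimage, Set.mem_singleton_iff, Set.mem_pi, Set.mem_univ, forall_true_left,
      Set.mem_Ico, funext_iff, latticeFloor, Int.floor_eq_iff]
    refine forall_congr' fun i => ?_
    rw [div_le_iff₀ ht, lt_div_iff₀ ht, mul_comm t]
  have h2 := PiLp.volume_preserving_ofLp (Fin d)
  rw [Measure.real, h1, h2.measure_preimage (MeasurableSet.univ_pi fun i =>
    measurableSet_Ico).nullMeasurableSet, Real.volume_pi_Ico, ENNReal.toReal_prod]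
  have : ∀ i, ((y i + 1 : ℝ) / t - y i / t) = t⁻¹ := fun i => by field_simp; ring
  simp [this, ht.le]

/-- The integrand is constant on cubes of side `1 / t`. Writing a lattice sum as an integral opens
it to dominated convergence. -/
theorem integral_comp_latticeFloor {t : ℝ} (ht : 0 < t) (s : Finset (Fin d → ℤ))
    {F : (Fin d → ℤ) → ℝ} (hF : ∀ y ∉ s, F y = 0) :
    ∫ x : EuclideanSpace ℝ (Fin d), F (latticeFloor t x) = (t ^ d)⁻¹ * ∑ y ∈ s, F y := by
  have hm : ∀ y, MeasurableSet (latticeFloor t ⁻¹' {y} : Set (EuclideanSpace ℝ (Fin d))) :=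
    fun y => measurable_latticeFloor t (measurableSet_singleton y)
  have hfin : ∀ y, volume (latticeFloor t ⁻¹' {y} : Set (EuclideanSpace ℝ (Fin d))) ≠ ∞ := by
    intro y h
    have h1 := volume_latticeFloor_preimage ht y
    rw [Measure.real, h] at h1
    simp only [ENNReal.toReal_top] at h1
    have : 0 < (t ^ d)⁻¹ := by positivity
    exact this.ne h1
  have h1 : ∀ x : EuclideanSpace ℝ (Fin d), F (latticeFloor t x)
      = ∑ y ∈ s, (latticeFloor t ⁻¹' {y}).indicator (fun _ => F y) x := by
    intro x
    by_cases hx : latticeFloor t x ∈ s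
    · rw [Finset.sum_eq_single_of_mem _ hx]
      · simp
      · intro y _ hy
        simp [Set.indicator, hy.symm]
    · rw [hF _ hx, Finset.sum_eq_zero]
      intro y hy
      have : latticeFloor t x ≠ y := fun h => hx (h ▸ hy)
      simp [Set.indicator, this]
  simp_rw [h1]
  rw [integral_finsetSum _ fun y _ => (integrable_indicator_iff (hm y)).2
    (integrableOn_const (hfin y)), Finset.mul_sum]
  refine Finset.sum_congr rfl fun y _ => ?_
  rw [integral_indicator (hm y), setIntegral_const, volume_latticeFloor_preimage ht, smul_eq_mul]

theorem norm_latticePoint_latticeFloor_sub_le (t : ℝ) (x : EuclideanSpace ℝ (Fin d)) :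
    ‖latticePoint (latticeFloor t x) - t • x‖ ≤ √(d : ℝ) := by
  rw [EuclideanSpace.norm_eq]
  refine Real.sqrt_le_sqrt ?_
  calc _ ≤ ∑ _i : Fin d, (1 : ℝ) := by
        refine Finset.sum_le_sum fun i _ => ?_
        have : (latticePoint (latticeFloor t x) - t • x) i = ⌊t * x i⌋ - t * x i := rfl
        rw [this, Real.norm_eq_abs, sq_abs]
        have h1 := Int.floor_le (t * x i)
        have h2 := Int.lt_floor_add_one (t * x i)
        nlinarith
    _ = d := by simp

theorem latticePoint_neg (y : Fin d → ℤ) : latticePoint (-y) = -latticePoint y := by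
  ext i; simp [latticePoint]

/-- Points at bounded distance from `t x` lie in `t S` for large `t`, if `x` is interior to `S`. -/
theorem eventually_mem_smul_of_mem_interior {S : Set (EuclideanSpace ℝ (Fin d))}
    {x : EuclideanSpace ℝ (Fin d)} (hx : x ∈ interior S) {t : ℕ → ℝ} (ht : Tendsto t atTop atTop)
    {q : ℕ → EuclideanSpace ℝ (Fin d)} {R : ℝ} (hq : ∀ n, ‖q n - t n • x‖ ≤ R) :
    ∀ᶠ n in atTop, q n ∈ t n • S := by
  obtain ⟨r, hr, hball⟩ := Metric.isOpen_iff.1 isOpen_interior x hx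
  filter_upwards [ht.eventually_gt_atTop (max 0 (R / r))] with n hn
  have h0 : 0 < t n := (le_max_left _ _).trans_lt hn
  rw [Set.mem_smul_set_iff_inv_smul_mem₀ h0.ne']
  refine interior_subset (hball ?_)
  rw [Metric.mem_ball, dist_eq_norm]
  have e : (t n)⁻¹ • q n - x = (t n)⁻¹ • (q n - t n • x) := by
    rw [smul_sub, smul_smul, inv_mul_cancel₀ h0.ne', one_smul]
  rw [e, norm_smul, norm_inv, Real.norm_eq_abs, abs_of_pos h0, inv_mul_lt_iff₀ h0]
  have h1 : R / r < t n := (le_max_right _ _).trans_lt hn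
  rw [div_lt_iff₀ hr] at h1
  exact (hq n).trans_lt h1

/-- For fixed `p`, the point `p + ⌊t x⌋` stays at bounded distance from `t x` and is therefore
eventually in `t S`. This produces the sequences to which the stabilization hypotheses apply. -/
theorem setLiminf_vadd_smul_eq_univ {S : Set (EuclideanSpace ℝ (Fin d))}
    {x : EuclideanSpace ℝ (Fin d)} (hx : x ∈ interior S) {t : ℕ → ℝ}
    (ht : Tendsto t atTop atTop) :
    setLiminf (fun n => latticePoint (-latticeFloor (t n) x) +ᵥ (t n • S)) = Set.univ := by
  rw [Set.eq_univ_iff_forall]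
  intro p
  have h := eventually_mem_smul_of_mem_interior hx ht
    (q := fun n => p + latticePoint (latticeFloor (t n) x)) (R := ‖p‖ + √(d : ℝ)) fun n => by
      rw [add_sub_assoc]
      exact (norm_add_le _ _).trans (by gcongr; exact norm_latticePoint_latticeFloor_sub_le _ _)
  obtain ⟨n, hn⟩ := eventually_atTop.1 h
  refine Set.mem_iUnion.2 ⟨n, Set.mem_iInter₂.2 fun m hm => ?_⟩
  rw [Set.mem_vadd_set_iff_neg_vadd_mem, latticePoint_neg, neg_neg, vadd_eq_add, add_comm]
  exact hn m hm

theorem eventually_latticePoint_mem {A : Set (EuclideanSpace ℝ (Fin d))}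
    {x : EuclideanSpace ℝ (Fin d)} (hx : x ∈ interior A) {t : ℕ → ℝ}
    (ht : Tendsto t atTop atTop) :
    ∀ᶠ n in atTop, latticePoint (latticeFloor (t n) x) ∈ t n • A :=
  eventually_mem_smul_of_mem_interior hx ht fun _ => norm_latticePoint_latticeFloor_sub_le _ _

theorem eventually_notMem_discretization {A : Set (EuclideanSpace ℝ (Fin d))}
    {x : EuclideanSpace ℝ (Fin d)} (hx : x ∉ closure A) {t : ℕ → ℝ}
    (ht : Tendsto t atTop atTop) (ρ : ℝ) :
    ∀ᶠ n in atTop, latticeFloor (t n) x ∉ discretization ρ (t n • A) := by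
  by_contra hcon
  rw [not_eventually] at hcon
  simp only [not_not] at hcon
  have hx' : x ∈ interior Aᶜ := by rwa [interior_compl]
  -- When the ball misses `t A` the default point is `t x` itself. The `max 0` keeps the distance
  -- bound valid for it, since `ρ` may be negative here.
  have hq : ∀ n, ∃ q : EuclideanSpace ℝ (Fin d),
      (latticeFloor (t n) x ∈ discretization ρ (t n • A) →
        q ∈ Metric.closedBall (latticePoint (latticeFloor (t n) x)) ρ ∩ t n • A) ∧
      ‖q - t n • x‖ ≤ max 0 (ρ + √(d : ℝ)) := by
    intro n
    by_cases h : latticeFloor (t n) x ∈ discretization ρ (t n • A)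
    · obtain ⟨q, hq⟩ := h
      refine ⟨q, fun _ => hq, le_max_of_le_right ?_⟩
      have h1 : ‖q - latticePoint (latticeFloor (t n) x)‖ ≤ ρ := by
        simpa [dist_eq_norm] using hq.1
      calc ‖q - t n • x‖ = ‖(q - latticePoint (latticeFloor (t n) x))
            + (latticePoint (latticeFloor (t n) x) - t n • x)‖ := by congr 1; abel
        _ ≤ _ := (norm_add_le _ _).trans
            (add_le_add h1 (norm_latticePoint_latticeFloor_sub_le _ _))
    · exact ⟨t n • x, fun h' => absurd h' h, by simp⟩
  choose q hq1 hq2 using hq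
  have h1 := eventually_mem_smul_of_mem_interior hx' ht hq2
  obtain ⟨n, hn, h2, h3⟩ := (hcon.and_eventually (h1.and (ht.eventually_gt_atTop 0))).exists
  have h4 := (hq1 n hn).2
  rw [Set.mem_smul_set_iff_inv_smul_mem₀ h3.ne'] at h2 h4
  exact h2 h4

theorem mem_discretization_of_latticePoint_mem {A : Set (EuclideanSpace ℝ (Fin d))} {ρ : ℝ}
    (hρ : 0 ≤ ρ) {y : Fin d → ℤ} (hy : latticePoint y ∈ A) : y ∈ discretization ρ A :=
  ⟨latticePoint y, Metric.mem_closedBall_self hρ, hy⟩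

theorem finite_discretization {A : Set (EuclideanSpace ℝ (Fin d))} (hA : Bornology.IsBounded A)
    (ρ : ℝ) : (discretization ρ A).Finite := by
  obtain ⟨R, hR⟩ := hA.exists_norm_le
  have hsub : discretization ρ A ⊆ Set.univ.pi fun _ : Fin d => Set.Icc (-⌈ρ + R⌉) ⌈ρ + R⌉ := by
    rintro y ⟨q, hq1, hq2⟩ i _
    have h1 : ‖latticePoint y‖ ≤ ρ + R := by
      have h2 : ‖latticePoint y - q‖ ≤ ρ := by
        rw [← dist_eq_norm, dist_comm]; exact hq1
      calc ‖latticePoint y‖ = ‖(latticePoint y - q) + q‖ := by congr 1; abel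
        _ ≤ _ := (norm_add_le _ _).trans (add_le_add h2 (hR q hq2))
    have h3 : |(y i : ℝ)| ≤ ρ + R := (PiLp.norm_apply_le (latticePoint y) i).trans h1
    have h4 := abs_le.1 (h3.trans (Int.le_ceil _))
    constructor
    · exact_mod_cast h4.1
    · exact_mod_cast h4.2
  exact (Set.Finite.pi fun _ => Set.finite_Icc _ _).subset hsub

/-- The displacement `ρ + √d` is measured at scale `t ≥ 1`, so rescaling only shrinks it. The
resulting ball does not depend on `t` and serves as domain of domination. -/
theorem norm_le_of_latticeFloor_mem_discretization {B : Set (EuclideanSpace ℝ (Fin d))} {R ρ t : ℝ}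
    (hR : ∀ x ∈ B, ‖x‖ ≤ R) (ht : 1 ≤ t) {x : EuclideanSpace ℝ (Fin d)}
    (hx : latticeFloor t x ∈ discretization ρ (t • B)) : ‖x‖ ≤ R + ρ + √(d : ℝ) := by
  obtain ⟨q, hq1, b, hb, rfl⟩ := hx
  have h0 : 0 < t := by linarith
  have h1 : ‖t • b - latticePoint (latticeFloor t x)‖ ≤ ρ := by
    rw [← dist_eq_norm]; exact hq1
  have h2 : ‖t • (x - b)‖ ≤ ρ + √(d : ℝ) := by
    calc ‖t • (x - b)‖ = ‖-((t • b - latticePoint (latticeFloor t x))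
          + (latticePoint (latticeFloor t x) - t • x))‖ := by
          congr 1; rw [smul_sub]; abel
      _ ≤ _ := by
          rw [norm_neg]
          exact (norm_add_le _ _).trans
            (add_le_add h1 (norm_latticePoint_latticeFloor_sub_le _ _))
  rw [norm_smul, Real.norm_eq_abs, abs_of_pos h0] at h2
  have h3 : ‖x - b‖ ≤ ρ + √(d : ℝ) :=
    (le_mul_of_one_le_left (norm_nonneg _) ht).trans h2
  calc ‖x‖ = ‖b + (x - b)‖ := by congr 1; abel
    _ ≤ R + (ρ + √(d : ℝ)) := (norm_add_le _ _).trans (add_le_add (hR b hb) h3)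
    _ = _ := by ring

/-- Rescaled lattice sums converge to integrals. -/
theorem tendsto_sum_discretization {B : Set (EuclideanSpace ℝ (Fin d))}
    (hB : Bornology.IsBounded B) {ρ : ℝ} {t : ℕ → ℝ} (ht1 : ∀ n, 1 ≤ t n)
    {Λ : ℕ → Finset (Fin d → ℤ)} (hΛ : ∀ n, ∀ y ∈ Λ n, y ∈ discretization ρ (t n • B))
    {F : ℕ → (Fin d → ℤ) → ℝ} (hF : ∀ n, ∀ y ∉ Λ n, F n y = 0) {C : ℝ}
    (hC : ∀ n y, |F n y| ≤ C) {φ : EuclideanSpace ℝ (Fin d) → ℝ}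
    (hφ : ∀ᵐ x, Tendsto (fun n => F n (latticeFloor (t n) x)) atTop (𝓝 (φ x))) :
    Tendsto (fun n => (t n ^ d)⁻¹ * ∑ y ∈ Λ n, F n y) atTop (𝓝 (∫ x, φ x)) := by
  obtain ⟨R, hR⟩ := hB.exists_norm_le
  have h1 : ∀ n, (t n ^ d)⁻¹ * ∑ y ∈ Λ n, F n y
      = ∫ x : EuclideanSpace ℝ (Fin d), F n (latticeFloor (t n) x) := fun n =>
    (integral_comp_latticeFloor (zero_lt_one.trans_le (ht1 n)) (Λ n) (hF n)).symm
  simp_rw [h1]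
  refine tendsto_integral_of_dominated_convergence
    ((Metric.closedBall 0 (R + ρ + √(d : ℝ))).indicator fun _ => C) ?_ ?_ ?_ hφ
  · intro n
    exact ((measurable_of_countable (F n)).comp
      (measurable_latticeFloor (t n))).aestronglyMeasurable
  · exact (integrable_indicator_iff Metric.isClosed_closedBall.measurableSet).2
      (integrableOn_const (measure_closedBall_lt_top.ne))
  · intro n
    refine Eventually.of_forall fun x => ?_
    by_cases hx : latticeFloor (t n) x ∈ Λ n
    · have := norm_le_of_latticeFloor_mem_discretization hR (ht1 n) (hΛ n _ hx)
      rw [Set.indicator_of_mem (by simpa using this)]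
      exact hC n _
    · rw [hF n _ hx, norm_zero]
      exact Set.indicator_nonneg (fun _ _ => (abs_nonneg _).trans (hC n 0)) _

/-- The number of lattice points in `t A` is asymptotic to `t ^ d |A|`. -/
theorem tendsto_card_div_pow {A : Set (EuclideanSpace ℝ (Fin d))} (hA : IsRiemannMeasurable A)
    {t : ℕ → ℝ} (ht1 : ∀ n, 1 ≤ t n) (ht : Tendsto t atTop atTop)
    {Λ : ℕ → Finset (Fin d → ℤ)} (hΛ : ∀ n y, y ∈ Λ n ↔ latticePoint y ∈ t n • A) :
    Tendsto (fun n => (Λ n).card / t n ^ d) atTop (𝓝 (volume.real A)) := by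
  classical
  have h := tendsto_sum_discretization hA.1 ht1 (Λ := Λ)
    (F := fun n y => if y ∈ Λ n then 1 else 0) (C := 1)
    (φ := (interior A).indicator fun _ => 1)
    (fun n y hy => mem_discretization_of_latticePoint_mem le_rfl ((hΛ n y).1 hy))
    (fun n y hy => by simp [hy]) (fun n y => by split_ifs <;> simp) ?_
  · rw [integral_indicator isOpen_interior.measurableSet, setIntegral_const, smul_eq_mul,
      mul_one] at h
    have hv : volume.real (interior A) = volume.real A :=
      measureReal_congr (interior_ae_eq_of_null_frontier hA.2)
    rw [hv] at h
    refine h.congr fun n => ?_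
    rw [Finset.sum_ite_mem, Finset.inter_self]
    simp [div_eq_inv_mul]
  · have : ∀ᵐ x, x ∉ frontier A := measure_eq_zero_iff_ae_notMem.1 hA.2
    filter_upwards [this] with x hx
    by_cases hi : x ∈ interior A
    · rw [Set.indicator_of_mem hi]
      refine tendsto_const_nhds.congr' ?_
      filter_upwards [eventually_latticePoint_mem hi ht] with n hn
      simp [hΛ, hn]
    · rw [Set.indicator_of_notMem hi]
      have hc : x ∉ closure A := fun h => hx ⟨h, hi⟩
      refine tendsto_const_nhds.congr' ?_
      filter_upwards [eventually_notMem_discretization hc ht 0] with n hn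
      have : latticeFloor (t n) x ∉ Λ n := fun h' =>
        hn (mem_discretization_of_latticePoint_mem le_rfl ((hΛ n _).1 h'))
      simp [this]

theorem IsRiemannMeasurable.inter {A B : Set (EuclideanSpace ℝ (Fin d))}
    (hA : IsRiemannMeasurable A) (hB : IsRiemannMeasurable B) : IsRiemannMeasurable (A ∩ B) := by
  refine ⟨hA.1.subset Set.inter_subset_left, ?_⟩
  refine measure_mono_null (frontier_inter_subset A B) (measure_union_null ?_ ?_)
  · exact measure_mono_null Set.inter_subset_left hA.2
  · exact measure_mono_null Set.inter_subset_right hB.2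

end Lattice

/-! ### Uniform integrability from moments of order above two. -/

section UniformIntegrability

variable {Ω : Type*} {mΩ : MeasurableSpace Ω} {P : Measure Ω}

theorem eLpNorm_le_of_lintegral_rpow_le {f : Ω → ℝ} {γ : ℝ} (hγ : 0 < γ) {C : ℝ≥0}
    (h : ∫⁻ ω, ‖f ω‖ₑ ^ γ ∂P ≤ C) :
    eLpNorm f (ENNReal.ofReal γ) P ≤ ((C ^ (1 / γ) : ℝ≥0) : ℝ≥0∞) := by
  rw [eLpNorm_eq_lintegral_rpow_enorm_toReal (by simpa using hγ) ENNReal.ofReal_ne_top,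
    ENNReal.toReal_ofReal hγ.le, ENNReal.coe_rpow_of_nonneg _ (by positivity)]
  exact ENNReal.rpow_le_rpow h (by positivity)

theorem integral_sq_eq_eLpNorm {f : Ω → ℝ} (hf : MemLp f 2 P) :
    ∫ ω, f ω ^ 2 ∂P = (eLpNorm f 2 P).toReal ^ 2 := by
  rw [hf.eLpNorm_eq_integral_rpow_norm (by norm_num) (by norm_num)]
  simp only [ENNReal.toReal_ofNat, Real.norm_eq_abs, Real.rpow_ofNat, sq_abs]
  rw [ENNReal.toReal_ofReal (by positivity), ← Real.rpow_natCast, ← Real.rpow_mul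
    (integral_nonneg fun _ => sq_nonneg _)]
  norm_num

/-- Hölder on a small event `s` bounds the `L²` norm by the `L^γ` norm times `P(s)` to the positive
power `θ = 1/2 - 1/γ`. -/
theorem unifIntegrable_two_of_eLpNorm_le {ι : Type*} {f : ι → Ω → ℝ} {γ : ℝ} (hγ : 2 < γ)
    (hf : ∀ n, AEStronglyMeasurable (f n) P) {K : ℝ≥0}
    (hK : ∀ n, eLpNorm (f n) (ENNReal.ofReal γ) P ≤ K) : UnifIntegrable f 2 P := by
  intro ε hε
  have hγ0 : 0 < γ := by linarith
  set θ : ℝ := 1 / 2 - 1 / γ with hθ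
  have hθ0 : 0 < θ := by
    rw [hθ, sub_pos]; exact one_div_lt_one_div_of_lt (by norm_num) hγ
  -- Chosen so that its power `θ` is `ε / (K + 1)`; the `+ 1` allows `K = 0`.
  refine ⟨(ε / (K + 1)) ^ (1 / θ), by positivity, fun n s hs hsδ => ?_⟩
  rw [eLpNorm_indicator_eq_eLpNorm_restrict hs]
  have h2 : (2 : ℝ≥0∞) ≤ ENNReal.ofReal γ := by
    rw [← ENNReal.ofReal_ofNat 2]; exact ENNReal.ofReal_le_ofReal hγ.le
  refine (eLpNorm_le_eLpNorm_mul_rpow_measure_univ h2 (hf n).restrict).trans ?_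
  rw [Measure.restrict_apply_univ, ENNReal.toReal_ofReal hγ0.le, ENNReal.toReal_ofNat, ← hθ]
  calc eLpNorm (f n) (ENNReal.ofReal γ) (P.restrict s) * P s ^ θ
      ≤ K * (ENNReal.ofReal ((ε / (K + 1)) ^ (1 / θ))) ^ θ := by
        gcongr
        exact (eLpNorm_mono_measure _ Measure.restrict_le_self).trans (hK n)
    _ = ENNReal.ofReal (K * (ε / (K + 1))) := by
        rw [ENNReal.ofReal_rpow_of_nonneg (by positivity) hθ0.le, ← Real.rpow_mul (by positivity),
          one_div_mul_cancel hθ0.ne', Real.rpow_one, ENNReal.ofReal_mul (by positivity),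
          ENNReal.ofReal_coe_nnreal]
    _ ≤ ENNReal.ofReal ε := by
        refine ENNReal.ofReal_le_ofReal ?_
        rw [← mul_div_assoc, div_le_iff₀ (by positivity)]
        nlinarith [K.coe_nonneg]

/-- Convergence in probability with bounded moments of order `γ > 2` implies convergence in mean
square. -/
theorem memLp_two_and_tendsto_of_tendstoInMeasure [IsProbabilityMeasure P] {f : ℕ → Ω → ℝ}
    {D : Ω → ℝ} {γ : ℝ} (hγ : 2 < γ)
    (hf : ∀ n, AEStronglyMeasurable (f n) P) (hD : AEStronglyMeasurable D P) {C : ℝ≥0}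
    (hC : ∀ᶠ n in atTop, ∫⁻ ω, ‖f n ω‖ₑ ^ γ ∂P ≤ C) (hfD : TendstoInMeasure P f atTop D) :
    MemLp D 2 P ∧ Tendsto (fun n => ∫ ω, (f n ω - D ω) ^ 2 ∂P) atTop (𝓝 0) := by
  have hγ0 : 0 < γ := by linarith
  have h2 : (2 : ℝ≥0∞) ≤ ENNReal.ofReal γ := by
    rw [← ENNReal.ofReal_ofNat 2]; exact ENNReal.ofReal_le_ofReal hγ.le
  obtain ⟨n₀, hn₀⟩ := eventually_atTop.1 hC
  -- The moment bound holds only eventually, so the first terms are dropped.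
  set f' : ℕ → Ω → ℝ := fun n => f (n + n₀) with hf'
  have hb : ∀ n, eLpNorm (f' n) (ENNReal.ofReal γ) P ≤ ((C ^ (1 / γ) : ℝ≥0) : ℝ≥0∞) := fun n =>
    eLpNorm_le_of_lintegral_rpow_le hγ0 (hn₀ (n + n₀) (Nat.le_add_left _ _))
  have hfD' : TendstoInMeasure P f' atTop D := fun ε hε =>
    (hfD ε hε).comp (tendsto_add_atTop_nat n₀)
  have hDγ : eLpNorm D (ENNReal.ofReal γ) P ≤ ((C ^ (1 / γ) : ℝ≥0) : ℝ≥0∞) :=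
    eLpNorm_le_of_tendstoInMeasure (Eventually.of_forall hb) hfD' fun n => hf _
  have hD2 : MemLp D 2 P :=
    MemLp.mono_exponent ⟨hD, hDγ.trans_lt ENNReal.coe_lt_top⟩ h2
  refine ⟨hD2, ?_⟩
  have hf2 : ∀ n, MemLp (f' n) 2 P := fun n =>
    MemLp.mono_exponent ⟨hf _, (hb n).trans_lt ENNReal.coe_lt_top⟩ h2
  have ht := tendsto_Lp_finite_of_tendstoInMeasure (p := 2) (by norm_num) (by norm_num)
    (fun n => hf (n + n₀)) hD2 (unifIntegrable_two_of_eLpNorm_le hγ (fun n => hf (n + n₀)) hb) hfD'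
  have ht' : Tendsto (fun n => (eLpNorm (f' n - D) 2 P).toReal ^ 2) atTop (𝓝 0) := by
    have := ((ENNReal.tendsto_toReal ENNReal.zero_ne_top).comp ht).pow 2
    simpa using this
  rw [← tendsto_add_atTop_iff_nat n₀]
  refine ht'.congr fun n => ?_
  exact (integral_sq_eq_eLpNorm ((hf2 n).sub hD2)).symm

end UniformIntegrability

/-! ### Resampling one coordinate, and square integrability from increments. -/

section Resampling

variable {ι E : Type*} [MeasurableSpace E] {P₀ : Measure E} [IsProbabilityMeasure P₀]
  [DecidableEq ι]

theorem memLp_of_comp_measurePreserving {α β : Type*} {mα : MeasurableSpace α}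
    {mβ : MeasurableSpace β} {ν : Measure α} {μ : Measure β} {T : α → β}
    (hT : MeasurePreserving T ν μ) {f : β → ℝ} {p : ℝ≥0∞} (hf : AEStronglyMeasurable f μ)
    (h : MemLp (fun x => f (T x)) p ν) : MemLp f p μ := by
  rw [← hT.map_eq] at hf ⊢
  exact (memLp_map_measure_iff hf hT.measurable.aemeasurable).2 h

theorem measurable_update_prod (y : ι) :
    Measurable (fun p : (ι → E) × E => Function.update p.1 y p.2) := by
  rw [measurable_pi_iff]
  intro z
  by_cases h : z = y
  · subst h; simp only [Function.update_self]; fun_prop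
  · simp only [Function.update_of_ne h]; fun_prop

/-- Resampling one coordinate preserves a product measure. -/
theorem measurePreserving_update (y : ι) :
    MeasurePreserving (fun p : (ι → E) × E => Function.update p.1 y p.2)
      ((Measure.infinitePi fun _ : ι => P₀).prod P₀) (Measure.infinitePi fun _ : ι => P₀) := by
  classical
  set μ := Measure.infinitePi fun _ : ι => P₀
  -- Realize the fresh value as the coordinate `y` of a second full sample, so that updating becomes
  -- gluing.
  have hev : MeasurePreserving (Prod.map id (Function.eval y)) (μ.prod μ) (μ.prod P₀) :=
    (MeasurePreserving.id μ).prod (measurePreserving_eval_infinitePi (fun _ : ι => P₀) y)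
  refine ⟨measurable_update_prod y, ?_⟩
  rw [← hev.map_eq, Measure.map_map (measurable_update_prod y) hev.measurable]
  have h := (measurePreserving_piecewise (P₀ := P₀) ({y}ᶜ : Set ι)).map_eq
  convert h using 2
  funext p
  funext z
  by_cases hz : z = y
  · subst hz; simp
  · simp [hz]

/-- A function of finitely many independent coordinates is square integrable as soon as its
increments under resampling of one coordinate are. -/
theorem memLp_two_of_resampling (Λ : Finset ι) {h : (ι → E) → ℝ} (hm : Measurable h)
    (hdep : ∀ x x' : ι → E, (∀ z ∈ Λ, x z = x' z) → h x = h x')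
    (hinc : ∀ y ∈ Λ, MemLp (fun p : (ι → E) × E => h p.1 - h (Function.update p.1 y p.2)) 2
      ((Measure.infinitePi fun _ : ι => P₀).prod P₀)) :
    MemLp h 2 (Measure.infinitePi fun _ : ι => P₀) := by
  set μ := Measure.infinitePi fun _ : ι => P₀
  have hpwm : ∀ s : Finset ι, MeasurePreserving
      (fun p : (ι → E) × (ι → E) => s.piecewise p.2 p.1) (μ.prod μ) μ := by
    intro s
    have h1 := (measurePreserving_piecewise (P₀ := P₀) (s : Set ι)).comp
      (Measure.measurePreserving_swap (μ := μ) (ν := μ))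
    convert h1 using 1
    funext p
    funext z
    by_cases hz : z ∈ s <;> simp [hz]
  -- Resample the coordinates one after another. Each further step adds the increment at one
  -- coordinate of a configuration that again has law `μ`.
  have key : ∀ s ⊆ Λ, MemLp (fun p : (ι → E) × (ι → E) => h p.1 - h (s.piecewise p.2 p.1)) 2
      (μ.prod μ) := by
    intro s
    induction s using Finset.induction_on with
    | empty => simp
    | insert y s hy ih =>
      intro hs
      have hyΛ : y ∈ Λ := hs (Finset.mem_insert_self _ _)
      have ih' := ih ((Finset.subset_insert _ _).trans hs)
      -- Since `y ∉ s`, the second sample has not been read at `y` so far. Replacing that entry by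
      -- an independent value keeps the law and turns the next step into a one-coordinate update.
      have hT : MeasurePreserving (fun p : ((ι → E) × (ι → E)) × E =>
          (p.1.1, Function.update p.1.2 y p.2)) ((μ.prod μ).prod P₀) (μ.prod μ) := by
        have h1 : MeasurePreserving (MeasurableEquiv.prodAssoc : ((ι → E) × (ι → E)) × E ≃ᵐ _)
            ((μ.prod μ).prod P₀) (μ.prod (μ.prod P₀)) := measurePreserving_prodAssoc μ μ P₀
        exact ((MeasurePreserving.id μ).prod (measurePreserving_update (P₀ := P₀) y)).comp h1
      refine memLp_of_comp_measurePreserving hT ?_ ?_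
      · refine Measurable.aestronglyMeasurable ?_
        exact (hm.comp measurable_fst).sub (hm.comp (hpwm _).measurable)
      have hA : MemLp (fun p : ((ι → E) × (ι → E)) × E =>
          h p.1.1 - h (s.piecewise p.1.2 p.1.1)) 2 ((μ.prod μ).prod P₀) :=
        memLp_comp_measurePreserving measurePreserving_fst ih'
      have hB : MemLp (fun p : ((ι → E) × (ι → E)) × E => h (s.piecewise p.1.2 p.1.1)
          - h (Function.update (s.piecewise p.1.2 p.1.1) y p.2)) 2 ((μ.prod μ).prod P₀) :=
        memLp_comp_measurePreserving ((hpwm s).prod (MeasurePreserving.id P₀)) (hinc y hyΛ)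
      refine (hA.add hB).congr_norm ?_ (Eventually.of_forall fun p => ?_)
      · exact (((hm.comp measurable_fst).sub (hm.comp (hpwm (insert y s)).measurable)).comp
          hT.measurable).aestronglyMeasurable
      · have e : (insert y s).piecewise (Function.update p.1.2 y p.2) p.1.1
            = Function.update (s.piecewise p.1.2 p.1.1) y p.2 := by
          rw [Finset.piecewise_insert, Function.update_self]
          congr 1
          funext z
          by_cases hz : z ∈ s
          · have : z ≠ y := fun h => hy (h ▸ hz)
            simp [hz, this]
          · simp [hz]
        simp only [Pi.add_apply, e]
        congr 1; ring
  have hfin := key Λ subset_rfl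
  have hfin' : MemLp (fun p : (ι → E) × (ι → E) => h p.1 - h p.2) 2 (μ.prod μ) := by
    refine hfin.congr_norm ?_ (Eventually.of_forall fun p => ?_)
    · exact ((hm.comp measurable_fst).sub (hm.comp measurable_snd)).aestronglyMeasurable
    · rw [hdep (Λ.piecewise p.2 p.1) p.2 fun z hz => by simp [hz]]
  -- By Fubini one independent copy can be frozen, and then `h` differs from a square integrable
  -- function by a constant.
  obtain ⟨x', hx'⟩ := hfin'.integrable_sq.prod_left_ae.exists
  have h1 : MemLp (fun x => h x - h x') 2 μ :=
    (memLp_two_iff_integrable_sq (hm.sub_const _).aestronglyMeasurable).2 hx'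
  have := h1.add (memLp_const (h x'))
  refine this.congr_norm hm.aestronglyMeasurable (Eventually.of_forall fun x => by simp)

/-- Averaging over the resampled value of one coordinate is conditioning on the others. -/
theorem condExp_compl_singleton_ae_eq (y : ι) {h : (ι → E) → ℝ}
    (hh : Integrable h (Measure.infinitePi fun _ : ι => P₀)) (hm : StronglyMeasurable h) :
    (Measure.infinitePi fun _ : ι => P₀)[h | cylinderEvents ({y}ᶜ : Set ι)]
      =ᵐ[Measure.infinitePi fun _ : ι => P₀] fun x => ∫ e, h (Function.update x y e) ∂P₀ := by
  classical
  refine (condExp_cylinderEvents_ae_eq_integral _ hh hm).trans (Eventually.of_forall fun x => ?_)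
  have := integral_comp_measurePreserving (measurePreserving_eval_infinitePi (fun _ : ι => P₀) y)
    (f := fun e => h (Function.update x y e))
    (hm.comp_measurable (measurable_update x)).aestronglyMeasurable
  simp only
  rw [← this]
  congr 1
  funext x'
  congr 1
  funext z
  by_cases hz : z = y
  · subst hz; simp
  · simp [hz]

end Resampling

/-! ### The martingale difference at the origin as a conditional increment. -/

section PastDifference

variable {d : ℕ} {E : Type*} [MeasurableSpace E] {P₀ : Measure E} [IsProbabilityMeasure P₀]

/-- The martingale difference at the origin of a function of the field. -/
noncomputable def pastDifference (P₀ : Measure E) [IsProbabilityMeasure P₀]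
    (h : ((Fin d → ℤ) → E) → ℝ) : ((Fin d → ℤ) → E) → ℝ := fun x =>
  ((Measure.infinitePi fun _ : Fin d → ℤ => P₀)[h | weakPast d E 0]) x
    - ((Measure.infinitePi fun _ : Fin d → ℤ => P₀)[h | strictPast d E 0]) x

theorem isMartingaleDifference_pastDifference {h : ((Fin d → ℤ) → E) → ℝ}
    (hh : MemLp h 2 (Measure.infinitePi fun _ : Fin d → ℤ => P₀)) :
    IsMartingaleDifference P₀ (pastDifference P₀ h) where
  stronglyMeasurable := stronglyMeasurable_condExp.sub
    (stronglyMeasurable_condExp.mono (strictPast_le_weakPast 0))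
  memLp := (hh.condExp (by norm_num)).sub (hh.condExp (by norm_num))
  condExp_eq_zero := by
    refine (condExp_sub integrable_condExp integrable_condExp _).trans ?_
    filter_upwards [condExp_condExp_of_le (μ := Measure.infinitePi fun _ : Fin d → ℤ => P₀) (f := h)
      (strictPast_le_weakPast (E := E) (0 : Fin d → ℤ)) cylinderEvents_le_pi,
      condExp_condExp_of_le (μ := Measure.infinitePi fun _ : Fin d → ℤ => P₀) (f := h)
      (le_refl (strictPast d E 0)) cylinderEvents_le_pi] with x h1 h2
    simp [h1, h2]

theorem weakPast_inter_compl :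
    {z : Fin d → ℤ | toLex z ≤ toLex 0} ∩ {0}ᶜ = {z | toLex z < toLex 0} := by
  ext z
  simp only [Set.mem_inter_iff, Set.mem_ofPred_eq, Set.mem_compl_iff, Set.mem_singleton_iff]
  exact ⟨fun h => lt_of_le_of_ne h.1 fun e => h.2 (toLex.injective e),
    fun h => ⟨h.le, fun e => h.ne (congrArg toLex e)⟩⟩

/-- Averaging over the fresh value conditions on all sites but the origin. Conditioning on the weak
past as well leaves the intersection of the two sets of sites, which is the strict past. -/
theorem condExp_comp_update {h : ((Fin d → ℤ) → E) → ℝ}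
    (hh : Integrable h (Measure.infinitePi fun _ : Fin d → ℤ => P₀)) (hm : StronglyMeasurable h) :
    ((Measure.infinitePi fun _ : Fin d → ℤ => P₀).prod P₀)[
        fun p => h (Function.update p.1 0 p.2) | (weakPast d E 0).comap Prod.fst]
      =ᵐ[(Measure.infinitePi fun _ : Fin d → ℤ => P₀).prod P₀]
    fun p => ((Measure.infinitePi fun _ : Fin d → ℤ => P₀)[h | strictPast d E 0]) p.1 := by
  set μ := Measure.infinitePi fun _ : Fin d → ℤ => P₀ with hμ
  have hle : (weakPast d E 0).comap (Prod.fst : _ × E → _) ≤ Prod.instMeasurableSpace :=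
    (MeasurableSpace.comap_mono cylinderEvents_le_pi).trans measurable_fst.comap_le
  have hki : Integrable (fun p : ((Fin d → ℤ) → E) × E => h (Function.update p.1 0 p.2))
      (μ.prod P₀) := (measurePreserving_update (P₀ := P₀) 0).integrable_comp_of_integrable hh
  have hfst : MeasurePreserving (Prod.fst : ((Fin d → ℤ) → E) × E → _) (μ.prod P₀) μ :=
    measurePreserving_fst
  have hsi : Integrable (fun p : ((Fin d → ℤ) → E) × E => (μ[h | strictPast d E 0]) p.1)
      (μ.prod P₀) := hfst.integrable_comp_of_integrable integrable_condExp
  refine (ae_eq_condExp_of_forall_setIntegral_eq hle hki ?_ ?_ ?_).symm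
  · intro s _ _; exact hsi.integrableOn
  · rintro _ ⟨B, hB, rfl⟩ _
    have hB' : MeasurableSet B := cylinderEvents_le_pi _ hB
    have e : (Prod.fst ⁻¹' B : Set (((Fin d → ℤ) → E) × E)) = B ×ˢ Set.univ := by
      ext; simp
    rw [e, setIntegral_prod _ hsi.integrableOn, setIntegral_prod _ hki.integrableOn]
    simp only [Measure.restrict_univ, integral_const, probReal_univ, one_smul]
    have h1 := condExp_compl_singleton_ae_eq (P₀ := P₀) (0 : Fin d → ℤ) hh hm
    have h2 := condExp_condExp_cylinderEvents (P₀ := P₀) ({0}ᶜ : Set (Fin d → ℤ))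
      {z | toLex z ≤ toLex 0} (f := h)
    rw [weakPast_inter_compl] at h2
    calc ∫ x in B, (μ[h | strictPast d E 0]) x ∂μ
        = ∫ x in B, (μ[μ[h | cylinderEvents {0}ᶜ] | weakPast d E 0]) x ∂μ :=
          setIntegral_congr_ae hB' (h2.mono fun x hx _ => hx.symm)
      _ = ∫ x in B, (μ[h | cylinderEvents {0}ᶜ]) x ∂μ :=
          setIntegral_condExp cylinderEvents_le_pi integrable_condExp hB
      _ = _ := setIntegral_congr_ae hB' (h1.mono fun x hx _ => hx)
  · refine StronglyMeasurable.aestronglyMeasurable ?_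
    exact (stronglyMeasurable_condExp.mono (strictPast_le_weakPast 0)).comp_measurable
      (comap_measurable _)

/-- This carries conditional expectations on `Ω` to the canonical space. -/
theorem lexPast_eq_comap {Ω : Type*} {X : (Fin d → ℤ) → Ω → E} (y : Fin d → ℤ) :
    lexPast X y = (weakPast d E y).comap (fun ω z => X z ω) := by
  simp only [lexPast, weakPast, cylinderEvents, MeasurableSpace.comap_iSup,
    MeasurableSpace.comap_comp]
  rfl

variable {Ω : Type*} [MeasurableSpace Ω] {P : Measure Ω} [IsProbabilityMeasure P]
  {X : (Fin d → ℤ) → Ω → E} {Xs : Ω → E}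

/-- The conditional expectation of the increment of `h` under resampling at the origin. -/
theorem condExp_resampling_increment
    (hpair : MeasurePreserving (fun ω => ((fun z => X z ω), Xs ω)) P
      ((Measure.infinitePi fun _ : Fin d → ℤ => P₀).prod P₀))
    {h : ((Fin d → ℤ) → E) → ℝ}
    (hh : Integrable h (Measure.infinitePi fun _ : Fin d → ℤ => P₀)) (hm : StronglyMeasurable h) :
    P[fun ω => h (fun z => X z ω) - h (Function.update (fun z => X z ω) 0 (Xs ω)) | lexPast X 0]
      =ᵐ[P] fun ω => pastDifference P₀ h (fun z => X z ω) := by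
  set μ := Measure.infinitePi fun _ : Fin d → ℤ => P₀ with hμ
  have hX : MeasurePreserving (fun ω z => X z ω) P μ :=
    (measurePreserving_fst (μ := μ) (ν := P₀)).comp hpair
  have hki : Integrable (fun p : ((Fin d → ℤ) → E) × E => h (Function.update p.1 0 p.2))
      (μ.prod P₀) := (measurePreserving_update (P₀ := P₀) 0).integrable_comp_of_integrable hh
  have h1 := condExp_comp_measurePreserving hX
    (cylinderEvents_le_pi (X := fun _ : Fin d → ℤ => E) (Δ := {z | toLex z ≤ toLex 0})) hh
  have h2 := condExp_comp_measurePreserving hpair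
    (m := (weakPast d E 0).comap (Prod.fst : ((Fin d → ℤ) → E) × E → _))
    ((MeasurableSpace.comap_mono cylinderEvents_le_pi).trans measurable_fst.comap_le) hki
  rw [MeasurableSpace.comap_comp] at h2
  have h3 := hpair.quasiMeasurePreserving.ae (condExp_comp_update hh hm)
  rw [lexPast_eq_comap]
  refine (condExp_sub (hX.integrable_comp_of_integrable hh)
    (hpair.integrable_comp_of_integrable hki) _).trans ?_
  filter_upwards [h1, h2, h3] with ω e1 e2 e3
  simp only [Pi.sub_apply, pastDifference]
  exact congrArg₂ _ e1 (e2.trans e3)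

end PastDifference

theorem shift_neg_update_shift {d : ℕ} {E : Type*} (y : Fin d → ℤ)
    (x : (Fin d → ℤ) → E) (e : E) :
    shift (-y) (Function.update (shift y x) 0 e) = Function.update x y e := by
  funext z
  by_cases hz : z = y
  · subst hz; simp [shift]
  · have : z + -y ≠ 0 := by rwa [← sub_eq_add_neg, sub_ne_zero]
    simp [shift, hz, this]

/-! ### Mean square stabilization of the martingale differences. -/

section Stabilization

variable {d : ℕ} {E : Type*} [MeasurableSpace E] {P₀ : Measure E} [IsProbabilityMeasure P₀]
  {Ω : Type*} [MeasurableSpace Ω] {P : Measure Ω} [IsProbabilityMeasure P]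
  {X : (Fin d → ℤ) → Ω → E} {Xs : Ω → E} {ρ : ℝ} {B₀ : Set (EuclideanSpace ℝ (Fin d))}
  {H : RandomSetFunction E ρ B₀}

namespace RandomSetFunction

/-- `H_t(A)` as a function of the field seen from `y`. -/
def recentred (H : RandomSetFunction E ρ B₀) (t : Set.Ici (1 : ℝ)) (A : RiemannSubset B₀)
    (y : Fin d → ℤ) (x : (Fin d → ℤ) → E) : ℝ :=
  H.eval t (shift (-y) x) A

theorem stronglyMeasurable_eval_cylinderEvents (t : Set.Ici (1 : ℝ)) (A : RiemannSubset B₀) :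
    StronglyMeasurable[cylinderEvents (discretization ρ ((t : ℝ) • B₀))]
      (fun x : (Fin d → ℤ) → E => H.eval t x A) :=
  ((H.measurable_toFun t A).comp (measurable_restrict_cylinderEvents _)).stronglyMeasurable

theorem stronglyMeasurable_eval (t : Set.Ici (1 : ℝ)) (A : RiemannSubset B₀) :
    StronglyMeasurable (fun x : (Fin d → ℤ) → E => H.eval t x A) :=
  (stronglyMeasurable_eval_cylinderEvents t A).mono cylinderEvents_le_pi

theorem stronglyMeasurable_recentred (t : Set.Ici (1 : ℝ)) (A : RiemannSubset B₀)
    (y : Fin d → ℤ) : StronglyMeasurable (H.recentred t A y) :=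
  (stronglyMeasurable_eval t A).comp_measurable (measurable_shift _)

theorem measurable_resampling_increment (t : Set.Ici (1 : ℝ)) (A : RiemannSubset B₀)
    (y : Fin d → ℤ) : Measurable (fun p : ((Fin d → ℤ) → E) × E =>
      H.recentred t A y p.1 - H.recentred t A y (Function.update p.1 0 p.2)) :=
  ((stronglyMeasurable_recentred t A y).measurable.comp measurable_fst).sub
    ((stronglyMeasurable_recentred t A y).measurable.comp (measurable_update_prod 0))

theorem measurable_increment (hpair : Measurable (fun ω => ((fun z => X z ω), Xs ω)))
    (t : Set.Ici (1 : ℝ)) (A : RiemannSubset B₀) (y : Fin d → ℤ) :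
    Measurable (H.increment X Xs t (-y) A) :=
  (measurable_resampling_increment t A y).comp hpair

theorem memLp_increment (hpair : Measurable (fun ω => ((fun z => X z ω), Xs ω)))
    {γ : ℝ} (hγ : 2 < γ) {C : ℝ≥0} {t : Set.Ici (1 : ℝ)} {A : RiemannSubset B₀} {y : Fin d → ℤ}
    (hC : ∫⁻ ω, ‖H.increment X Xs t (-y) A ω‖ₑ ^ γ ∂P ≤ C) :
    MemLp (H.increment X Xs t (-y) A) 2 P ∧
      ∫ ω, H.increment X Xs t (-y) A ω ^ 2 ∂P ≤ ((C ^ (1 / γ) : ℝ≥0) : ℝ) ^ 2 := by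
  have h2 : (2 : ℝ≥0∞) ≤ ENNReal.ofReal γ := by
    rw [← ENNReal.ofReal_ofNat 2]; exact ENNReal.ofReal_le_ofReal hγ.le
  have hm : AEStronglyMeasurable (H.increment X Xs t (-y) A) P :=
    (measurable_increment hpair t A y).aestronglyMeasurable
  have hle := eLpNorm_le_of_lintegral_rpow_le (by linarith) hC
  have hmem : MemLp (H.increment X Xs t (-y) A) 2 P :=
    MemLp.mono_exponent ⟨hm, hle.trans_lt ENNReal.coe_lt_top⟩ h2
  refine ⟨hmem, ?_⟩
  rw [integral_sq_eq_eLpNorm hmem]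
  gcongr
  exact ENNReal.toReal_le_coe_of_le_coe
    ((eLpNorm_le_eLpNorm_of_exponent_le h2 hm).trans hle)

/-- No moment of `H` itself is assumed. Boundedness of `B₀` makes `H_t(A)` a function of finitely
many sites, and a shift turns the increments at the origin into increments at each of them. -/
theorem memLp_eval (hB₀ : Bornology.IsBounded B₀)
    (hpair : MeasurePreserving (fun ω => ((fun z => X z ω), Xs ω)) P
      ((Measure.infinitePi fun _ : Fin d → ℤ => P₀).prod P₀))
    (hmom : H.BoundedMoments P X Xs) (t : Set.Ici (1 : ℝ)) (A : RiemannSubset B₀) :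
    MemLp (fun x => H.eval t x A) 2 (Measure.infinitePi fun _ : Fin d → ℤ => P₀) := by
  obtain ⟨γ, hγ, C, hC⟩ := hmom
  have hfin : (discretization ρ ((t : ℝ) • B₀)).Finite := finite_discretization (hB₀.smul₀ _) ρ
  refine memLp_two_of_resampling hfin.toFinset (stronglyMeasurable_eval t A).measurable ?_ ?_
  · intro x x' hxx
    simp only [eval]
    congr 1
    funext z
    exact hxx z (hfin.mem_toFinset.2 z.2)
  · intro y hy
    have h1 := (memLp_increment hpair.measurable hγ (hC A t y (hfin.mem_toFinset.1 hy))).1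
    have h2 : MemLp (fun p : ((Fin d → ℤ) → E) × E =>
        H.recentred t A y p.1 - H.recentred t A y (Function.update p.1 0 p.2)) 2
        ((Measure.infinitePi fun _ : Fin d → ℤ => P₀).prod P₀) :=
      memLp_of_comp_measurePreserving hpair
        (measurable_resampling_increment t A y).aestronglyMeasurable h1
    have h3 := memLp_comp_measurePreserving
      ((measurePreserving_shift (P₀ := P₀) y).prod (MeasurePreserving.id P₀)) h2
    refine h3.congr_norm ?_ (Eventually.of_forall fun p => ?_)
    · exact (((stronglyMeasurable_eval t A).measurable.comp measurable_fst).sub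
        ((stronglyMeasurable_eval t A).measurable.comp
          (measurable_update_prod y))).aestronglyMeasurable
    · simp only [Prod.map_fst, Prod.map_snd, id_eq, recentred, shift_neg_shift,
        shift_neg_update_shift]

theorem memLp_recentred (hB₀ : Bornology.IsBounded B₀)
    (hpair : MeasurePreserving (fun ω => ((fun z => X z ω), Xs ω)) P
      ((Measure.infinitePi fun _ : Fin d → ℤ => P₀).prod P₀))
    (hmom : H.BoundedMoments P X Xs) (t : Set.Ici (1 : ℝ)) (A : RiemannSubset B₀)
    (y : Fin d → ℤ) :
    MemLp (H.recentred t A y) 2 (Measure.infinitePi fun _ : Fin d → ℤ => P₀) :=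
  memLp_comp_measurePreserving (measurePreserving_shift _) (memLp_eval hB₀ hpair hmom t A)

theorem condExp_increment (hB₀ : Bornology.IsBounded B₀)
    (hpair : MeasurePreserving (fun ω => ((fun z => X z ω), Xs ω)) P
      ((Measure.infinitePi fun _ : Fin d → ℤ => P₀).prod P₀))
    (hmom : H.BoundedMoments P X Xs) (t : Set.Ici (1 : ℝ)) (A : RiemannSubset B₀)
    (y : Fin d → ℤ) :
    P[H.increment X Xs t (-y) A | lexPast X 0]
      =ᵐ[P] fun ω => pastDifference P₀ (H.recentred t A y) (fun z => X z ω) :=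
  condExp_resampling_increment hpair
    ((memLp_recentred hB₀ hpair hmom t A y).integrable (by norm_num))
    (stronglyMeasurable_recentred t A y)

/-- The differences are conditional expectations of the increments, so contraction transfers the
uniform moment bound. It will be the dominating constant. -/
theorem exists_integral_sq_pastDifference_le (hB₀ : Bornology.IsBounded B₀)
    (hpair : MeasurePreserving (fun ω => ((fun z => X z ω), Xs ω)) P
      ((Measure.infinitePi fun _ : Fin d → ℤ => P₀).prod P₀))
    (hmom : H.BoundedMoments P X Xs) :
    ∃ C : ℝ, ∀ (A : RiemannSubset B₀) (t : Set.Ici (1 : ℝ)),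
      ∀ y ∈ discretization ρ ((t : ℝ) • B₀),
        ∫ x, pastDifference P₀ (H.recentred t A y) x ^ 2
          ∂(Measure.infinitePi fun _ : Fin d → ℤ => P₀) ≤ C := by
  have hX : MeasurePreserving (fun ω z => X z ω) P (Measure.infinitePi fun _ : Fin d → ℤ => P₀) :=
    (measurePreserving_fst (ν := P₀)).comp hpair
  obtain ⟨γ, hγ, C, hC⟩ := id hmom
  refine ⟨((C ^ (1 / γ) : ℝ≥0) : ℝ) ^ 2, fun A t y hy => ?_⟩
  obtain ⟨h1, h2⟩ := memLp_increment hpair.measurable hγ (hC A t y hy)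
  refine le_trans (le_of_eq ?_) ((integral_sq_condExp_le (m := lexPast X 0) h1).trans h2)
  rw [← integral_comp_measurePreserving hX (f := fun x =>
    pastDifference P₀ (H.recentred t A y) x ^ 2)]
  · refine integral_congr_ae ?_
    filter_upwards [condExp_increment hB₀ hpair hmom t A y] with ω hω
    rw [hω]
  · exact (isMartingaleDifference_pastDifference
      (memLp_recentred hB₀ hpair hmom t A y)).memLp.1.pow 2

/-- The origin belongs to the lower limit. This places `y n` in the region where the moment bound is
available. -/
theorem eventually_latticePoint_mem_of_setLiminf {S : Set (EuclideanSpace ℝ (Fin d))} {t : ℕ → ℝ}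
    {y : ℕ → Fin d → ℤ}
    (h : setLiminf (fun n => latticePoint (-y n) +ᵥ (t n • S)) = Set.univ) :
    ∀ᶠ n in atTop, latticePoint (y n) ∈ t n • S := by
  have h0 : (0 : EuclideanSpace ℝ (Fin d)) ∈
      setLiminf (fun n => latticePoint (-y n) +ᵥ (t n • S)) := by rw [h]; trivial
  obtain ⟨n, hn⟩ := Set.mem_iUnion.1 h0
  filter_upwards [eventually_ge_atTop n] with m hm
  have := Set.mem_iInter₂.1 hn m hm
  rw [Set.mem_vadd_set_iff_neg_vadd_mem, latticePoint_neg, neg_neg, vadd_eq_add, add_zero] at this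
  exact this

/-- Stabilization in mean square of the martingale differences of a random set function, along a
sequence whose increments converge in probability. -/
theorem tendsto_integral_sq_pastDifference_sub (hB₀ : Bornology.IsBounded B₀) (hρ : 0 ≤ ρ)
    (hpair : MeasurePreserving (fun ω => ((fun z => X z ω), Xs ω)) P
      ((Measure.infinitePi fun _ : Fin d → ℤ => P₀).prod P₀))
    (hmom : H.BoundedMoments P X Xs) {D : Ω → ℝ} (hD : Measurable D)
    {g : ((Fin d → ℤ) → E) → ℝ} (hgm : StronglyMeasurable g)
    (hg : (fun ω => g fun z => X z ω) =ᵐ[P] P[D | lexPast X 0]) (A : RiemannSubset B₀)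
    {t : ℕ → Set.Ici (1 : ℝ)} {y : ℕ → Fin d → ℤ} {S : Set (EuclideanSpace ℝ (Fin d))}
    (hS : S ⊆ B₀)
    (hlim : setLiminf (fun n => latticePoint (-y n) +ᵥ ((t n : ℝ) • S)) = Set.univ)
    (hconv : TendstoInMeasure P (fun n => H.increment X Xs (t n) (-y n) A) atTop D) :
    MemLp D 2 P ∧ Tendsto (fun n => ∫ x, (pastDifference P₀ (H.recentred (t n) A (y n)) x - g x) ^ 2
      ∂(Measure.infinitePi fun _ : Fin d → ℤ => P₀)) atTop (𝓝 0) := by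
  have hX : MeasurePreserving (fun ω z => X z ω) P (Measure.infinitePi fun _ : Fin d → ℤ => P₀) :=
    (measurePreserving_fst (ν := P₀)).comp hpair
  obtain ⟨γ, hγ, C, hC⟩ := id hmom
  have hev : ∀ᶠ n in atTop, y n ∈ discretization ρ ((t n : ℝ) • B₀) := by
    filter_upwards [eventually_latticePoint_mem_of_setLiminf hlim] with n hn
    exact mem_discretization_of_latticePoint_mem hρ (Set.smul_set_mono hS hn)
  obtain ⟨hD2, ht⟩ := memLp_two_and_tendsto_of_tendstoInMeasure hγ
    (fun n => (measurable_increment hpair.measurable (t n) A (y n)).aestronglyMeasurable)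
    hD.aestronglyMeasurable (hev.mono fun n hn => hC A (t n) (y n) hn) hconv
  refine ⟨hD2, ?_⟩
  refine squeeze_zero' (Eventually.of_forall fun n => integral_nonneg fun x => sq_nonneg _) ?_ ht
  filter_upwards [hev] with n hn
  have hinc := (memLp_increment hpair.measurable hγ (hC A (t n) (y n) hn)).1
  have hsub : MemLp (fun ω => H.increment X Xs (t n) (-y n) A ω - D ω) 2 P := hinc.sub hD2
  -- Seen through `X`, the difference is the conditional expectation of the increment minus `D`, so
  -- its second moment contracts.
  refine le_trans (le_of_eq ?_) (integral_sq_condExp_le (m := lexPast X 0) hsub)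
  rw [← integral_comp_measurePreserving hX (f := fun x =>
    (pastDifference P₀ (H.recentred (t n) A (y n)) x - g x) ^ 2)]
  · refine integral_congr_ae ?_
    filter_upwards [condExp_increment hB₀ hpair hmom (t n) A (y n), hg,
      condExp_sub (μ := P) (hinc.integrable (by norm_num)) (hD2.integrable (by norm_num))
        (lexPast X 0)] with ω h1 h2 h3
    have h3' : (P[fun ω => H.increment X Xs (t n) (-y n) A ω - D ω | lexPast X 0]) ω
      = (P[H.increment X Xs (t n) (-y n) A | lexPast X 0] - P[D | lexPast X 0]) ω := h3
    rw [h3', Pi.sub_apply, h1, ← h2]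
  · exact ((isMartingaleDifference_pastDifference
      (memLp_recentred hB₀ hpair hmom _ A _)).memLp.1.sub hgm.aestronglyMeasurable).pow 2

/-- The limit of the martingale differences of a stabilizing random set function. -/
theorem exists_limit_pastDifference (hB₀ : IsRiemannMeasurable B₀) (hB₀pos : 0 < volume B₀)
    (hρ : 0 ≤ ρ)
    (hpair : MeasurePreserving (fun ω => ((fun z => X z ω), Xs ω)) P
      ((Measure.infinitePi fun _ : Fin d → ℤ => P₀).prod P₀))
    (hmom : H.BoundedMoments P X Xs) {D : Ω → ℝ} (hstab : H.Stabilizes P X Xs D) :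
    MemLp D 2 P ∧ ∃ g : ((Fin d → ℤ) → E) → ℝ, IsMartingaleDifference P₀ g ∧
      ((fun ω => g fun z => X z ω) =ᵐ[P] P[D | lexPast X 0]) ∧
      ∀ (A : RiemannSubset B₀) (t : ℕ → Set.Ici (1 : ℝ)) (y : ℕ → Fin d → ℤ),
        (setLiminf (fun n => latticePoint (-y n) +ᵥ
            ((t n : ℝ) • (A : Set (EuclideanSpace ℝ (Fin d))))) = Set.univ →
          Tendsto (fun n => ∫ x, (pastDifference P₀ (H.recentred (t n) A (y n)) x - g x) ^ 2
            ∂(Measure.infinitePi fun _ : Fin d → ℤ => P₀)) atTop (𝓝 0)) ∧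
        (setLiminf (fun n => latticePoint (-y n) +ᵥ
            ((t n : ℝ) • (B₀ \ (A : Set (EuclideanSpace ℝ (Fin d)))))) = Set.univ →
          Tendsto (fun n => ∫ x, pastDifference P₀ (H.recentred (t n) A (y n)) x ^ 2
            ∂(Measure.infinitePi fun _ : Fin d → ℤ => P₀)) atTop (𝓝 0)) := by
  set μ := Measure.infinitePi fun _ : Fin d → ℤ => P₀ with hμ
  have hX : MeasurePreserving (fun ω z => X z ω) P μ :=
    (measurePreserving_fst (ν := P₀)).comp hpair
  have hDm := hstab.1
  -- The conditional limit increment is measurable for the past of the field, hence a function of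
  -- the field.
  obtain ⟨g, hgs, hgX⟩ : ∃ g : ((Fin d → ℤ) → E) → ℝ, StronglyMeasurable[weakPast d E 0] g ∧
      P[D | lexPast X 0] = g ∘ fun ω z => X z ω := by
    have h1 : StronglyMeasurable[(weakPast d E 0).comap (fun ω z => X z ω)] (P[D | lexPast X 0]) := by
      rw [← lexPast_eq_comap]; exact stronglyMeasurable_condExp
    exact h1.exists_eq_measurable_comp (mY := weakPast d E 0)
  have hgX' : (fun ω => g fun z => X z ω) =ᵐ[P] P[D | lexPast X 0] := by rw [hgX]; rfl
  have hgs' : StronglyMeasurable g := hgs.mono cylinderEvents_le_pi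
  have hconv : ∀ (A : RiemannSubset B₀) (t : ℕ → Set.Ici (1 : ℝ)) (y : ℕ → Fin d → ℤ),
      setLiminf (fun n => latticePoint (-y n) +ᵥ
            ((t n : ℝ) • (A : Set (EuclideanSpace ℝ (Fin d))))) = Set.univ →
      MemLp D 2 P ∧ Tendsto (fun n => ∫ x, (pastDifference P₀ (H.recentred (t n) A (y n)) x - g x) ^ 2
            ∂μ) atTop (𝓝 0) := fun A t y hlim =>
    tendsto_integral_sq_pastDifference_sub hB₀.1 hρ hpair hmom hDm hgs' hgX' A A.2.2 hlim
      ((hstab.2 A t fun n => -y n).1 hlim)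
  -- Positive measure and null boundary give an interior point, hence at least one sequence, with `A
  -- = B₀`, along which the differences converge. Square integrability of `D` and centring of `g`
  -- are read off from it.
  obtain ⟨x₀, hx₀⟩ : (interior B₀).Nonempty := by
    rw [Set.nonempty_iff_ne_empty]
    intro h
    have := measure_interior_of_null_frontier hB₀.2
    rw [h, measure_empty] at this
    exact hB₀pos.ne this
  let t₀ : ℕ → Set.Ici (1 : ℝ) := fun n => ⟨n + 1, by simp⟩
  have ht₀ : Tendsto (fun n => (t₀ n : ℝ)) atTop atTop :=
    tendsto_atTop_add_const_right _ _ tendsto_natCast_atTop_atTop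
  let A₀ : RiemannSubset B₀ := ⟨B₀, hB₀, subset_rfl⟩
  obtain ⟨hD2, hlim₀⟩ := hconv A₀ t₀ _ (setLiminf_vadd_smul_eq_univ hx₀ ht₀)
  have hg2 : MemLp g 2 μ := by
    refine memLp_of_comp_measurePreserving hX hgs'.aestronglyMeasurable ?_
    exact (memLp_congr_ae hgX').2 (hD2.condExp (by norm_num))
  refine ⟨hD2, g, ⟨hgs, hg2, ?_⟩, hgX', fun A t y => ⟨fun h => (hconv A t y h).2, fun h => ?_⟩⟩
  · have hz : ∫ x, (μ[g | strictPast d E 0]) x ^ 2 ∂μ ≤ 0 := by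
      refine ge_of_tendsto' hlim₀ fun n => ?_
      set M := pastDifference P₀ (H.recentred (t₀ n) A₀ (latticeFloor (t₀ n : ℝ) x₀)) with hM
      have hMd : IsMartingaleDifference P₀ M :=
        isMartingaleDifference_pastDifference (memLp_recentred hB₀.1 hpair hmom _ _ _)
      have hsub : MemLp (fun x => M x - g x) 2 μ := hMd.memLp.sub hg2
      refine le_trans (le_of_eq ?_) (integral_sq_condExp_le (m := strictPast d E 0) hsub)
      refine integral_congr_ae ?_
      filter_upwards [hMd.condExp_eq_zero, condExp_sub (μ := μ) (hMd.memLp.integrable (by norm_num))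
        (hg2.integrable (by norm_num)) (strictPast d E 0)] with x h1 h2
      have h2' : (μ[fun x => M x - g x | strictPast d E 0]) x
        = (μ[M | strictPast d E 0] - μ[g | strictPast d E 0]) x := h2
      have h1' : (μ[M | strictPast d E 0]) x = 0 := h1
      rw [h2', Pi.sub_apply, h1']
      ring
    have hz' : ∫ x, (μ[g | strictPast d E 0]) x ^ 2 ∂μ = 0 :=
      le_antisymm hz (integral_nonneg fun x => sq_nonneg _)
    rw [integral_eq_zero_iff_of_nonneg (fun x => sq_nonneg _)
      (hg2.condExp (by norm_num)).integrable_sq] at hz'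
    filter_upwards [hz'] with x hx
    simpa using hx
  · have h0 := tendsto_integral_sq_pastDifference_sub (D := fun _ => 0) (g := fun _ => 0) hB₀.1 hρ
      hpair hmom measurable_const stronglyMeasurable_const (by
        have : (fun _ : Ω => (0 : ℝ)) = 0 := rfl
        rw [this, condExp_zero]) A Set.sdiff_subset h
      ((hstab.2 A t fun n => -y n).2 h)
    simpa using h0.2

end RandomSetFunction

end Stabilization

/-! ### Martingale decomposition along the lexicographic order. -/

section MartingaleDecomposition

variable {d : ℕ} {E : Type*} [MeasurableSpace E] {P₀ : Measure E} [IsProbabilityMeasure P₀]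

/-- The martingale decomposition, along the lexicographic order, of a function of finitely many
coordinates of the field. -/
theorem sub_integral_ae_eq_sum_pastDifference {h : ((Fin d → ℤ) → E) → ℝ}
    (hh : Integrable h (Measure.infinitePi fun _ : Fin d → ℤ => P₀)) (Λ : Finset (Fin d → ℤ))
    (hm : StronglyMeasurable[cylinderEvents (Λ : Set (Fin d → ℤ))] h) :
    (fun x => h x - ∫ x, h x ∂(Measure.infinitePi fun _ : Fin d → ℤ => P₀))
      =ᵐ[Measure.infinitePi fun _ : Fin d → ℤ => P₀]
    fun x => ∑ y ∈ Λ, pastDifference P₀ (fun x => h (shift (-y) x)) (shift y x) := by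
  set μ := Measure.infinitePi fun _ : Fin d → ℤ => P₀ with hμ
  have hcomp : ∀ y : Fin d → ℤ, (fun x => h (shift (-y) x)) ∘ shift y = h := fun y => by
    funext x; simp only [Function.comp, shift_neg_shift]
  have hintg : ∀ y : Fin d → ℤ, Integrable (fun x => h (shift (-y) x)) μ := fun y =>
    (measurePreserving_shift _).integrable_comp_of_integrable hh
  -- Undoing the shift turns the past of the origin into the past of `y`. Since `h` reads only `Λ`,
  -- that past may be cut down to `Λ`, which makes the telescoping finite.
  have hw : ∀ᵐ x ∂μ, ∀ y ∈ Λ, (μ[fun x => h (shift (-y) x) | weakPast d E 0]) (shift y x)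
      = (μ[h | cylinderEvents ({z | toLex z ≤ toLex y} ∩ (Λ : Set (Fin d → ℤ)))]) x := by
    rw [Finset.eventually_all]
    intro y _
    have h1 := condExp_comp_measurePreserving (measurePreserving_shift (P₀ := P₀) y)
      (m := weakPast d E 0) cylinderEvents_le_pi (hintg y)
    rw [hcomp, comap_shift_weakPast] at h1
    filter_upwards [h1, condExp_cylinderEvents_inter_of_stronglyMeasurable
      {z | toLex z ≤ toLex y} hh hm] with x e1 e2
    exact e1.symm.trans e2
  have hs : ∀ᵐ x ∂μ, ∀ y ∈ Λ, (μ[fun x => h (shift (-y) x) | strictPast d E 0]) (shift y x)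
      = (μ[h | cylinderEvents ({z | toLex z < toLex y} ∩ (Λ : Set (Fin d → ℤ)))]) x := by
    rw [Finset.eventually_all]
    intro y _
    have h1 := condExp_comp_measurePreserving (measurePreserving_shift (P₀ := P₀) y)
      (m := strictPast d E 0) cylinderEvents_le_pi (hintg y)
    rw [hcomp, comap_shift_strictPast] at h1
    filter_upwards [h1, condExp_cylinderEvents_inter_of_stronglyMeasurable
      {z | toLex z < toLex y} hh hm] with x e1 e2
    exact e1.symm.trans e2
  filter_upwards [hw, hs] with x hwx hsx
  have htel := sum_sub_eq_of_linearOrder (r := fun z : Fin d → ℤ => toLex z) toLex.injective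
    (fun S => (μ[h | cylinderEvents S]) x) Λ
  have hbot : cylinderEvents (X := fun _ : Fin d → ℤ => E) ∅ = ⊥ := by
    simp [cylinderEvents]
  -- The ends of the telescope: all of `Λ` gives `h`, no coordinate gives the mean.
  rw [condExp_of_stronglyMeasurable cylinderEvents_le_pi hm hh, hbot, condExp_bot] at htel
  rw [← htel]
  refine Finset.sum_congr rfl fun y hy => ?_
  rw [pastDifference, hwx y hy, hsx y hy]
  rfl

/-- Orthogonality does not need one common function: here it may vary with the site, as the
approximation errors do. -/
theorem integral_sq_sum_shift {G : (Fin d → ℤ) → ((Fin d → ℤ) → E) → ℝ}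
    (hG : ∀ y, IsMartingaleDifference P₀ (G y)) (s : Finset (Fin d → ℤ)) :
    ∫ x, (∑ y ∈ s, G y (shift y x)) ^ 2 ∂(Measure.infinitePi fun _ : Fin d → ℤ => P₀)
      = ∑ y ∈ s, ∫ x, G y x ^ 2 ∂(Measure.infinitePi fun _ : Fin d → ℤ => P₀) := by
  classical
  have h := integral_sum_mul_sum_eq (μ := Measure.infinitePi fun _ : Fin d → ℤ => P₀)
    (r := fun z : Fin d → ℤ => toLex z) toLex.injective (F := fun y => strictPast d E y)
    (fun _ => cylinderEvents_le_pi) (w := fun y x => G y (shift y x))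
    (v := fun y x => G y (shift y x))
    (fun y y' hy => ((hG y).stronglyMeasurable_shift hy).aestronglyMeasurable)
    (fun y y' hy => ((hG y).stronglyMeasurable_shift hy).aestronglyMeasurable)
    (fun y => (hG y).memLp_shift y) (fun y => (hG y).memLp_shift y)
    (fun y => (hG y).condExp_shift_eq_zero y) (fun y => (hG y).condExp_shift_eq_zero y) s s
  rw [Finset.inter_self] at h
  simp only [sq]
  rw [h]
  refine Finset.sum_congr rfl fun y _ => ?_
  exact integral_comp_measurePreserving (measurePreserving_shift y)
    (f := fun x => G y x * G y x) ((hG y).memLp.1.mul (hG y).memLp.1)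

/-- The lattice points of the dilate `t • A`. -/
noncomputable def latticeFinset {A : Set (EuclideanSpace ℝ (Fin d))} (hA : Bornology.IsBounded A)
    (t : ℝ) : Finset (Fin d → ℤ) :=
  (finite_discretization (hA.smul₀ t) 0).toFinset

theorem mem_latticeFinset {A : Set (EuclideanSpace ℝ (Fin d))} {hA : Bornology.IsBounded A}
    {t : ℝ} {y : Fin d → ℤ} : y ∈ latticeFinset hA t ↔ latticePoint y ∈ t • A := by
  simp [latticeFinset, discretization, Metric.closedBall_zero]

end MartingaleDecomposition

/-! ### Approximation of a random set function by a stationary sum. -/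

namespace RandomSetFunction

section Approximation

variable {d : ℕ} {E : Type*} [MeasurableSpace E] {P₀ : Measure E} [IsProbabilityMeasure P₀]
  {Ω : Type*} [MeasurableSpace Ω] {P : Measure Ω} [IsProbabilityMeasure P]
  {X : (Fin d → ℤ) → Ω → E} {Xs : Ω → E} {ρ : ℝ} {B₀ : Set (EuclideanSpace ℝ (Fin d))}
  {H : RandomSetFunction E ρ B₀}

/-- `H_t(A)` centred at its mean, as a function on the canonical space. -/
noncomputable def centred (P₀ : Measure E) [IsProbabilityMeasure P₀] (H : RandomSetFunction E ρ B₀)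
    (t : Set.Ici (1 : ℝ)) (A : RiemannSubset B₀) (x : (Fin d → ℤ) → E) : ℝ :=
  H.eval t x A - ∫ x, H.eval t x A ∂(Measure.infinitePi fun _ : Fin d → ℤ => P₀)

theorem centred_ae_eq_sum_pastDifference (hB₀ : Bornology.IsBounded B₀)
    (hpair : MeasurePreserving (fun ω => ((fun z => X z ω), Xs ω)) P
      ((Measure.infinitePi fun _ : Fin d → ℤ => P₀).prod P₀))
    (hmom : H.BoundedMoments P X Xs) (t : Set.Ici (1 : ℝ)) (A : RiemannSubset B₀)
    {Λ : Finset (Fin d → ℤ)} (hΛ : (Λ : Set (Fin d → ℤ)) = discretization ρ ((t : ℝ) • B₀)) :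
    H.centred P₀ t A =ᵐ[Measure.infinitePi fun _ : Fin d → ℤ => P₀]
      fun x => ∑ y ∈ Λ, pastDifference P₀ (H.recentred t A y) (shift y x) := by
  have hm : StronglyMeasurable[cylinderEvents (Λ : Set (Fin d → ℤ))] (fun x => H.eval t x A) := by
    rw [hΛ]; exact stronglyMeasurable_eval_cylinderEvents t A
  have hi : Integrable (fun x => H.eval t x A) (Measure.infinitePi fun _ : Fin d → ℤ => P₀) :=
    (memLp_eval hB₀ hpair hmom t A).integrable (by norm_num)
  exact sub_integral_ae_eq_sum_pastDifference hi Λ hm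

/-- The stationary martingale approximation of a random set function in mean square. -/
theorem tendsto_integral_sq_centred_sub (hB₀ : IsRiemannMeasurable B₀) (hρ : 0 ≤ ρ)
    (hpair : MeasurePreserving (fun ω => ((fun z => X z ω), Xs ω)) P
      ((Measure.infinitePi fun _ : Fin d → ℤ => P₀).prod P₀))
    (hmom : H.BoundedMoments P X Xs) {g : ((Fin d → ℤ) → E) → ℝ}
    (hg : IsMartingaleDifference P₀ g) (A : RiemannSubset B₀) {t : ℕ → Set.Ici (1 : ℝ)}
    (ht : Tendsto (fun n => (t n : ℝ)) atTop atTop)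
    (hlim : ∀ y : ℕ → Fin d → ℤ,
        (setLiminf (fun n => latticePoint (-y n) +ᵥ
            ((t n : ℝ) • (A : Set (EuclideanSpace ℝ (Fin d))))) = Set.univ →
          Tendsto (fun n => ∫ x, (pastDifference P₀ (H.recentred (t n) A (y n)) x - g x) ^ 2
            ∂(Measure.infinitePi fun _ : Fin d → ℤ => P₀)) atTop (𝓝 0)) ∧
        (setLiminf (fun n => latticePoint (-y n) +ᵥ
            ((t n : ℝ) • (B₀ \ (A : Set (EuclideanSpace ℝ (Fin d)))))) = Set.univ →
          Tendsto (fun n => ∫ x, pastDifference P₀ (H.recentred (t n) A (y n)) x ^ 2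
            ∂(Measure.infinitePi fun _ : Fin d → ℤ => P₀)) atTop (𝓝 0))) :
    Tendsto (fun n => ((t n : ℝ) ^ d)⁻¹ * ∫ x, (H.centred P₀ (t n) A x
        - ∑ y ∈ latticeFinset A.2.1.1 (t n), g (shift y x)) ^ 2
          ∂(Measure.infinitePi fun _ : Fin d → ℤ => P₀)) atTop (𝓝 0) := by
  classical
  set μ := Measure.infinitePi fun _ : Fin d → ℤ => P₀ with hμ
  have hfin : ∀ n, (discretization ρ ((t n : ℝ) • B₀)).Finite := fun n =>
    finite_discretization (hB₀.1.smul₀ _) ρ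
  let Λ : ℕ → Finset (Fin d → ℤ) := fun n => (hfin n).toFinset
  let Λ' : ℕ → Finset (Fin d → ℤ) := fun n => latticeFinset A.2.1.1 (t n)
  have hΛ' : ∀ n, Λ' n ⊆ Λ n := fun n y hy => (hfin n).mem_toFinset.2
    (mem_discretization_of_latticePoint_mem hρ
      (Set.smul_set_mono A.2.2 (mem_latticeFinset.1 hy)))
  have hzero : IsMartingaleDifference P₀ (fun _ : (Fin d → ℤ) → E => (0 : ℝ)) := by
    simpa using hg.sub hg
  have hite : ∀ n y, IsMartingaleDifference P₀ (fun x => if y ∈ Λ' n then g x else 0) := by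
    intro n y
    by_cases hy : y ∈ Λ' n
    · simpa [hy] using hg
    · simpa [hy] using hzero
  -- The error at site `y`: the target is `g` for lattice points of `t A` and zero elsewhere.
  let G : ℕ → (Fin d → ℤ) → ((Fin d → ℤ) → E) → ℝ := fun n y x =>
    pastDifference P₀ (H.recentred (t n) A y) x - if y ∈ Λ' n then g x else 0
  have hpd : ∀ n y, IsMartingaleDifference P₀ (pastDifference P₀ (H.recentred (t n) A y)) :=
    fun n y => isMartingaleDifference_pastDifference (memLp_recentred hB₀.1 hpair hmom _ _ _)
  have hG : ∀ n y, IsMartingaleDifference P₀ (G n y) := fun n y => (hpd n y).sub (hite n y)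
  let F : ℕ → (Fin d → ℤ) → ℝ := fun n y => if y ∈ Λ n then ∫ x, G n y x ^ 2 ∂μ else 0
  have hF0 : ∀ n y, 0 ≤ F n y := fun n y => by
    simp only [F]; split_ifs
    · exact integral_nonneg fun x => sq_nonneg _
    · exact le_rfl
  have hFle : ∀ n y, F n y ≤ ∫ x, G n y x ^ 2 ∂μ := fun n y => by
    simp only [F]; split_ifs
    · exact le_rfl
    · exact integral_nonneg fun x => sq_nonneg _
  have hsum : ∀ n, ∫ x, (H.centred P₀ (t n) A x - ∑ y ∈ Λ' n, g (shift y x)) ^ 2 ∂μ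
      = ∑ y ∈ Λ n, F n y := by
    intro n
    have hdec := centred_ae_eq_sum_pastDifference hB₀.1 hpair hmom (t n) A (hfin n).coe_toFinset
    calc _ = ∫ x, (∑ y ∈ Λ n, G n y (shift y x)) ^ 2 ∂μ := by
          refine integral_congr_ae ?_
          filter_upwards [hdec] with x hx
          rw [hx]
          simp only [G, Finset.sum_sub_distrib]
          rw [Finset.sum_ite_mem, Finset.inter_eq_right.2 (hΛ' n)]
      _ = ∑ y ∈ Λ n, ∫ x, G n y x ^ 2 ∂μ := integral_sq_sum_shift (hG n) (Λ n)
      _ = _ := Finset.sum_congr rfl fun y hy => by simp only [F, hy, if_true]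
  obtain ⟨C, hC⟩ := exists_integral_sq_pastDifference_le hB₀.1 hpair hmom
  -- The `max` is there because nothing says that `C` is nonnegative, while the bound must also hold
  -- where `F` is zero.
  have hbound : ∀ n y, |F n y| ≤ 2 * max C 0 + 2 * ∫ x, g x ^ 2 ∂μ := by
    intro n y
    have hg0 : 0 ≤ ∫ x, g x ^ 2 ∂μ := integral_nonneg fun x => sq_nonneg _
    rw [abs_of_nonneg (hF0 n y)]
    by_cases hy : y ∈ Λ n
    · have h1 := integral_sq_add_le (hpd n y).memLp (hite n y).memLp.neg
      have h2 := hC A (t n) y ((hfin n).mem_toFinset.1 hy)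
      have h3 : ∫ x, (-fun x => if y ∈ Λ' n then g x else 0) x ^ 2 ∂μ ≤ ∫ x, g x ^ 2 ∂μ := by
        by_cases hy' : y ∈ Λ' n
        · simp [hy']
        · simpa [hy'] using hg0
      have h4 : F n y = ∫ x, (pastDifference P₀ (H.recentred (t n) A y) x
          + (-fun x => if y ∈ Λ' n then g x else 0) x) ^ 2 ∂μ := by
        simp only [F, hy, if_true, G, Pi.neg_apply, sub_eq_add_neg]
      rw [h4]
      have := le_max_left C 0
      linarith
    · simp only [F, hy, if_false]
      positivity
  -- Off the two null boundaries there are three cases: `x` interior to `A`, `x` interior to `B₀`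
  -- but off the closure of `A`, and `x` off the closure of `B₀`.
  have hae : ∀ᵐ x : EuclideanSpace ℝ (Fin d),
      Tendsto (fun n => F n (latticeFloor (t n : ℝ) x)) atTop (𝓝 0) := by
    have hA := measure_eq_zero_iff_ae_notMem.1 A.2.1.2
    have hB := measure_eq_zero_iff_ae_notMem.1 hB₀.2
    filter_upwards [hA, hB] with x hxA hxB
    by_cases hxi : x ∈ interior (A : Set (EuclideanSpace ℝ (Fin d)))
    · refine squeeze_zero' (Eventually.of_forall fun n => hF0 n _) ?_
        ((hlim fun n => latticeFloor (t n : ℝ) x).1 (setLiminf_vadd_smul_eq_univ hxi ht))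
      filter_upwards [eventually_latticePoint_mem hxi ht] with n hn
      refine (hFle n _).trans_eq ?_
      have : latticeFloor (t n : ℝ) x ∈ Λ' n := mem_latticeFinset.2 hn
      simp only [G, this, if_true]
    have hxc : x ∉ closure (A : Set (EuclideanSpace ℝ (Fin d))) := fun h => hxA ⟨h, hxi⟩
    by_cases hxb : x ∈ interior B₀
    · have hxd : x ∈ interior (B₀ \ (A : Set (EuclideanSpace ℝ (Fin d)))) := by
        rw [mem_interior_iff_mem_nhds] at hxb ⊢
        filter_upwards [hxb, isClosed_closure.isOpen_compl.mem_nhds hxc] with z hz hz'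
        exact ⟨hz, fun h => hz' (subset_closure h)⟩
      refine squeeze_zero' (Eventually.of_forall fun n => hF0 n _) ?_
        ((hlim fun n => latticeFloor (t n : ℝ) x).2 (setLiminf_vadd_smul_eq_univ hxd ht))
      filter_upwards [eventually_notMem_discretization hxc ht 0] with n hn
      refine (hFle n _).trans_eq ?_
      have : latticeFloor (t n : ℝ) x ∉ Λ' n := fun h => hn
        (mem_discretization_of_latticePoint_mem le_rfl (mem_latticeFinset.1 h))
      simp only [G, this, if_false, sub_zero]
    · have hxbc : x ∉ closure B₀ := fun h => hxB ⟨h, hxb⟩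
      refine tendsto_const_nhds.congr' ?_
      filter_upwards [eventually_notMem_discretization hxbc ht ρ] with n hn
      have : latticeFloor (t n : ℝ) x ∉ Λ n := fun h => hn ((hfin n).mem_toFinset.1 h)
      simp only [F, this, if_false]
  have hfinal := tendsto_sum_discretization hB₀.1 (ρ := ρ) (fun n => (t n).2) (Λ := Λ)
    (fun n y hy => (hfin n).mem_toFinset.1 hy) (F := F)
    (fun n y hy => by simp only [F, hy, if_false]) hbound hae
  rw [integral_zero] at hfinal
  exact hfinal.congr fun n => by rw [← hsum n]

end Approximation

end RandomSetFunction

/-! ### Passing from stationary sums to the variables they approximate. -/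

section StationaryApproximation

variable {d : ℕ} {E : Type*} [MeasurableSpace E] {P₀ : Measure E} [IsProbabilityMeasure P₀] {k : ℕ}
  {g : Fin k → ((Fin d → ℤ) → E) → ℝ} {Λ : Fin k → ℕ → Finset (Fin d → ℤ)} {N : ℕ → ℝ}
  [DecidableEq (Fin d → ℤ)] {V : Fin k → Fin k → ℝ} {U : Fin k → ℕ → ((Fin d → ℤ) → E) → ℝ}

theorem sqrt_inv_mul_mul_sqrt_inv_mul {N : ℝ} (hN : 0 < N) (a b : ℝ) :
    √(N⁻¹ * a) * √(N⁻¹ * b) = N⁻¹ * (√a * √b) := by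
  have h : √N⁻¹ * √N⁻¹ = N⁻¹ := Real.mul_self_sqrt (inv_nonneg.2 hN.le)
  rw [Real.sqrt_mul (inv_nonneg.2 hN.le), Real.sqrt_mul (inv_nonneg.2 hN.le)]
  linear_combination (√a * √b) * h

/-- The covariances of random variables approximated by stationary martingale difference sums. -/
theorem tendsto_inv_mul_integral_mul (hg : ∀ i, IsMartingaleDifference P₀ (g i))
    (hN0 : ∀ n, 0 < N n)
    (hV : ∀ i j, Tendsto (fun n => ((Λ i n ∩ Λ j n).card : ℝ) / N n) atTop (𝓝 (V i j)))
    (hU : ∀ i n, MemLp (U i n) 2 (Measure.infinitePi fun _ : Fin d → ℤ => P₀))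
    (happ : ∀ i, Tendsto (fun n => (N n)⁻¹ * ∫ x, (U i n x - ∑ y ∈ Λ i n, g i (shift y x)) ^ 2
      ∂(Measure.infinitePi fun _ : Fin d → ℤ => P₀)) atTop (𝓝 0)) (i j : Fin k) :
    Tendsto (fun n => (N n)⁻¹ * ∫ x, U i n x * U j n x
        ∂(Measure.infinitePi fun _ : Fin d → ℤ => P₀)) atTop
      (𝓝 (V i j * ∫ x, g i x * g j x ∂(Measure.infinitePi fun _ : Fin d → ℤ => P₀))) := by
  set μ := Measure.infinitePi fun _ : Fin d → ℤ => P₀ with hμ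
  let W : Fin k → ℕ → ((Fin d → ℤ) → E) → ℝ := fun i n x => ∑ y ∈ Λ i n, g i (shift y x)
  have hW : ∀ i n, MemLp (W i n) 2 μ := fun i n =>
    memLp_finsetSum (Λ i n) fun y _ => (hg i).memLp_shift y
  have hWW : ∀ i j, Tendsto (fun n => (N n)⁻¹ * ∫ x, W i n x * W j n x ∂μ) atTop
      (𝓝 (V i j * ∫ x, g i x * g j x ∂μ)) := by
    intro i j
    refine ((hV i j).mul_const (∫ x, g i x * g j x ∂μ)).congr fun n => ?_
    rw [(hg i).integral_sum_mul_sum (hg j)]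
    ring
  have hsq : ∀ i, Tendsto (fun n => √((N n)⁻¹ * ∫ x, W i n x ^ 2 ∂μ)) atTop
      (𝓝 √(V i i * ∫ x, g i x * g i x ∂μ)) := fun i => by
    simpa only [sq] using (hWW i i).sqrt
  have herr : ∀ i, Tendsto (fun n => √((N n)⁻¹ * ∫ x, (W i n x - U i n x) ^ 2 ∂μ)) atTop
      (𝓝 0) := fun i => by
    have := (happ i).sqrt
    rw [Real.sqrt_zero] at this
    refine this.congr fun n => ?_
    simp only [W, sub_sq_comm]
  have hdiff : Tendsto (fun n => (N n)⁻¹ * ∫ x, U i n x * U j n x ∂μ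
      - (N n)⁻¹ * ∫ x, W i n x * W j n x ∂μ) atTop (𝓝 0) := by
    have hz := (((herr i).mul (hsq j)).add ((hsq i).mul (herr j))).add ((herr i).mul (herr j))
    simp only [zero_mul, mul_zero, add_zero] at hz
    refine squeeze_zero_norm (fun n => ?_) hz
    have h := abs_integral_mul_sub_le (hW i n) (hW j n) (hU i n) (hU j n)
    rw [← mul_sub, norm_mul, Real.norm_of_nonneg (inv_nonneg.2 (hN0 n).le), Real.norm_eq_abs]
    refine (mul_le_mul_of_nonneg_left h (inv_nonneg.2 (hN0 n).le)).trans_eq ?_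
    simp only [sqrt_inv_mul_mul_sqrt_inv_mul (hN0 n)]
    ring
  simpa using hdiff.add (hWW i j)

/-- The quadratic form is the limit of normalized second moments of the combinations `∑ i, v i * W i
n`. -/
theorem sum_mul_nonneg_of_approx (hg : ∀ i, IsMartingaleDifference P₀ (g i))
    (hN0 : ∀ n, 0 < N n)
    (hV : ∀ i j, Tendsto (fun n => ((Λ i n ∩ Λ j n).card : ℝ) / N n) atTop (𝓝 (V i j)))
    (v : Fin k → ℝ) :
    0 ≤ ∑ i, ∑ j, v i * v j *
      (V i j * ∫ x, g i x * g j x ∂(Measure.infinitePi fun _ : Fin d → ℤ => P₀)) := by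
  set μ := Measure.infinitePi fun _ : Fin d → ℤ => P₀ with hμ
  let W : Fin k → ℕ → ((Fin d → ℤ) → E) → ℝ := fun i n x => ∑ y ∈ Λ i n, g i (shift y x)
  have hW : ∀ i n, MemLp (W i n) 2 μ := fun i n =>
    memLp_finsetSum (Λ i n) fun y _ => (hg i).memLp_shift y
  have hlim := fun i j => tendsto_inv_mul_integral_mul hg hN0 hV hW
    (fun i => by simp [W]) i j
  have hsum : Tendsto (fun n => ∑ i, ∑ j, v i * v j * ((N n)⁻¹ * ∫ x, W i n x * W j n x ∂μ)) atTop
      (𝓝 (∑ i, ∑ j, v i * v j * (V i j * ∫ x, g i x * g j x ∂μ))) :=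
    tendsto_finsetSum _ fun i _ => tendsto_finsetSum _ fun j _ => (hlim i j).const_mul _
  refine ge_of_tendsto' hsum fun n => ?_
  have hintg : ∀ i j, Integrable (fun x => v i * v j * (W i n x * W j n x)) μ := fun i j =>
    ((hW i n).integrable_mul (hW j n)).const_mul _
  have heq : ∑ i, ∑ j, v i * v j * ((N n)⁻¹ * ∫ x, W i n x * W j n x ∂μ)
      = (N n)⁻¹ * ∫ x, (∑ i, v i * W i n x) ^ 2 ∂μ := by
    have : ∀ x, (∑ i, v i * W i n x) ^ 2 = ∑ i, ∑ j, v i * v j * (W i n x * W j n x) := fun x => by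
      rw [sq, Finset.sum_mul_sum]
      exact Finset.sum_congr rfl fun i _ => Finset.sum_congr rfl fun j _ => by ring
    simp only [this]
    rw [integral_finsetSum _ fun i _ => integrable_finsetSum _ fun j _ => hintg i j, Finset.mul_sum]
    refine Finset.sum_congr rfl fun i _ => ?_
    rw [integral_finsetSum _ fun j _ => hintg i j, Finset.mul_sum]
    refine Finset.sum_congr rfl fun j _ => ?_
    rw [integral_const_mul]
    ring
  rw [heq]
  exact mul_nonneg (inv_nonneg.2 (hN0 n).le) (integral_nonneg fun x => sq_nonneg _)

/-- Characteristic functions of random vectors approximated by stationary martingale difference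
sums. -/
theorem tendsto_integral_exp_of_approx (hg : ∀ i, IsMartingaleDifference P₀ (g i))
    (hN0 : ∀ n, 0 < N n) (hN : Tendsto N atTop atTop)
    (hV : ∀ i j, Tendsto (fun n => ((Λ i n ∩ Λ j n).card : ℝ) / N n) atTop (𝓝 (V i j)))
    (hU : ∀ i n, MemLp (U i n) 2 (Measure.infinitePi fun _ : Fin d → ℤ => P₀))
    (happ : ∀ i, Tendsto (fun n => (N n)⁻¹ * ∫ x, (U i n x - ∑ y ∈ Λ i n, g i (shift y x)) ^ 2
      ∂(Measure.infinitePi fun _ : Fin d → ℤ => P₀)) atTop (𝓝 0)) (a : Fin k → ℝ) :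
    Tendsto (fun n => ∫ x, Complex.exp (((√(N n))⁻¹ * ∑ i, a i * U i n x : ℝ) * Complex.I)
        ∂(Measure.infinitePi fun _ : Fin d → ℤ => P₀)) atTop
      (𝓝 (Real.exp (-(∑ i, ∑ j, a i * a j *
        (V i j * ∫ x, g i x * g j x ∂(Measure.infinitePi fun _ : Fin d → ℤ => P₀))) / 2) : ℂ)) := by
  set μ := Measure.infinitePi fun _ : Fin d → ℤ => P₀ with hμ
  let W : Fin k → ℕ → ((Fin d → ℤ) → E) → ℝ := fun i n x => ∑ y ∈ Λ i n, g i (shift y x)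
  have hW : ∀ i n, MemLp (W i n) 2 μ := fun i n =>
    memLp_finsetSum (Λ i n) fun y _ => (hg i).memLp_shift y
  have hlim := tendsto_integral_exp_sum_shift hg hN0 hN hV a
  have hI : ∀ {Y : Fin k → ℕ → ((Fin d → ℤ) → E) → ℝ}, (∀ i n, MemLp (Y i n) 2 μ) → ∀ n,
      Integrable (fun x => (√(N n))⁻¹ * ∑ i, a i * Y i n x) μ := fun hY n =>
    (integrable_finsetSum _ fun i _ =>
      ((hY i n).integrable (by norm_num)).const_mul (a i)).const_mul _
  have hz : Tendsto (fun n => ∑ i, |a i| * √((N n)⁻¹ * ∫ x, (U i n x - W i n x) ^ 2 ∂μ)) atTop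
      (𝓝 0) := by
    have : Tendsto (fun n => ∑ i, |a i| * √((N n)⁻¹ * ∫ x, (U i n x - W i n x) ^ 2 ∂μ)) atTop
        (𝓝 (∑ i : Fin k, |a i| * √0)) :=
      tendsto_finsetSum _ fun i _ => ((happ i).sqrt).const_mul _
    simpa using this
  -- By the Lipschitz bound for `exp(i u)` and Cauchy–Schwarz, the mean square approximation makes
  -- the two characteristic functions merge.
  have hdiff : Tendsto (fun n =>
      ∫ x, Complex.exp (((√(N n))⁻¹ * ∑ i, a i * U i n x : ℝ) * Complex.I) ∂μ
      - ∫ x, Complex.exp (((√(N n))⁻¹ * ∑ i, a i * W i n x : ℝ) * Complex.I) ∂μ) atTop (𝓝 0) := by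
    refine squeeze_zero_norm (fun n => ?_) hz
    refine (norm_integral_exp_sub_le (hI hU n) (hI hW n)).trans ?_
    have hsub : ∀ i, MemLp (fun x => U i n x - W i n x) 2 μ := fun i => (hU i n).sub (hW i n)
    have hintg : ∀ i, Integrable (fun x => (√(N n))⁻¹ * (|a i| * |U i n x - W i n x|)) μ := fun i =>
      ((((hsub i).integrable (by norm_num)).abs).const_mul _).const_mul _
    have hs0 : 0 ≤ (√(N n))⁻¹ := inv_nonneg.2 (Real.sqrt_nonneg _)
    calc ∫ x, |(√(N n))⁻¹ * ∑ i, a i * U i n x - (√(N n))⁻¹ * ∑ i, a i * W i n x| ∂μ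
        ≤ ∫ x, ∑ i, (√(N n))⁻¹ * (|a i| * |U i n x - W i n x|) ∂μ := by
          refine integral_mono ((hI hU n).sub (hI hW n)).abs
            (integrable_finsetSum _ fun i _ => hintg i) fun x => ?_
          have : (√(N n))⁻¹ * ∑ i, a i * U i n x - (√(N n))⁻¹ * ∑ i, a i * W i n x
              = ∑ i, (√(N n))⁻¹ * (a i * (U i n x - W i n x)) := by
            rw [← mul_sub, ← Finset.sum_sub_distrib, Finset.mul_sum]
            exact Finset.sum_congr rfl fun i _ => by ring
          simp only [this]
          refine (Finset.abs_sum_le_sum_abs _ _).trans_eq ?_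
          refine Finset.sum_congr rfl fun i _ => ?_
          rw [abs_mul, abs_mul, abs_of_nonneg hs0]
      _ = ∑ i, (√(N n))⁻¹ * (|a i| * ∫ x, |U i n x - W i n x| ∂μ) := by
          rw [integral_finsetSum _ fun i _ => hintg i]
          simp only [integral_const_mul]
      _ ≤ _ := by
          refine Finset.sum_le_sum fun i _ => ?_
          rw [Real.sqrt_mul (inv_nonneg.2 (hN0 n).le), Real.sqrt_inv, mul_left_comm]
          gcongr
          exact integral_abs_le_sqrt (hsub i)
  have hadd := hdiff.add hlim
  rw [zero_add] at hadd
  exact hadd.congr fun n => sub_add_cancel _ _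

end StationaryApproximation

/-! ### Assembly of the main theorem. -/

theorem measurePreserving_field_resample {ι E Ω : Type*} [MeasurableSpace E] {P₀ : Measure E}
    [MeasurableSpace Ω] {P : Measure Ω} [IsProbabilityMeasure P] {X : ι → Ω → E} {Xs : Ω → E}
    (hX : ∀ z, Measurable (X z)) (hXs : Measurable Xs) (hXlaw : ∀ z, P.map (X z) = P₀)
    (hXslaw : P.map Xs = P₀) (hXindep : iIndepFun X P)
    (hXXs : IndepFun (fun ω z => X z ω) Xs P) :
    MeasurePreserving (fun ω => ((fun z => X z ω), Xs ω)) P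
      ((Measure.infinitePi fun _ : ι => P₀).prod P₀) where
  measurable := (measurable_pi_lambda _ hX).prodMk hXs
  map_eq := by
    rw [(indepFun_iff_map_prod_eq_prod_map_map (measurable_pi_lambda _ hX).aemeasurable
      hXs.aemeasurable).1 hXXs, iIndepFun.map_fun_eq_infinitePi_map hX hXindep, hXslaw]
    simp only [hXlaw]

theorem latticeFinset_inter {d : ℕ} {A A' : Set (EuclideanSpace ℝ (Fin d))}
    (hA : Bornology.IsBounded A) (hA' : Bornology.IsBounded A') {t : ℝ} (ht : t ≠ 0)
    [DecidableEq (Fin d → ℤ)] (y : Fin d → ℤ) :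
    y ∈ latticeFinset hA t ∩ latticeFinset hA' t ↔ latticePoint y ∈ t • (A ∩ A') := by
  rw [Finset.mem_inter, mem_latticeFinset, mem_latticeFinset, Set.smul_set_inter₀ ht,
    Set.mem_inter_iff]

end LatticeCLT

open LatticeCLT in
theorem mainTheorem1 {d k : ℕ} (hd : 1 ≤ d) {E : Type*} [MeasurableSpace E]
    (P₀ : Measure E) [IsProbabilityMeasure P₀]
    {Ω : Type*} [MeasurableSpace Ω] (P : Measure Ω) [IsProbabilityMeasure P]
    (X : (Fin d → ℤ) → Ω → E) (Xs : Ω → E)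
    (hX : ∀ z, Measurable (X z)) (hXs : Measurable Xs)
    (hXlaw : ∀ z, P.map (X z) = P₀) (hXslaw : P.map Xs = P₀)
    (hXindep : iIndepFun X P) (hXXs : IndepFun (fun ω z => X z ω) Xs P)
    (ρ : ℝ) (hρ : √(d : ℝ) ≤ ρ)
    (B₀ : Set (EuclideanSpace ℝ (Fin d))) (hB₀ : LatticeCLT.IsRiemannMeasurable B₀)
    (hB₀pos : 0 < volume B₀)
    (H : Fin k → LatticeCLT.RandomSetFunction E ρ B₀) (D : Fin k → Ω → ℝ)
    (hstab : ∀ i, (H i).Stabilizes P X Xs (D i))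
    (hmom : ∀ i, (H i).BoundedMoments P X Xs)
    (A : Fin k → LatticeCLT.RiemannSubset B₀) :
    (∀ i, MemLp (D i) 2 P) ∧
    (∀ i t, MemLp ((H i).var X t (A i)) 2 P) ∧
    (∀ i j, Tendsto (fun t : Set.Ici (1 : ℝ) =>
        (t : ℝ) ^ (-(d : ℝ)) * cov[(H i).var X t (A i), (H j).var X t (A j); P]) atTop
      (𝓝 (LatticeCLT.sigmaStar P X D i j *
        volume.real ((A i : Set (EuclideanSpace ℝ (Fin d))) ∩ A j)))) ∧
    (LatticeCLT.limitCov P X D A).PosSemidef ∧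
    TendstoInDistribution
      (fun (t : Set.Ici (1 : ℝ)) ω => (WithLp.toLp 2 fun i : Fin k =>
        (t : ℝ) ^ (-(d : ℝ) / 2) *
          ((H i).var X t (A i) ω - ∫ ω', (H i).var X t (A i) ω' ∂P) :
        EuclideanSpace ℝ (Fin k)))
      atTop id (fun _ => P) (multivariateGaussian 0 (LatticeCLT.limitCov P X D A)) := by
  classical
  set μ := Measure.infinitePi fun _ : Fin d → ℤ => P₀ with hμ
  have hρ0 : 0 ≤ ρ := (Real.sqrt_nonneg _).trans hρ
  have hpair := measurePreserving_field_resample hX hXs hXlaw hXslaw hXindep hXXs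
  have hXμ : MeasurePreserving (fun ω z => X z ω) P μ :=
    (measurePreserving_fst (ν := P₀)).comp hpair
  choose hD g hg hgD hgl using fun i =>
    RandomSetFunction.exists_limit_pastDifference hB₀ hB₀pos hρ0 hpair (hmom i) (hstab i)
  have hσ : ∀ i j, sigmaStar P X D i j = ∫ x, g i x * g j x ∂μ := by
    intro i j
    rw [← integral_comp_measurePreserving hXμ (f := fun x => g i x * g j x)
      ((hg i).memLp.1.mul (hg j).memLp.1)]
    refine integral_congr_ae ?_
    filter_upwards [hgD i, hgD j] with ω h1 h2
    rw [← h1, ← h2]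
  have heval : ∀ i t, MemLp (fun x => (H i).eval t x (A i)) 2 μ := fun i t =>
    RandomSetFunction.memLp_eval hB₀.1 hpair (hmom i) t (A i)
  have hcen : ∀ i t, MemLp ((H i).centred P₀ t (A i)) 2 μ := fun i t =>
    (heval i t).sub (memLp_const _)
  have hvar : ∀ i t, MemLp ((H i).var X t (A i)) 2 P := fun i t =>
    memLp_comp_measurePreserving hXμ (heval i t)
  have hmean : ∀ i t ω, (H i).var X t (A i) ω - ∫ ω', (H i).var X t (A i) ω' ∂P
      = (H i).centred P₀ t (A i) (fun z => X z ω) := fun i t ω => by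
    have h := integral_comp_measurePreserving hXμ (f := fun x => (H i).eval t x (A i))
      (heval i t).1
    simp only [RandomSetFunction.var, RandomSetFunction.centred, h, hμ]
  let Λ : Fin k → Set.Ici (1 : ℝ) → Finset (Fin d → ℤ) := fun i t =>
    latticeFinset (A i).2.1.1 (t : ℝ)
  have hpos : ∀ t : Set.Ici (1 : ℝ), 0 < (t : ℝ) := fun t => zero_lt_one.trans_le t.2
  have hpow : ∀ t : Set.Ici (1 : ℝ), 0 < (t : ℝ) ^ d := fun t => pow_pos (hpos t) d
  have hcard : ∀ t : ℕ → Set.Ici (1 : ℝ), Tendsto t atTop atTop → ∀ i j,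
      Tendsto (fun n => ((Λ i (t n) ∩ Λ j (t n)).card : ℝ) / (t n : ℝ) ^ d) atTop
        (𝓝 (volume.real ((A i : Set (EuclideanSpace ℝ (Fin d))) ∩ A j))) := fun t ht i j =>
    tendsto_card_div_pow ((A i).2.1.inter (A j).2.1) (fun n => (t n).2)
      (tendsto_Ici_atTop.1 ht) fun n y => latticeFinset_inter _ _ (hpos (t n)).ne' y
  have happ : ∀ t : ℕ → Set.Ici (1 : ℝ), Tendsto t atTop atTop → ∀ i,
      Tendsto (fun n => ((t n : ℝ) ^ d)⁻¹ * ∫ x, ((H i).centred P₀ (t n) (A i) x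
        - ∑ y ∈ Λ i (t n), g i (shift y x)) ^ 2 ∂μ) atTop (𝓝 0) := fun t ht i =>
    RandomSetFunction.tendsto_integral_sq_centred_sub hB₀ hρ0 hpair (hmom i) (hg i) (A i)
      (tendsto_Ici_atTop.1 ht) (hgl i (A i) t)
  have hpsd : (limitCov P X D A).PosSemidef := by
    refine Matrix.PosSemidef.of_dotProduct_mulVec_nonneg ?_ fun v => ?_
    · ext i j
      simp only [limitCov, Matrix.conjTranspose_apply, Matrix.of_apply, star_trivial, hσ]
      rw [Set.inter_comm]
      simp only [mul_comm]
    · let t : ℕ → Set.Ici (1 : ℝ) := fun n => ⟨n + 1, by simp⟩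
      have ht : Tendsto t atTop atTop := tendsto_Ici_atTop.2
        (tendsto_atTop_add_const_right _ _ tendsto_natCast_atTop_atTop)
      refine (sum_mul_nonneg_of_approx hg (fun n => hpow (t n)) (hcard t ht) v).trans_eq ?_
      simp only [limitCov, dotProduct, Matrix.mulVec, Matrix.of_apply, Pi.star_apply, star_trivial,
        hσ, Finset.mul_sum]
      exact Finset.sum_congr rfl fun i _ => Finset.sum_congr rfl fun j _ => by ring
  refine ⟨hD, hvar, fun i j => ?_, hpsd, ?_⟩
  · refine tendsto_of_seq_tendsto fun t ht => ?_
    rw [hσ, mul_comm]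
    refine (tendsto_inv_mul_integral_mul hg (fun n => hpow (t n)) (hcard t ht)
      (fun i n => hcen i (t n)) (happ t ht) i j).congr fun n => ?_
    rw [Function.comp_apply, Real.rpow_neg (hpos _).le, Real.rpow_natCast, covariance]
    congr 1
    simp only [hmean]
    exact (integral_comp_measurePreserving hXμ (f := fun x => (H i).centred P₀ (t n) (A i) x
      * (H j).centred P₀ (t n) (A j) x) ((hcen i _).1.mul (hcen j _).1)).symm
  · let Y : Set.Ici (1 : ℝ) → Ω → EuclideanSpace ℝ (Fin k) := fun t ω => WithLp.toLp 2 fun i =>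
      (t : ℝ) ^ (-(d : ℝ) / 2) * ((H i).var X t (A i) ω - ∫ ω', (H i).var X t (A i) ω' ∂P)
    have hmeas : ∀ t, AEMeasurable (Y t) P := fun t => by
      refine (WithLp.measurable_toLp 2 _).comp_aemeasurable ?_
      exact aemeasurable_pi_lambda _ fun i =>
        ((hvar i t).1.aemeasurable.sub_const _).const_mul _
    refine ⟨hmeas, aemeasurable_id, ?_⟩
    refine tendsto_of_seq_tendsto fun t ht => ?_
    -- Lévy's continuity theorem: the argument `a` selects a linear combination of the coordinates.
    refine ProbabilityMeasure.tendsto_of_tendsto_charFun fun a => ?_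
    change Tendsto (fun n => charFun (P.map (Y (t n))) a) atTop
      (𝓝 (charFun ((multivariateGaussian 0 (limitCov P X D A)).map id) a))
    rw [Measure.map_id, charFun_multivariateGaussian hpsd]
    -- Here `d ≥ 1` is needed: the normalization must diverge.
    have htd : Tendsto (fun n => (t n : ℝ) ^ d) atTop atTop :=
      (tendsto_pow_atTop (by omega)).comp (tendsto_Ici_atTop.1 ht)
    have hlim := tendsto_integral_exp_of_approx hg (fun n => hpow (t n)) htd (hcard t ht)
      (fun i n => hcen i (t n)) (happ t ht) a
    have hval : Complex.exp ((inner ℝ a (0 : EuclideanSpace ℝ (Fin k)) : ℝ) * Complex.I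
        - ((a.ofLp ⬝ᵥ (limitCov P X D A).mulVec a.ofLp : ℝ) : ℂ) / 2)
        = (Real.exp (-(∑ i, ∑ j, a i * a j *
        (volume.real ((A i : Set (EuclideanSpace ℝ (Fin d))) ∩ A j)
          * ∫ x, g i x * g j x ∂μ)) / 2) : ℂ) := by
      have : a.ofLp ⬝ᵥ (limitCov P X D A).mulVec a.ofLp = ∑ i, ∑ j, a i * a j *
          (volume.real ((A i : Set (EuclideanSpace ℝ (Fin d))) ∩ A j)
            * ∫ x, g i x * g j x ∂μ) := by
        simp only [limitCov, dotProduct, Matrix.mulVec, Matrix.of_apply, hσ, Finset.mul_sum]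
        exact Finset.sum_congr rfl fun i _ => Finset.sum_congr rfl fun j _ => by ring
      rw [this, inner_zero_right, Complex.ofReal_exp]
      congr 1
      push_cast
      ring
    rw [hval]
    refine hlim.congr fun n => ?_
    rw [charFun_apply, integral_map (hmeas _) (by fun_prop),
      ← integral_comp_measurePreserving hXμ (f := fun x => Complex.exp
        (((√((t n : ℝ) ^ d))⁻¹ * ∑ i, a i * (H i).centred P₀ (t n) (A i) x : ℝ) * Complex.I))]
    · refine integral_congr_ae (Eventually.of_forall fun ω => ?_)
      have hs : (t n : ℝ) ^ (-(d : ℝ) / 2) = (√((t n : ℝ) ^ d))⁻¹ := by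
        rw [Real.sqrt_eq_rpow, ← Real.rpow_natCast, ← Real.rpow_mul (hpos _).le,
          ← Real.rpow_neg (hpos _).le]
        congr 1
        ring
      simp only [Y, hmean, PiLp.inner_apply, hs, Finset.mul_sum, RCLike.inner_apply, conj_trivial]
      congr 3
      exact Finset.sum_congr rfl fun i _ => by ring
    · have : AEMeasurable (fun x => (√((t n : ℝ) ^ d))⁻¹
          * ∑ i, a i * (H i).centred P₀ (t n) (A i) x) μ :=
        (Finset.aemeasurable_fun_sum _ fun i _ =>
          (hcen i (t n)).1.aemeasurable.const_mul _).const_mul _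
      exact (Complex.measurable_exp.comp_aemeasurable
        ((Complex.measurable_ofReal.comp_aemeasurable this).mul_const _)).aestronglyMeasurable
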